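/- Let $n\ge 2$ and $\alpha>-1$. Let $\mathbb{B}^n$ be the open unit ball of $\mathbb{C}^n$, $\langle z,w\rangle=\sum_j z_j\overline{w_j}$, $v$ Lebesgue measure, and $$dv_\alpha(z)=c_\alpha(1-|z|^2)^\alpha\,dv(z),\qquad c_\alpha=\frac{\Gamma(n+\alpha+1)}{\Gamma(\alpha+1)\pi^n},$$ so that $v_\alpha(\mathbb{B}^n)=1$. The Bergman projection of $f\in L^\infty(\mathbb{B}^n)$ is $$P_\alpha f(z)=\int_{\mathbb{B}^n}\frac{f(w)}{(1-\langle z,w\rangle)^{n+\alpha+1}}\,dv_\alpha(w),\qquad z\in\mathbb{B}^n.$$ For $f$ holomorphic in $\mathbb{B}^n$ put $\nabla f=(\partial f/\partial z_1,\dots,\partial f/\partial z_n)$ and $\widetilde\nabla f(z)=\nabla(f\circ\varphi_z)(0)$, where $\varphi_z$ is an automorphism of $\mathbb{B}^n$ with $\varphi_z(0)=z$ (the length $|\widetilde\nabla f(z)|$ does not depend on its choice). Let $$\|f\|_{\widetilde\beta}=\sup_{|z|<1}|\widetilde\nabla f(z)|,\qquad \|f\|_{\widetilde{\mathcal B}}=|f(0)|+\|f\|_{\widetilde\beta};$$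 the Bloch space $\mathcal B$ consists of the holomorphic $f$ in $\mathbb{B}^n$ with $\|f\|_{\widetilde\beta}<\infty$. Let $\|P_\alpha\|_{\widetilde\beta}$ and $\|P_\alpha\|_{\widetilde{\mathcal B}}$ be the suprema of $\|P_\alpha f\|_{\widetilde\beta}$ and of $\|P_\alpha f\|_{\widetilde{\mathcal B}}$ over $\|f\|_{L^\infty}\le 1$. For $0\le t\le\frac{\pi}{2}$ let $$l(t)=(n+\alpha+1)\int_{\mathbb{B}^n}\frac{|(1-w_1)\cos t+w_2\sin t|}{|w_1-1|^{n+\alpha+1}}\,dv_\alpha(w).$$ Then $P_\alpha$ maps $L^\infty(\mathbb{B}^n)$ into $\mathcal B$, and $$\|P_\alpha\|_{\widetilde\beta}=\frac{\pi}{2}\,\frac{\Gamma(n+\alpha+2)}{\Gamma^2(\frac{n+\alpha}{2}+1)},\qquad \|P_\alpha\|_{\widetilde{\mathcal B}}=1+\frac{\pi}{2}\,\frac{\Gamma(n+\alpha+2)}{\Gamma^2(\frac{n+\alpha}{2}+1)}.$$ Moreover, the integral defining $l(t)$ converges for every $t\in[0,\frac{\pi}{2}]$, $$l(t)=\frac{\Gamma(n+\alpha+2)}{\Gamma^2(\frac{n+\alpha}{2}+1)}\,\sin^2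 t\,\sum_{m=0}^{\infty}\frac{\Gamma(m+\frac12)\Gamma(m+\frac32)}{(m!)^2}\cos^{2m}t,\qquad 0<t\le\frac{\pi}{2},$$ where the series converges, and $l$ is strictly increasing on $[0,\frac{\pi}{2}]$. -/

import Mathlib

open MeasureTheory Set
open scoped ENNReal

noncomputable section

namespace BergmanBloch

/-- Complex Euclidean space `ℂⁿ`. -/
abbrev Cn (n : ℕ) : Type := EuclideanSpace ℂ (Fin n)

/-- The open unit ball of `ℂⁿ`. -/
abbrev unitBall (n : ℕ) : Set (Cn n) := Metric.ball 0 1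

/-- The scalar product `⟨z, w⟩ = ∑ zᵢ conj(wᵢ)`, linear in the first variable. -/
def ip {n : ℕ} (z w : Cn n) : ℂ := inner ℂ w z

/-- Lebesgue measure on the unit ball. -/
def ballVolume (n : ℕ) : Measure (Cn n) := volume.restrict (unitBall n)

/-- The normalizing constant `c_α = Γ(n+α+1) / (Γ(α+1) πⁿ)`. -/
def cConst (n : ℕ) (α : ℝ) : ℝ :=
  Real.Gamma (n + α + 1) / (Real.Gamma (α + 1) * Real.pi ^ n)

/-- The weighted measure `dv_α(z) = c_α (1 - |z|²)^α dv(z)` on the unit ball. -/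
def weightedMeasure (n : ℕ) (α : ℝ) : Measure (Cn n) :=
  (ballVolume n).withDensity fun z => ENNReal.ofReal (cConst n α * (1 - ‖z‖ ^ 2) ^ α)

/-- The kernel `K_α(z,w) = (1 - ⟨z,w⟩)^{-(n+α+1)}` (principal branch; `Re (1 - ⟨z,w⟩) > 0` on the
ball). -/
def bergmanKernel (n : ℕ) (α : ℝ) (z w : Cn n) : ℂ :=
  1 / (1 - ip z w) ^ ((n + α + 1 : ℝ) : ℂ)

/-- `L^∞(𝔹ⁿ)`. -/
abbrev LInfty (n : ℕ) : Type := Lp ℂ ∞ (ballVolume n)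

/-- The Bergman projection `P_α f(z) = ∫ K_α(z,w) f(w) dv_α(w)`. -/
def bergmanProj (n : ℕ) (α : ℝ) (f : LInfty n) (z : Cn n) : ℂ :=
  ∫ w, bergmanKernel n α z w * f w ∂(weightedMeasure n α)

/-- The complex gradient `∇f(z) = (∂f/∂z₁, …, ∂f/∂zₙ)`. -/
def cgrad {n : ℕ} (f : Cn n → ℂ) (z : Cn n) : Cn n :=
  WithLp.toLp 2 fun i => fderiv ℂ f z (EuclideanSpace.single i 1)

/-- Automorphisms (biholomorphic self-maps) of the unit ball. -/
def IsBallAut {n : ℕ} (φ : Cn n → Cn n) : Prop :=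
  DifferentiableOn ℂ φ (unitBall n) ∧ MapsTo φ (unitBall n) (unitBall n) ∧
    ∃ ψ : Cn n → Cn n, DifferentiableOn ℂ ψ (unitBall n) ∧
      MapsTo ψ (unitBall n) (unitBall n) ∧ InvOn ψ φ (unitBall n) (unitBall n)

/-- The orthogonal projection of `w` onto the complex line spanned by `z` (zero if `z = 0`). -/
def lineProj {n : ℕ} (z w : Cn n) : Cn n := (ip w z / ((‖z‖ ^ 2 : ℝ) : ℂ)) • z

/-- The involutive automorphism `φ_z` of the ball that interchanges `0` and `z`:
`φ_z(w) = (z - P_z w - √(1-|z|²) (w - P_z w)) / (1 - ⟨w,z⟩)`. -/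
def ballAut {n : ℕ} (z w : Cn n) : Cn n :=
  (1 - ip w z)⁻¹ • (z - lineProj z w - ((√(1 - ‖z‖ ^ 2) : ℝ) : ℂ) • (w - lineProj z w))

theorem ip_lineProj {n : ℕ} (z w : Cn n) : ip (lineProj z w) z = ip w z := by
  rcases eq_or_ne z 0 with rfl | hz
  · simp [ip]
  · have : ((‖z‖ : ℝ) : ℂ) ≠ 0 := by simpa using hz
    simp only [lineProj, ip, inner_smul_right, inner_self_eq_norm_sq_to_K]
    push_cast
    simp only [Complex.coe_algebraMap]
    field_simp

theorem norm_sq_smul_lineProj {n : ℕ} (z w : Cn n) :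
    ((‖z‖ ^ 2 : ℝ) : ℂ) • lineProj z w = ip w z • z := by
  rcases eq_or_ne z 0 with rfl | hz
  · simp [lineProj]
  · have : ((‖z‖ ^ 2 : ℝ) : ℂ) ≠ 0 := by simpa using hz
    rw [lineProj, smul_smul, mul_div_cancel₀ _ this]

theorem one_sub_ip_ne_zero {n : ℕ} {z w : Cn n} (hz : z ∈ unitBall n) (hw : w ∈ unitBall n) :
    1 - ip w z ≠ 0 := by
  rw [mem_ball_zero_iff] at hz hw
  intro h
  have h1 : ‖ip w z‖ ≤ ‖z‖ * ‖w‖ := norm_inner_le_norm z w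
  rw [← sub_eq_zero.1 h, norm_one] at h1
  nlinarith [norm_nonneg z, norm_nonneg w]

theorem ballAut_zero {n : ℕ} (z : Cn n) : ballAut z 0 = z := by
  simp [ballAut, lineProj, ip]

theorem ballAut_mem {n : ℕ} {z w : Cn n} (hz : z ∈ unitBall n) (hw : w ∈ unitBall n) :
    ballAut z w ∈ unitBall n := by
  have hne := one_sub_ip_ne_zero hz hw
  rw [mem_ball_zero_iff] at hz hw ⊢
  have hA : 0 < 1 - ‖z‖ ^ 2 := by nlinarith [norm_nonneg z]
  have hB : 0 < 1 - ‖w‖ ^ 2 := by nlinarith [norm_nonneg w]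
  set x := lineProj z w with hx
  set s : ℝ := √(1 - ‖z‖ ^ 2) with hs
  have hs2 : s ^ 2 = 1 - ‖z‖ ^ 2 := Real.sq_sqrt hA.le
  have hxz : inner ℂ z x = ip w z := ip_lineProj z w
  have hyz : inner ℂ z (w - x) = 0 := by
    rw [inner_sub_right, hxz]; simp [ip]
  have hyx : inner ℂ x (w - x) = 0 := by
    have hx' : x = (ip w z / ((‖z‖ ^ 2 : ℝ) : ℂ)) • z := hx
    generalize w - x = y at hyz
    rw [hx', inner_smul_left, hyz, mul_zero]
  have e1 : ‖w‖ ^ 2 = ‖x‖ ^ 2 + ‖w - x‖ ^ 2 := by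
    have := norm_add_sq (𝕜 := ℂ) x (w - x)
    rw [hyx] at this
    simpa using this
  have e2 : ‖z - x - (s : ℂ) • (w - x)‖ ^ 2 = ‖z - x‖ ^ 2 + s ^ 2 * ‖w - x‖ ^ 2 := by
    have := norm_sub_sq (𝕜 := ℂ) (z - x) ((s : ℂ) • (w - x))
    rw [inner_smul_right, inner_sub_left, hyz, hyx, norm_smul, mul_pow] at this
    simpa using this
  have e3 : ‖z - x‖ ^ 2 = ‖z‖ ^ 2 - 2 * (ip w z).re + ‖x‖ ^ 2 := by
    have := norm_sub_sq (𝕜 := ℂ) z x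
    rw [hxz] at this
    simpa using this
  have e4 : ‖z‖ ^ 2 * ‖x‖ ^ 2 = ‖ip w z‖ ^ 2 := by
    rcases eq_or_ne z 0 with h0 | h0
    · simp [h0, ip]
    · have h := congrArg norm (norm_sq_smul_lineProj z w)
      rw [norm_smul, norm_smul, Complex.norm_real, Real.norm_of_nonneg (by positivity), ← hx] at h
      have h0' : ‖z‖ ≠ 0 := by simpa using h0
      have : ‖z‖ * ‖x‖ = ‖ip w z‖ := mul_right_cancel₀ h0' (by linarith [h])
      rw [← this, mul_pow]
  have e5 : ‖1 - ip w z‖ ^ 2 = 1 - 2 * (ip w z).re + ‖ip w z‖ ^ 2 := by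
    simp only [← Complex.normSq_eq_norm_sq, Complex.normSq_apply]
    simp
    ring
  have hpos : 0 < ‖1 - ip w z‖ := by simpa using hne
  have key : ‖z - x - (s : ℂ) • (w - x)‖ ^ 2 < ‖1 - ip w z‖ ^ 2 := by
    rw [e2, e3, e5, hs2]
    nlinarith [mul_pos hA hB]
  rw [ballAut, norm_smul, norm_inv, inv_mul_lt_iff₀ hpos, mul_one]
  exact lt_of_pow_lt_pow_left₀ 2 hpos.le key

theorem ballAut_ballAut {n : ℕ} {z w : Cn n} (hz : z ∈ unitBall n) (hw : w ∈ unitBall n) :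
    ballAut z (ballAut z w) = w := by
  have hne := one_sub_ip_ne_zero hz hw
  rw [mem_ball_zero_iff] at hz
  have hA : 0 < 1 - ‖z‖ ^ 2 := by nlinarith [norm_nonneg z]
  set a := ip w z with ha
  set x := lineProj z w with hx
  set s : ℂ := ((√(1 - ‖z‖ ^ 2) : ℝ) : ℂ) with hs
  set A : ℂ := ((‖z‖ ^ 2 : ℝ) : ℂ) with hAA
  have hs2 : s * s = 1 - A := by
    rw [hs, ← Complex.ofReal_mul, Real.mul_self_sqrt hA.le, hAA]; push_cast; ring
  have hA0 : 1 - A ≠ 0 := by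
    rw [hAA, ← Complex.ofReal_one, ← Complex.ofReal_sub]; exact_mod_cast hA.ne'
  have hzz : ip z z = A := by
    rw [ip, inner_self_eq_norm_sq_to_K, hAA]; push_cast; rfl
  have hxz : ip x z = a := ip_lineProj z w
  have hu : ip (ballAut z w) z = (1 - a)⁻¹ * (A - a) := by
    rw [ballAut]
    simp only [ip, inner_smul_right, inner_sub_right] at *
    rw [← hx, hxz, hzz, ← ha]; ring
  have hAx : A • x = a • z := norm_sq_smul_lineProj z w
  have hP : lineProj z (ballAut z w) = (1 - a)⁻¹ • (z - x) := by
    rw [lineProj, hu, hx, lineProj]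
    rcases eq_or_ne z 0 with h0 | h0
    · simp [h0]
    · have hA1 : A ≠ 0 := by simpa [hAA] using h0
      rw [← ha, ← hAA]
      match_scalars
      field_simp
  have hQ : ballAut z w - lineProj z (ballAut z w) = (-((1 - a)⁻¹ * s)) • (w - x) := by
    rw [hP, ballAut, ← hx, ← hs, ← ha]
    module
  have hden : (1 - (1 - a)⁻¹ * (A - a))⁻¹ = (1 - a) * (1 - A)⁻¹ := by
    have : 1 - (1 - a)⁻¹ * (A - a) = (1 - a)⁻¹ * (1 - A) := by field_simp; ring
    rw [this, mul_inv, inv_inv]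
  have hs3 : s • (-((1 - a)⁻¹ * s)) • (w - x) = -((1 - a)⁻¹ * (1 - A)) • (w - x) := by
    rw [smul_smul, ← hs2]; congr 1; ring
  rw [ballAut, hQ, hP, hu, hden, ← hs, hs3]
  have h1 : ((1 - a) * (1 - A)⁻¹) • (z - (1 - a)⁻¹ • (z - x) - -((1 - a)⁻¹ * (1 - A)) • (w - x))
      = (1 - A)⁻¹ • (A • x - a • z) + w := by
    match_scalars <;> field_simp <;> ring
  rw [h1, hAx, sub_self, smul_zero, zero_add]

theorem isBallAut_ballAut {n : ℕ} {z : Cn n} (hz : z ∈ unitBall n) : IsBallAut (ballAut z) := by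
  have hd : DifferentiableOn ℂ (ballAut z) (unitBall n) := by
    have h1 : Differentiable ℂ fun w : Cn n => ip w z := by
      unfold ip
      exact (innerSL ℂ z).differentiable
    have h2 : Differentiable ℂ fun w : Cn n => lineProj z w := by
      unfold lineProj
      simp only [div_eq_mul_inv]
      exact (h1.mul_const _).smul_const z
    intro w hw
    refine DifferentiableAt.differentiableWithinAt ?_
    unfold ballAut
    refine DifferentiableAt.smul (((h1 w).const_sub 1).inv (one_sub_ip_ne_zero hz hw)) ?_
    exact ((h2 w).const_sub z).sub ((differentiableAt_fun_id.fun_sub (h2 w)).fun_const_smul _)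
  exact ⟨hd, fun w hw => ballAut_mem hz hw, ballAut z, hd, fun w hw => ballAut_mem hz hw,
    fun w hw => ballAut_ballAut hz hw, fun w hw => ballAut_ballAut hz hw⟩

/-- The invariant gradient `∇̃f(z) = ∇(f ∘ φ_z)(0)`. -/
def invGrad {n : ℕ} (f : Cn n → ℂ) (z : Cn n) : Cn n := cgrad (f ∘ ballAut z) 0

/-- The Euclidean norm of the gradient is the operator norm of the derivative. -/
theorem norm_cgrad {n : ℕ} (f : Cn n → ℂ) (z : Cn n) : ‖cgrad f z‖ = ‖fderiv ℂ f z‖ := by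
  set L := fderiv ℂ f z with hL
  set g : Cn n := (InnerProductSpace.toDual ℂ (Cn n)).symm L with hg
  have h1 : ‖g‖ = ‖L‖ := LinearIsometryEquiv.norm_map _ _
  rw [← h1, EuclideanSpace.norm_eq, EuclideanSpace.norm_eq]
  congr 1
  refine Finset.sum_congr rfl fun i _ => ?_
  have h2 : inner ℂ g (EuclideanSpace.single i (1 : ℂ)) = L (EuclideanSpace.single i 1) :=
    InnerProductSpace.toDual_symm_apply
  rw [EuclideanSpace.inner_single_right] at h2
  have h3 : cgrad f z i = L (EuclideanSpace.single i 1) := rfl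
  rw [h3, ← h2]
  simp

theorem norm_cgrad_comp_le {n : ℕ} {f : Cn n → ℂ} (hf : DifferentiableOn ℂ f (unitBall n))
    {φ ψ : Cn n → Cn n} (hφ : IsBallAut φ) (hψ : IsBallAut ψ) (h : φ 0 = ψ 0) :
    ‖cgrad (f ∘ φ) 0‖ ≤ ‖cgrad (f ∘ ψ) 0‖ := by
  obtain ⟨hφd, hφm, -⟩ := hφ
  obtain ⟨hψd, hψm, χ, hχd, hχm, hl, hr⟩ := hψ
  have h0 : (0 : Cn n) ∈ unitBall n := by simp
  have hgd : DifferentiableOn ℂ (χ ∘ φ) (unitBall n) := hχd.comp hφd hφm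
  have hgm : MapsTo (χ ∘ φ) (unitBall n) (unitBall n) := hχm.comp hφm
  have hg0 : (χ ∘ φ) 0 = 0 := by
    simp only [Function.comp_apply, h]
    exact hl h0
  have hnh : unitBall n ∈ nhds (0 : Cn n) := Metric.isOpen_ball.mem_nhds h0
  have hS : ‖fderiv ℂ (χ ∘ φ) 0‖ ≤ 1 :=
    Complex.norm_fderiv_le_one_of_mapsTo_ball hgd
      (by rw [hg0]; exact hgm.mono_right Metric.ball_subset_closedBall) one_pos
  have heq : f ∘ φ =ᶠ[nhds 0] (f ∘ ψ) ∘ (χ ∘ φ) := by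
    filter_upwards [hnh] with w hw
    simp only [Function.comp_apply]
    rw [hr (hφm hw)]
  have hfψ : DifferentiableAt ℂ (f ∘ ψ) ((χ ∘ φ) 0) := by
    rw [hg0]
    exact (hf.comp hψd hψm).differentiableAt hnh
  rw [norm_cgrad, norm_cgrad, heq.fderiv_eq, fderiv_comp _ hfψ (hgd.differentiableAt hnh), hg0]
  refine (ContinuousLinearMap.opNorm_comp_le _ _).trans ?_
  exact mul_le_of_le_one_right (norm_nonneg _) hS

/-- For holomorphic `f`, the length of the invariant gradient does not depend on the choice of the
automorphism that sends `0` to `z`. -/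
theorem norm_invGrad_eq {n : ℕ} {f : Cn n → ℂ} (hf : DifferentiableOn ℂ f (unitBall n))
    {z : Cn n} (hz : z ∈ unitBall n) {φ : Cn n → Cn n} (hφ : IsBallAut φ) (h : φ 0 = z) :
    ‖invGrad f z‖ = ‖cgrad (f ∘ φ) 0‖ :=
  le_antisymm
    (norm_cgrad_comp_le hf (isBallAut_ballAut hz) hφ (by rw [ballAut_zero, h]))
    (norm_cgrad_comp_le hf hφ (isBallAut_ballAut hz) (by rw [ballAut_zero, h]))

/-- The semi-norm `‖f‖_β̃ = sup_{|z|<1} |∇̃f(z)|`, with values in `[0,∞]`. -/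
def blochSeminorm {n : ℕ} (f : Cn n → ℂ) : ℝ≥0∞ := ⨆ z ∈ unitBall n, ‖invGrad f z‖ₑ

/-- The norm `|f(0)| + ‖f‖_β̃`, with values in `[0,∞]`. -/
def blochNorm {n : ℕ} (f : Cn n → ℂ) : ℝ≥0∞ := ‖f 0‖ₑ + blochSeminorm f

/-- Membership in the Bloch space: `f` is holomorphic in the ball and `‖f‖_β̃ < ∞`. -/
def MemBloch {n : ℕ} (f : Cn n → ℂ) : Prop :=
  DifferentiableOn ℂ f (unitBall n) ∧ blochSeminorm f < ∞

/-- The operator norm of `P_α : L^∞ → 𝓑` with respect to the semi-norm `‖·‖_β̃`. -/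
def projSeminorm (n : ℕ) (α : ℝ) : ℝ≥0∞ :=
  ⨆ (f : LInfty n) (_ : ‖f‖ ≤ 1), blochSeminorm (bergmanProj n α f)

/-- The operator norm of `P_α : L^∞ → 𝓑` with respect to the norm `|f(0)| + ‖f‖_β̃`. -/
def projNorm (n : ℕ) (α : ℝ) : ℝ≥0∞ :=
  ⨆ (f : LInfty n) (_ : ‖f‖ ≤ 1), blochNorm (bergmanProj n α f)

/-- The integrand `|(1 - w₁) cos t + w₂ sin t| / |w₁ - 1|^{n+α+1}`. -/
def lIntegrand (n : ℕ) (hn : 2 ≤ n) (α t : ℝ) (w : Cn n) : ℝ :=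
  ‖(1 - w ⟨0, by omega⟩) * (Real.cos t : ℂ) + w ⟨1, by omega⟩ * (Real.sin t : ℂ)‖ /
    ‖w ⟨0, by omega⟩ - 1‖ ^ (n + α + 1)

/-- `l(t) = (n+α+1) ∫ |(1 - w₁) cos t + w₂ sin t| / |w₁ - 1|^{n+α+1} dv_α(w)`. -/
def lFun (n : ℕ) (hn : 2 ≤ n) (α t : ℝ) : ℝ :=
  (n + α + 1) * ∫ w, lIntegrand n hn α t w ∂(weightedMeasure n α)

/-- `C_α = Γ(n+α+2) / Γ((n+α)/2+1)²`. -/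
def CConst (n : ℕ) (α : ℝ) : ℝ :=
  Real.Gamma (n + α + 2) / Real.Gamma ((n + α) / 2 + 1) ^ 2

/-- The coefficients `Γ(m+1/2) Γ(m+3/2) / (m!)²`. -/
def coeffA (m : ℕ) : ℝ :=
  Real.Gamma (m + 1 / 2) * Real.Gamma (m + 3 / 2) / (m.factorial : ℝ) ^ 2

end BergmanBloch

end

noncomputable section

namespace BergmanBloch

/-! ### Lebesgue measure on `ℂ` and `ℂⁿ` -/

/-! Differentiating under the integral, the derivative of `P_α f ∘ φ_z` at `0` in a unit direction
`ζ` is the integral of `f` against `κ(w) = (n+α+1) (1-⟨z,w⟩)^{-(n+α+2)} ⟨φ_z'(0)ζ, w⟩`. The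
semi-norm of `P_α` is therefore governed by the `L¹(v_α)` norm of `κ`, maximized over `z` and `ζ`.

A unitary map reduces to `z = r e₁` and `ζ = c (k e₁ + s e₂)` with `|c| = 1`, `k² + s² = 1`. Then
`|κ|` depends on two coordinates, and integrating out the others leaves the weight of exponent `β =
n+α-2` on the ball of `ℂ²`. A Möbius substitution cancels every power of `1-r²` and yields
`ballIntegral β k s r` (`lintegral_kernel_eq_ballIntegral`). Rotation invariance allows `r` to be
replaced by any `μ` on the circle of radius `r`; for fixed `(u,v)` the integrand is then the modulus
of a function holomorphic in `μ`, whose circular means are at most the mean over `|μ| = 1`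
(`ballIntegral_le_one`).

At `r = 1` the substitution `v = (1-u)z` separates the variables: the `u`-integral runs over a disc
tangent to the unit circle at `1` and gives a constant times `(1+|z|²)^{-2}`, and the `z`-integral
of `|k+sz| (1+|z|²)^{-2}` is `π E(k)`, with `E` the complete elliptic integral of the second kind
(`ballIntegral_one`). For `k = cos t` this same integral is `l(t)` up to its factor, so `l(t) = C_α
E(cos t)` (`lFun_eq`). Since `E ≤ E(0) = π/2`, the upper bound follows; since `E` is strictly
decreasing on `[0,1]`, `l` is strictly increasing. The series comes from `E(k) = (1-k²) · ½ ∫₀^π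
(1-k² sin² θ)^{-3/2} dθ` and the binomial series.

For sharpness take `k = 0` (a direction orthogonal to `z`) and let `r → 1`: by Fatou the `L¹` norms
approach `(π/2) C_α`, while `κ` tends to `0` uniformly away from the boundary point `e₁`. A single
`f` that aligns the phase of `κ` near `e₁` and equals `1` elsewhere makes the gradient nearly
maximal and `P_α f(0)` nearly `1` at once (`ofReal_one_add_le_projNorm`). Together with `|P_α f(0)|
≤ 1` this determines both norms. -/

theorem volume_fundamentalDomain_basisOneI_pi (n : ℕ) :
    volume (ZSpan.fundamentalDomain (Pi.basis fun _ : Fin n => Complex.basisOneI)) = 1 := by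
  have : ZSpan.fundamentalDomain (Pi.basis fun _ : Fin n => Complex.basisOneI) =
      Set.univ.pi fun _ : Fin n =>
        Complex.measurableEquivPi ⁻¹' (Set.univ.pi fun _ : Fin 2 => Ico (0 : ℝ) 1) := by
    ext x
    simp only [ZSpan.mem_fundamentalDomain, Set.mem_pi, Set.mem_preimage, Sigma.forall,
      Pi.basis_repr, Set.mem_univ, true_imp_iff, Fin.forall_fin_two]
    simp [Complex.measurableEquivPi_apply]
  rw [this, volume_pi_pi, Finset.prod_congr rfl
    (fun _ _ => Complex.volume_preserving_equiv_pi.measure_preimage_equiv _)]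
  simp [volume_pi_pi]

/-- The volume of `ℂⁿ` as an inner product space is the product measure. -/
theorem volume_preserving_ofLp (n : ℕ) :
    MeasurePreserving (WithLp.ofLp : Cn n → Fin n → ℂ) := by
  let e : Cn n ≃L[ℝ] (Fin n → ℂ) := (WithLp.linearEquiv 2 ℝ (Fin n → ℂ)).toContinuousLinearEquiv
  have he : (WithLp.ofLp : Cn n → Fin n → ℂ) = e := rfl
  refine ⟨e.continuous.measurable, ?_⟩
  let b : OrthonormalBasis (Σ _ : Fin n, Fin 2) ℝ (Cn n) :=
    Pi.orthonormalBasis fun _ : Fin n => Complex.orthonormalBasisOneI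
  have hb : b.toBasis.map e.toLinearEquiv = Pi.basis fun _ : Fin n => Complex.basisOneI := by
    ext
    rfl
  -- Both sides are Haar measures, so it is enough to compare them on one parallelepiped, which
  -- agrees up to a null set with the half-open fundamental domain.
  rw [he, ← b.addHaar_eq_volume, Module.Basis.map_addHaar, hb, Module.Basis.addHaar_eq_iff,
    Module.Basis.coe_parallelepiped,
    ← measure_congr (ZSpan.fundamentalDomain_ae_parallelepiped _ volume),
    volume_fundamentalDomain_basisOneI_pi]

theorem measurePreserving_unitary {n : ℕ} (U : Cn n ≃ₗᵢ[ℂ] Cn n) : MeasurePreserving U := by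
  let V : Cn n ≃ₗᵢ[ℝ] Cn n := ⟨U.toLinearEquiv.restrictScalars ℝ, U.norm_map⟩
  exact V.measurePreserving

/-- As a real linear map, multiplication by `a` has determinant `|a|²`. Nearly all later
substitutions (rotations, dilations, `v = (1-u)z`) are instances of this. -/
theorem lintegral_comp_mul_left_complex {a : ℂ} (ha : a ≠ 0) (f : ℂ → ℝ≥0∞) :
    ∫⁻ z, f z = ENNReal.ofReal (‖a‖ ^ 2) * ∫⁻ z, f (a * z) := by
  have hdet : LinearMap.det (LinearMap.mulLeft ℝ a) = ‖a‖ ^ 2 := by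
    have : LinearMap.det (LinearMap.mulLeft ℝ a) = Algebra.norm ℝ a := rfl
    rw [this, Algebra.norm_complex_apply, Complex.normSq_eq_norm_sq]
  have ha' : 0 < ‖a‖ ^ 2 := by positivity
  have h := Measure.map_linearMap_addHaar_eq_smul_addHaar (volume : Measure ℂ)
    (f := LinearMap.mulLeft ℝ a) (by rw [hdet]; exact ha'.ne')
  have h2 : ∫⁻ z, f (a * z) = ∫⁻ z, f z ∂(Measure.map (LinearMap.mulLeft ℝ a) volume) :=
    (lintegral_map_equiv f (MeasurableEquiv.mulLeft₀ a ha)).symm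
  rw [h2, h, lintegral_smul_measure, hdet, smul_eq_mul, ← mul_assoc,
    abs_of_pos (inv_pos.2 ha'), ← ENNReal.ofReal_mul ha'.le, mul_inv_cancel₀ ha'.ne',
    ENNReal.ofReal_one, one_mul]

theorem lintegral_complex_eq_polar {f : ℂ → ℝ≥0∞} (hf : Measurable f) :
    ∫⁻ z, f z = ∫⁻ θ in Ioo (-Real.pi) Real.pi, ∫⁻ r in Ioi (0 : ℝ),
      ENNReal.ofReal r * f (r * (Real.cos θ + Real.sin θ * Complex.I)) := by
  rw [← Complex.lintegral_comp_polarCoord_symm, polarCoord_target, Measure.volume_eq_prod,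
    ← Measure.prod_restrict, lintegral_prod_symm]
  · simp [Complex.polarCoord_symm_apply]
  · simp only [Complex.polarCoord_symm_apply]
    fun_prop

theorem lintegral_complex_norm_sq {g : ℝ → ℝ≥0∞} (hg : Measurable g) :
    ∫⁻ z : ℂ, g (‖z‖ ^ 2) = ENNReal.ofReal Real.pi * ∫⁻ x in Ioi (0 : ℝ), g x := by
  rw [lintegral_complex_eq_polar (by fun_prop)]
  have h1 : ∀ θ r : ℝ, ‖(r * (Real.cos θ + Real.sin θ * Complex.I) : ℂ)‖ ^ 2 = r ^ 2 := by
    intro θ r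
    rw [norm_mul, mul_pow, Complex.norm_real, Real.norm_eq_abs, sq_abs, Complex.ofReal_cos,
      Complex.ofReal_sin, ← Complex.exp_mul_I, Complex.norm_exp_ofReal_mul_I, one_pow, mul_one]
  simp only [h1, lintegral_const]
  have h2 : (fun r : ℝ => r ^ 2) '' Ioi 0 = Ioi 0 := by
    ext x
    constructor
    · rintro ⟨y, hy, rfl⟩
      exact pow_pos (mem_Ioi.1 hy) 2
    · intro hx
      exact ⟨√x, Real.sqrt_pos.2 hx, Real.sq_sqrt (le_of_lt hx)⟩
  have h3 := lintegral_image_eq_lintegral_abs_deriv_mul (f := fun r : ℝ => r ^ 2)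
    (f' := fun r => 2 * r) measurableSet_Ioi
    (fun x _ => by simpa using ((hasDerivAt_pow 2 x).hasDerivWithinAt (s := Ioi 0)))
    (fun x hx y hy hxy => by
      exact (pow_left_inj₀ (le_of_lt hx) (le_of_lt hy) two_ne_zero).1 hxy) g
  rw [h2] at h3
  have h4 : ∀ x ∈ Ioi (0 : ℝ), ENNReal.ofReal |2 * x| * g (x ^ 2) =
      2 * (ENNReal.ofReal x * g (x ^ 2)) := by
    intro x hx
    rw [abs_of_pos (mul_pos two_pos hx), ENNReal.ofReal_mul zero_le_two, mul_assoc]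
    simp
  rw [h3, setLIntegral_congr_fun measurableSet_Ioi h4, lintegral_const_mul _ (by fun_prop),
    ← mul_assoc, mul_comm]
  congr 1
  rw [Measure.restrict_apply_univ, Real.volume_Ioo, mul_comm, sub_neg_eq_add, ← two_mul,
    ENNReal.ofReal_mul zero_le_two]
  simp [mul_comm]

/-! ### Truncated powers -/

/-- The truncated power `x₊^β` with values in `[0,∞]`. -/
def posPow (β x : ℝ) : ℝ≥0∞ := if 0 < x then ENNReal.ofReal (x ^ β) else 0

@[fun_prop]
theorem measurable_posPow (β : ℝ) : Measurable (posPow β) := by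
  unfold posPow
  exact Measurable.ite measurableSet_Ioi (by fun_prop) measurable_const

theorem posPow_of_pos {β x : ℝ} (hx : 0 < x) : posPow β x = ENNReal.ofReal (x ^ β) := if_pos hx

theorem posPow_of_nonpos {β x : ℝ} (hx : x ≤ 0) : posPow β x = 0 := if_neg hx.not_gt

/-- With truncated powers the domain of integration sits inside the integrand, so this homogeneity
lets a substitution transform the domain and the weight in one stroke. -/
theorem posPow_mul {β c x : ℝ} (hc : 0 < c) :
    posPow β (c * x) = ENNReal.ofReal (c ^ β) * posPow β x := by
  rcases lt_or_ge 0 x with hx | hx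
  · rw [posPow_of_pos hx, posPow_of_pos (mul_pos hc hx), Real.mul_rpow hc.le hx.le,
      ENNReal.ofReal_mul (by positivity)]
  · rw [posPow_of_nonpos hx, posPow_of_nonpos (mul_nonpos_of_nonneg_of_nonpos hc.le hx), mul_zero]

theorem lintegral_posPow_sub {β : ℝ} (hβ : -1 < β) (R : ℝ) :
    ∫⁻ x in Ioi (0 : ℝ), posPow β (R - x) = ENNReal.ofReal (1 / (β + 1)) * posPow (β + 1) R := by
  rcases le_or_gt R 0 with hR | hR
  · rw [posPow_of_nonpos hR, mul_zero, setLIntegral_congr_fun (g := fun _ => 0) measurableSet_Ioi]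
    · simp
    · intro x hx
      exact posPow_of_nonpos (by have : 0 < x := hx; linarith)
  · rw [posPow_of_pos hR, ← ENNReal.ofReal_mul (by have : 0 < β + 1 := by linarith
                                                   positivity)]
    have hi : IntervalIntegrable (fun x : ℝ => (R - x) ^ β) volume 0 R := by
      have := (intervalIntegral.intervalIntegrable_rpow' (a := 0) (b := R) hβ).comp_sub_left R
      simpa using this.symm
    have h1 : ∫ x in (0 : ℝ)..R, (R - x) ^ β = 1 / (β + 1) * R ^ (β + 1) := by
      rw [intervalIntegral.integral_comp_sub_left (fun x => x ^ β), integral_rpow (Or.inl hβ)]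
      simp [Real.zero_rpow (by linarith : β + 1 ≠ 0)]
      ring
    rw [← h1, intervalIntegral.integral_of_le hR.le, ofReal_integral_eq_lintegral_ofReal]
    · have h2 : ∀ x ∈ Ioi (0 : ℝ), posPow β (R - x) =
          (Ioo 0 R).indicator (fun x => ENNReal.ofReal ((R - x) ^ β)) x := by
        intro x hx
        by_cases h : x < R
        · rw [indicator_of_mem (show x ∈ Ioo 0 R from ⟨hx, h⟩), posPow_of_pos (by linarith)]
        · rw [indicator_of_notMem (fun h' => h h'.2), posPow_of_nonpos (by linarith)]
      rw [setLIntegral_congr_fun measurableSet_Ioi h2, setLIntegral_indicator measurableSet_Ioo,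
        inter_eq_left.2 Ioo_subset_Ioi_self]
      exact setLIntegral_congr Ioo_ae_eq_Ioc
    · exact (intervalIntegrable_iff_integrableOn_Ioc_of_le hR.le).1 hi
    · filter_upwards [ae_restrict_mem measurableSet_Ioc] with x hx
      exact Real.rpow_nonneg (by linarith [hx.2]) _

theorem lintegral_posPow_sub_norm_sq {β : ℝ} (hβ : -1 < β) (R : ℝ) :
    ∫⁻ z : ℂ, posPow β (R - ‖z‖ ^ 2) = ENNReal.ofReal (Real.pi / (β + 1)) * posPow (β + 1) R := by
  rw [lintegral_complex_norm_sq (g := fun x => posPow β (R - x)) (by fun_prop),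
    lintegral_posPow_sub hβ, ← mul_assoc, ← ENNReal.ofReal_mul Real.pi_pos.le, mul_one_div]

theorem lintegral_pi_succ {m : ℕ} {f : (Fin (m + 1) → ℂ) → ℝ≥0∞} (hf : Measurable f) :
    ∫⁻ u, f u = ∫⁻ x : ℂ, ∫⁻ y : Fin m → ℂ, f (Fin.cons x y) := by
  rw [← ((volume_preserving_piFinSuccAbove (fun _ : Fin (m + 1) => ℂ) 0).symm).lintegral_comp_emb
    (MeasurableEquiv.measurableEmbedding _), Measure.volume_eq_prod, lintegral_prod]
  · simp [MeasurableEquiv.piFinSuccAbove_symm_apply, Fin.insertNthEquiv]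
  · fun_prop

/-- Each complex coordinate integrated out raises the exponent by one and contributes `π` over the
new exponent; these factors telescope into a quotient of Gamma values. -/
theorem lintegral_pi_posPow_sub_sum {α : ℝ} (hα : -1 < α) (m : ℕ) (R : ℝ) :
    ∫⁻ u : Fin m → ℂ, posPow α (R - ∑ i, ‖u i‖ ^ 2) =
      ENNReal.ofReal (Real.pi ^ m * Real.Gamma (α + 1) / Real.Gamma (α + m + 1)) *
        posPow (α + m) R := by
  induction m generalizing R with
  | zero =>
    have h : Real.Gamma (α + 1) ≠ 0 := (Real.Gamma_pos_of_pos (by linarith)).ne'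
    simp [volume_pi, div_self h]
  | succ m ih =>
    have hm : (0 : ℝ) ≤ m := m.cast_nonneg
    rw [lintegral_pi_succ (by fun_prop)]
    · have h : ∀ (x : ℂ) (y : Fin m → ℂ),
          posPow α (R - ∑ i, ‖(Fin.cons x y : Fin (m + 1) → ℂ) i‖ ^ 2) =
          posPow α (R - ‖x‖ ^ 2 - ∑ i, ‖y i‖ ^ 2) := by
        intro x y
        simp [Fin.sum_univ_succ, sub_sub]
      simp only [h, ih]
      rw [lintegral_const_mul _ (by fun_prop), lintegral_posPow_sub_norm_sq (by linarith),
        ← mul_assoc, ← ENNReal.ofReal_mul]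
      · congr 2
        · rw [show α + ((m + 1 : ℕ) : ℝ) + 1 = (α + m + 1) + 1 by push_cast; ring,
            Real.Gamma_add_one (by linarith : α + m + 1 ≠ 0)]
          have : Real.Gamma (α + m + 1) ≠ 0 := (Real.Gamma_pos_of_pos (by linarith)).ne'
          have : α + m + 1 ≠ 0 := by linarith
          field_simp
          ring
        · push_cast; ring
      · have h1 := Real.Gamma_pos_of_pos (by linarith : 0 < α + 1)
        have h2 := Real.Gamma_pos_of_pos (by linarith : 0 < α + m + 1)
        positivity

/-- The measure of `ℂⁿ` with density `(1 - |z|²)₊^α`, in terms of the first two coordinates. -/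
theorem lintegral_weightedMeasure_two {n : ℕ} (hn : 2 ≤ n) {α : ℝ} (hα : -1 < α)
    {h : ℂ → ℂ → ℝ≥0∞} (hh : Measurable fun p : ℂ × ℂ => h p.1 p.2) :
    ∫⁻ w, h (w ⟨0, by omega⟩) (w ⟨1, by omega⟩) ∂(weightedMeasure n α) =
      ENNReal.ofReal (Real.Gamma (n + α + 1) / (Real.Gamma (n + α - 1) * Real.pi ^ 2)) *
        ∫⁻ a, ∫⁻ b, h a b * posPow (n + α - 2) (1 - ‖a‖ ^ 2 - ‖b‖ ^ 2) := by
  obtain ⟨m, rfl⟩ : ∃ m, n = m + 1 + 1 := ⟨n - 2, by omega⟩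
  have hm : (0 : ℝ) ≤ m := m.cast_nonneg
  have hc : 0 ≤ cConst (m + 1 + 1) α := by
    have h1 := Real.Gamma_pos_of_pos (by linarith : 0 < α + 1)
    have h2 := Real.Gamma_pos_of_pos (by push_cast; linarith : 0 < ((m + 1 + 1 : ℕ) : ℝ) + α + 1)
    unfold cConst
    positivity
  -- The ball and the density merge into one truncated power on all of `ℂⁿ`, so coordinates can be
  -- split off by Tonelli.
  have hw : ∀ w : Cn (m + 1 + 1), (unitBall (m + 1 + 1)).indicator
      (fun z => ENNReal.ofReal (cConst (m + 1 + 1) α * (1 - ‖z‖ ^ 2) ^ α)) w =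
      ENNReal.ofReal (cConst (m + 1 + 1) α) * posPow α (1 - ∑ i, ‖w i‖ ^ 2) := by
    intro w
    rw [← EuclideanSpace.norm_sq_eq]
    by_cases hw : w ∈ unitBall (m + 1 + 1)
    · rw [indicator_of_mem hw, posPow_of_pos, ENNReal.ofReal_mul hc]
      rw [mem_ball_zero_iff] at hw
      nlinarith [norm_nonneg w]
    · rw [indicator_of_notMem hw, posPow_of_nonpos, mul_zero]
      rw [mem_ball_zero_iff, not_lt] at hw
      nlinarith [norm_nonneg w]
  have hm0 : Measurable fun w : Cn (m + 1 + 1) =>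
      h (w ⟨0, by omega⟩) (w ⟨1, by omega⟩) :=
    hh.comp (Measurable.prodMk (by fun_prop) (by fun_prop))
  have hm1 : Measurable fun w : Cn (m + 1 + 1) =>
      ENNReal.ofReal (cConst (m + 1 + 1) α * (1 - ‖w‖ ^ 2) ^ α) := by fun_prop
  rw [weightedMeasure, lintegral_withDensity_eq_lintegral_mul _ hm1 hm0, ballVolume,
    ← lintegral_indicator measurableSet_ball]
  have hi : ∀ w : Cn (m + 1 + 1), (unitBall (m + 1 + 1)).indicator
      ((fun w => ENNReal.ofReal (cConst (m + 1 + 1) α * (1 - ‖w‖ ^ 2) ^ α)) *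
        fun w => h (w ⟨0, by omega⟩) (w ⟨1, by omega⟩)) w =
      ENNReal.ofReal (cConst (m + 1 + 1) α) * posPow α (1 - ∑ i, ‖w i‖ ^ 2) *
        h (w ⟨0, by omega⟩) (w ⟨1, by omega⟩) := by
    intro w
    rw [← hw]
    exact indicator_mul_left ..
  rw [lintegral_congr hi]
  have hmf : Measurable fun w : Fin (m + 1 + 1) → ℂ => ENNReal.ofReal (cConst (m + 1 + 1) α) *
      posPow α (1 - ∑ i, ‖w i‖ ^ 2) * h (w ⟨0, by omega⟩) (w ⟨1, by omega⟩) :=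
    Measurable.mul (by fun_prop) (hh.comp (Measurable.prodMk (by fun_prop) (by fun_prop)))
  refine ((volume_preserving_ofLp (m + 1 + 1)).lintegral_comp hmf).trans ?_
  rw [lintegral_pi_succ hmf]
  have hinner : ∀ a : ℂ, ∫⁻ y : Fin (m + 1) → ℂ, ENNReal.ofReal (cConst (m + 1 + 1) α) *
      posPow α (1 - ∑ i, ‖(Fin.cons a y : Fin (m + 1 + 1) → ℂ) i‖ ^ 2) *
        h ((Fin.cons a y : Fin (m + 1 + 1) → ℂ) ⟨0, by omega⟩)
          ((Fin.cons a y : Fin (m + 1 + 1) → ℂ) ⟨1, by omega⟩) =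
      ENNReal.ofReal (Real.Gamma ((m + 1 + 1 : ℕ) + α + 1) /
        (Real.Gamma ((m + 1 + 1 : ℕ) + α - 1) * Real.pi ^ 2)) *
        ∫⁻ b, h a b * posPow ((m + 1 + 1 : ℕ) + α - 2) (1 - ‖a‖ ^ 2 - ‖b‖ ^ 2) := by
    intro a
    have hcons : Measurable fun y : Fin (m + 1) → ℂ => (Fin.cons a y : Fin (m + 1 + 1) → ℂ) := by
      refine measurable_pi_lambda _ fun i => ?_
      refine Fin.cases ?_ (fun j => ?_) i
      · simp
      · simpa using measurable_pi_apply j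
    refine (lintegral_pi_succ (hmf.comp hcons)).trans ?_
    simp only [Function.comp_apply]
    have hb : Measurable fun b => h a b := hh.comp (Measurable.prodMk (by fun_prop) (by fun_prop))
    have h3 : ∀ (b : ℂ) (y : Fin m → ℂ), ENNReal.ofReal (cConst (m + 1 + 1) α) *
        posPow α (1 - ∑ i, ‖(Fin.cons a (Fin.cons b y : Fin (m + 1) → ℂ) :
          Fin (m + 1 + 1) → ℂ) i‖ ^ 2) *
        h ((Fin.cons a (Fin.cons b y : Fin (m + 1) → ℂ) : Fin (m + 1 + 1) → ℂ) ⟨0, by omega⟩)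
          ((Fin.cons a (Fin.cons b y : Fin (m + 1) → ℂ) : Fin (m + 1 + 1) → ℂ) ⟨1, by omega⟩) =
        ENNReal.ofReal (cConst (m + 1 + 1) α) * h a b *
          posPow α (1 - ‖a‖ ^ 2 - ‖b‖ ^ 2 - ∑ i, ‖y i‖ ^ 2) := by
      intro b y
      have h0 : (Fin.cons a (Fin.cons b y : Fin (m + 1) → ℂ) : Fin (m + 1 + 1) → ℂ)
        ⟨0, by omega⟩ = a := rfl
      have h1 : (Fin.cons a (Fin.cons b y : Fin (m + 1) → ℂ) : Fin (m + 1 + 1) → ℂ)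
        ⟨1, by omega⟩ = b := rfl
      rw [h0, h1, Fin.sum_univ_succ, Fin.sum_univ_succ]
      simp only [Fin.cons_zero, Fin.cons_succ, sub_sub, add_assoc]
      ring
    simp only [h3]
    rw [← lintegral_const_mul _ (by fun_prop)]
    refine lintegral_congr fun b => ?_
    rw [lintegral_const_mul _ (by fun_prop), lintegral_pi_posPow_sub_sum hα,
      show α + m = ((m + 1 + 1 : ℕ) : ℝ) + α - 2 by push_cast; ring]
    -- The normalization `c_α` times the constant from the `m = n - 2` remaining coordinates:
    -- `Γ(α+1)` and `π^m` cancel.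
    have h4 : Real.Gamma ((m + 1 + 1 : ℕ) + α + 1) /
        (Real.Gamma ((m + 1 + 1 : ℕ) + α - 1) * Real.pi ^ 2) = cConst (m + 1 + 1) α *
          (Real.pi ^ m * Real.Gamma (α + 1) / Real.Gamma (((m + 1 + 1 : ℕ) : ℝ) + α - 2 + 1)) := by
      rw [cConst, show ((m + 1 + 1 : ℕ) : ℝ) + α - 2 + 1 = ((m + 1 + 1 : ℕ) : ℝ) + α - 1 by ring]
      have h1 := (Real.Gamma_pos_of_pos (by linarith : 0 < α + 1)).ne'
      have h2 := (Real.Gamma_pos_of_pos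
        (by push_cast; linarith : 0 < ((m + 1 + 1 : ℕ) : ℝ) + α - 1)).ne'
      have := Real.pi_pos.ne'
      rw [pow_add, pow_add]
      field_simp
    rw [h4, ENNReal.ofReal_mul hc]
    ring
  simp only [hinner]
  refine lintegral_const_mul _ ?_
  have : Measurable fun p : ℂ × ℂ => h p.1 p.2 *
      posPow ((m + 1 + 1 : ℕ) + α - 2) (1 - ‖p.1‖ ^ 2 - ‖p.2‖ ^ 2) :=
    hh.mul (by fun_prop)
  exact this.lintegral_prod_right'

/-! ### Gaussian integrals -/

theorem lintegral_complex_re_im {f : ℂ → ℝ≥0∞} (hf : Measurable f) :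
    ∫⁻ z, f z = ∫⁻ x : ℝ, ∫⁻ y : ℝ, f (x + y * Complex.I) := by
  rw [← (Complex.volume_preserving_equiv_real_prod.symm).lintegral_comp_emb
    (MeasurableEquiv.measurableEmbedding _), Measure.volume_eq_prod, lintegral_prod]
  · refine lintegral_congr fun x => lintegral_congr fun y => ?_
    rw [← Complex.mk_eq_add_mul_I]
    rfl
  · fun_prop

theorem lintegral_rpow_mul_exp_neg_mul_sq {q b : ℝ} (hq : -1 < q) (hb : 0 < b) :
    ∫⁻ x in Ioi (0 : ℝ), ENNReal.ofReal (x ^ q * Real.exp (-b * x ^ 2)) =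
      ENNReal.ofReal (b ^ (-(q + 1) / 2) * (1 / 2) * Real.Gamma ((q + 1) / 2)) := by
  rw [← integral_rpow_mul_exp_neg_mul_rpow two_pos hq hb, ofReal_integral_eq_lintegral_ofReal]
  · simp
  · exact integrableOn_rpow_mul_exp_neg_mul_rpow hq two_pos hb
  · filter_upwards [ae_restrict_mem measurableSet_Ioi] with x hx
    have : 0 < x := hx
    simp only [Pi.zero_apply]
    positivity

theorem lintegral_exp_neg_sq :
    ∫⁻ x : ℝ, ENNReal.ofReal (Real.exp (-x ^ 2)) = ENNReal.ofReal √Real.pi := by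
  have h := integral_gaussian 1
  have h2 := integrable_exp_neg_mul_sq (b := 1) one_pos
  simp only [neg_mul, one_mul, div_one] at h h2
  rw [← h, ofReal_integral_eq_lintegral_ofReal h2]
  exact Filter.Eventually.of_forall fun x => (Real.exp_pos _).le

theorem lintegral_of_even {f : ℝ → ℝ≥0∞} (hf : ∀ x, f (-x) = f x) :
    ∫⁻ x, f x = 2 * ∫⁻ x in Ioi (0 : ℝ), f x := by
  have h := lintegral_add_compl f (measurableSet_Ioi (a := (0 : ℝ))) (μ := volume)
  have h2 : ∫⁻ x in (Ioi (0 : ℝ))ᶜ, f x = ∫⁻ x in Ioi (0 : ℝ), f x := by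
    rw [compl_Ioi, ← setLIntegral_congr (Iio_ae_eq_Iic (a := (0 : ℝ)) (μ := volume)),
      ← (Measure.measurePreserving_neg (volume : Measure ℝ)).setLIntegral_comp_preimage_emb
        (MeasurableEquiv.neg ℝ).measurableEmbedding]
    simp [hf]
  rw [← h, h2, two_mul]

theorem norm_mul_cos_add_sin (r θ : ℝ) :
    ‖(r * (Real.cos θ + Real.sin θ * Complex.I) : ℂ)‖ = |r| := by
  rw [norm_mul, Complex.norm_real, Real.norm_eq_abs, Complex.ofReal_cos, Complex.ofReal_sin,
    ← Complex.exp_mul_I, Complex.norm_exp_ofReal_mul_I, mul_one]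

/-- The Wallis integral with a real exponent. -/
theorem lintegral_posPow_two_mul_cos {p : ℝ} (hp : 0 < p) :
    ∫⁻ θ in Ioo (-Real.pi) Real.pi, posPow p (2 * Real.cos θ) =
      ENNReal.ofReal (Real.pi * Real.Gamma (p + 1) / Real.Gamma (p / 2 + 1) ^ 2) := by
  have hG := Real.Gamma_pos_of_pos (by linarith : 0 < p / 2 + 1)
  set W := ∫⁻ θ in Ioo (-Real.pi) Real.pi, posPow p (2 * Real.cos θ)
  -- The planar Gaussian integral of `(2 Re z)₊^p` is computed twice: polar coordinates give `W`
  -- times a Gamma value, Cartesian ones a product of one-dimensional integrals.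
  have h1 : ∫⁻ z : ℂ, posPow p (2 * z.re) * ENNReal.ofReal (Real.exp (-‖z‖ ^ 2)) =
      W * ENNReal.ofReal (1 / 2 * Real.Gamma (p / 2 + 1)) := by
    rw [lintegral_complex_eq_polar (by fun_prop), ← lintegral_mul_const _ (by fun_prop)]
    refine lintegral_congr fun θ => ?_
    have h2 := lintegral_rpow_mul_exp_neg_mul_sq (by linarith : -1 < p + 1) one_pos
    rw [Real.one_rpow, one_mul, show (p + 1 + 1) / 2 = p / 2 + 1 by ring] at h2
    rw [← h2, ← lintegral_const_mul _ (by fun_prop)]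
    refine setLIntegral_congr_fun measurableSet_Ioi fun r hr => ?_
    have hr : 0 < r := hr
    simp only [norm_mul_cos_add_sin, sq_abs]
    rw [show 2 * (r * (Real.cos θ + Real.sin θ * Complex.I) : ℂ).re = r * (2 * Real.cos θ) by
      rw [Complex.re_ofReal_mul]; simp [-Complex.ofReal_cos, -Complex.ofReal_sin]; ring,
      posPow_mul hr, Real.rpow_add_one hr.ne', neg_one_mul, mul_assoc (r ^ p),
      ENNReal.ofReal_mul (by positivity : 0 ≤ r ^ p), ENNReal.ofReal_mul hr.le]
    ring
  have h2 : ∫⁻ z : ℂ, posPow p (2 * z.re) * ENNReal.ofReal (Real.exp (-‖z‖ ^ 2)) =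
      ENNReal.ofReal (2 ^ p * (1 / 2 * Real.Gamma ((p + 1) / 2)) * √Real.pi) := by
    rw [lintegral_complex_re_im (by fun_prop)]
    have h3 : ∀ x y : ℝ, posPow p (2 * (x + y * Complex.I : ℂ).re) *
        ENNReal.ofReal (Real.exp (-‖(x + y * Complex.I : ℂ)‖ ^ 2)) =
        posPow p (2 * x) * ENNReal.ofReal (Real.exp (-x ^ 2)) *
          ENNReal.ofReal (Real.exp (-y ^ 2)) := by
      intro x y
      rw [← Complex.normSq_eq_norm_sq, Complex.normSq_add_mul_I, mul_assoc,
        ← ENNReal.ofReal_mul (Real.exp_pos _).le, ← Real.exp_add]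
      simp only [Complex.add_re, Complex.ofReal_re, Complex.mul_re, Complex.I_re, Complex.I_im,
        Complex.ofReal_im]
      congr 3 <;> ring
    simp only [h3]
    have h4 : ∀ x : ℝ, ∫⁻ y : ℝ, posPow p (2 * x) * ENNReal.ofReal (Real.exp (-x ^ 2)) *
          ENNReal.ofReal (Real.exp (-y ^ 2)) =
        posPow p (2 * x) * ENNReal.ofReal (Real.exp (-x ^ 2)) * ENNReal.ofReal √Real.pi := by
      intro x
      rw [lintegral_const_mul _ (by fun_prop), lintegral_exp_neg_sq]
    simp only [h4]
    rw [lintegral_mul_const _ (by fun_prop), ENNReal.ofReal_mul (by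
      have := Real.Gamma_pos_of_pos (by linarith : 0 < (p + 1) / 2); positivity)]
    congr 1
    have h5 : ∀ x : ℝ, posPow p (2 * x) * ENNReal.ofReal (Real.exp (-x ^ 2)) =
        (Ioi (0 : ℝ)).indicator (fun x => ENNReal.ofReal (2 ^ p) *
          ENNReal.ofReal (x ^ p * Real.exp (-1 * x ^ 2))) x := by
      intro x
      by_cases hx : x ∈ Ioi (0 : ℝ)
      · rw [indicator_of_mem hx, posPow_mul two_pos, posPow_of_pos hx,
          ENNReal.ofReal_mul (Real.rpow_nonneg (le_of_lt hx) _), neg_one_mul, mul_assoc]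
      · rw [indicator_of_notMem hx, posPow_of_nonpos, zero_mul]
        simp only [mem_Ioi, not_lt] at hx
        linarith
    simp only [h5]
    rw [lintegral_indicator measurableSet_Ioi, lintegral_const_mul _ (by fun_prop),
      lintegral_rpow_mul_exp_neg_mul_sq (by linarith) one_pos, ← ENNReal.ofReal_mul (by positivity),
      Real.one_rpow, one_mul]
  -- Legendre duplication trades `Γ((p+1)/2)` for `Γ(p+1) / Γ(p/2+1)`, which produces the squared
  -- denominator.
  have h3 := Real.Gamma_mul_Gamma_add_half ((p + 1) / 2)
  rw [show (p + 1) / 2 + 1 / 2 = p / 2 + 1 by ring, show 2 * ((p + 1) / 2) = p + 1 by ring,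
    show 1 - (p + 1) = -p by ring, Real.rpow_neg zero_le_two] at h3
  have hne : ENNReal.ofReal (1 / 2 * Real.Gamma (p / 2 + 1)) ≠ 0 := by
    rw [Ne, ENNReal.ofReal_eq_zero, not_le]; positivity
  rw [← ENNReal.mul_left_inj hne ENNReal.ofReal_ne_top, ← h1, h2, ← ENNReal.ofReal_mul (by
    have := Real.Gamma_pos_of_pos (by linarith : 0 < p + 1); positivity)]
  congr 1
  have h2p : (2 : ℝ) ^ p ≠ 0 := (Real.rpow_pos_of_pos two_pos _).ne'
  have hsq : √Real.pi * √Real.pi = Real.pi := Real.mul_self_sqrt Real.pi_pos.le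
  have hg : Real.Gamma ((p + 1) / 2) =
      Real.Gamma (p + 1) * (2 ^ p)⁻¹ * √Real.pi / Real.Gamma (p / 2 + 1) := by
    rw [← h3]; field_simp
  rw [hg]
  field_simp
  rw [sq, hsq]

/-! ### The integral over the unit disc -/

theorem lintegral_mul_posPow_sub {β : ℝ} (hβ : -1 < β) (R : ℝ) :
    ∫⁻ x in Ioi (0 : ℝ), ENNReal.ofReal x * posPow β (R - x) =
      ENNReal.ofReal (1 / ((β + 1) * (β + 2))) * posPow (β + 2) R := by
  rcases le_or_gt R 0 with hR | hR
  · rw [posPow_of_nonpos hR, mul_zero, setLIntegral_congr_fun (g := fun _ => 0) measurableSet_Ioi]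
    · simp
    · intro x hx
      have : 0 < x := hx
      simp only
      rw [posPow_of_nonpos (by linarith), mul_zero]
  · have h1 : 0 < β + 1 := by linarith
    have h2 : 0 < β + 2 := by linarith
    rw [posPow_of_pos hR, ← ENNReal.ofReal_mul (by positivity)]
    have hi0 : IntervalIntegrable (fun x : ℝ => (R - x) * x ^ β) volume 0 R :=
      (intervalIntegral.intervalIntegrable_rpow' (a := 0) (b := R) hβ).continuousOn_mul
        (by fun_prop)
    have hi : IntervalIntegrable (fun x : ℝ => x * (R - x) ^ β) volume 0 R := by
      have := hi0.comp_sub_left R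
      simpa using this.symm
    have h3 : ∫ x in (0 : ℝ)..R, x * (R - x) ^ β = 1 / ((β + 1) * (β + 2)) * R ^ (β + 2) := by
      have e1 := intervalIntegral.integral_comp_sub_left (a := 0) (b := R)
        (fun x => (R - x) * x ^ β) R
      simp only [sub_sub_cancel, sub_self, sub_zero] at e1
      rw [e1]
      -- At the endpoint `x = 0` this relies on `0 ^ (β + 1) = 0`, that is, on `β + 1 ≠ 0`.
      have e2 : ∀ x ∈ uIcc 0 R, (R - x) * x ^ β = R * x ^ β - x ^ (β + 1) := by
        intro x hx
        rw [uIcc_of_le hR.le] at hx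
        rw [Real.rpow_add_one' hx.1 h1.ne']
        ring
      rw [intervalIntegral.integral_congr e2, intervalIntegral.integral_sub,
        intervalIntegral.integral_const_mul, integral_rpow (Or.inl hβ),
        integral_rpow (Or.inl (by linarith)), Real.zero_rpow h1.ne',
        Real.zero_rpow (by linarith : β + 1 + 1 ≠ 0), show β + 2 = β + 1 + 1 by ring,
        Real.rpow_add_one hR.ne' (β + 1)]
      · field_simp
        ring
      · exact (intervalIntegral.intervalIntegrable_rpow' hβ).const_mul _
      · exact intervalIntegral.intervalIntegrable_rpow' (by linarith)
    rw [← h3, intervalIntegral.integral_of_le hR.le, ofReal_integral_eq_lintegral_ofReal]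
    · have h2 : ∀ x ∈ Ioi (0 : ℝ), ENNReal.ofReal x * posPow β (R - x) =
          (Ioo 0 R).indicator (fun x => ENNReal.ofReal (x * (R - x) ^ β)) x := by
        intro x hx
        by_cases h : x < R
        · rw [indicator_of_mem (show x ∈ Ioo 0 R from ⟨hx, h⟩), posPow_of_pos (by linarith),
            ENNReal.ofReal_mul (le_of_lt hx)]
        · rw [indicator_of_notMem (fun h' => h h'.2), posPow_of_nonpos (by linarith), mul_zero]
      rw [setLIntegral_congr_fun measurableSet_Ioi h2, setLIntegral_indicator measurableSet_Ioo,
        inter_eq_left.2 Ioo_subset_Ioi_self]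
      exact setLIntegral_congr Ioo_ae_eq_Ioc
    · exact (intervalIntegrable_iff_integrableOn_Ioc_of_le hR.le).1 hi
    · filter_upwards [ae_restrict_mem measurableSet_Ioc] with x hx
      exact mul_nonneg hx.1.le (Real.rpow_nonneg (by linarith [hx.2]) _)

/-- In polar coordinates about the boundary point, `v = 1 - r e^{iθ}`, one has `1-|v|² = r (2 cos θ
- r)`. The factor `r^{-β}` cancels `r^β`, the radial integral is elementary, and a Wallis integral
of exponent `β + 2` remains. -/
theorem lintegral_norm_one_sub_rpow_mul_posPow {β : ℝ} (hβ : -1 < β) :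
    ∫⁻ v : ℂ, ENNReal.ofReal (‖1 - v‖ ^ (-β)) * posPow β (1 - ‖v‖ ^ 2) =
      ENNReal.ofReal (Real.pi * Real.Gamma (β + 1) / Real.Gamma (β / 2 + 2) ^ 2) := by
  have h1 : 0 < β + 1 := by linarith
  have h2 : 0 < β + 2 := by linarith
  rw [← lintegral_sub_left_eq_self _ (1 : ℂ), lintegral_complex_eq_polar (by fun_prop)]
  have h3 : ∀ θ : ℝ, ∫⁻ r in Ioi (0 : ℝ), ENNReal.ofReal r * (ENNReal.ofReal
      (‖1 - (1 - r * (Real.cos θ + Real.sin θ * Complex.I) : ℂ)‖ ^ (-β)) *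
      posPow β (1 - ‖1 - (r * (Real.cos θ + Real.sin θ * Complex.I) : ℂ)‖ ^ 2)) =
      ENNReal.ofReal (1 / ((β + 1) * (β + 2))) * posPow (β + 2) (2 * Real.cos θ) := by
    intro θ
    rw [← lintegral_mul_posPow_sub hβ]
    refine setLIntegral_congr_fun measurableSet_Ioi fun r hr => ?_
    have hr : 0 < r := hr
    have e1 : 1 - ‖1 - (r * (Real.cos θ + Real.sin θ * Complex.I) : ℂ)‖ ^ 2 =
        r * (2 * Real.cos θ - r) := by
      rw [← Complex.normSq_eq_norm_sq, Complex.normSq_apply]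
      simp only [Complex.sub_re, Complex.sub_im, Complex.one_re, Complex.one_im, Complex.re_ofReal_mul,
        Complex.im_ofReal_mul, Complex.add_re, Complex.add_im, Complex.ofReal_re, Complex.ofReal_im,
        Complex.I_re, Complex.I_im]
      have := Real.sin_sq_add_cos_sq θ
      linear_combination (-r ^ 2) * this
    simp only [sub_sub_cancel, norm_mul_cos_add_sin, abs_of_pos hr]
    rw [e1, posPow_mul hr, ← mul_assoc (ENNReal.ofReal (r ^ (-β))),
      ← ENNReal.ofReal_mul (by positivity), ← Real.rpow_add hr]
    simp
  simp only [h3]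
  rw [lintegral_const_mul _ (by fun_prop), lintegral_posPow_two_mul_cos h2,
    ← ENNReal.ofReal_mul (by positivity)]
  congr 1
  rw [show β + 2 + 1 = (β + 1) + 1 + 1 by ring, Real.Gamma_add_one (by linarith),
    Real.Gamma_add_one h1.ne', show (β + 2) / 2 + 1 = β / 2 + 2 by ring]
  have : Real.Gamma (β / 2 + 2) ≠ 0 := (Real.Gamma_pos_of_pos (by linarith)).ne'
  field_simp
  ring

/-! ### The complete elliptic integral -/

/-- The complete elliptic integral of the second kind, `E(k) = ∫₀^{π/2} √(1 - k² sin² θ) dθ`. -/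
def ellipticE (k : ℝ) : ℝ := 1 / 2 * ∫ θ in (0 : ℝ)..Real.pi, √(1 - k ^ 2 * Real.sin θ ^ 2)

theorem lintegral_sqrt_eq_ellipticE (k : ℝ) :
    ∫⁻ θ in Ioo (-Real.pi) Real.pi, ENNReal.ofReal √(1 - k ^ 2 * Real.sin θ ^ 2) =
      ENNReal.ofReal (4 * ellipticE k) := by
  have hc : Continuous fun θ : ℝ => √(1 - k ^ 2 * Real.sin θ ^ 2) := by fun_prop
  have hle : -Real.pi ≤ Real.pi := by linarith [Real.pi_pos]
  have h1 : ∫ θ in (-Real.pi)..Real.pi, √(1 - k ^ 2 * Real.sin θ ^ 2) = 4 * ellipticE k := by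
    rw [← intervalIntegral.integral_add_adjacent_intervals (b := 0) (hc.intervalIntegrable _ _)
      (hc.intervalIntegrable _ _)]
    have h2 := intervalIntegral.integral_comp_neg (a := 0) (b := Real.pi)
      fun θ => √(1 - k ^ 2 * Real.sin θ ^ 2)
    simp only [Real.sin_neg, neg_sq, neg_zero] at h2
    rw [← h2, ellipticE]
    ring
  rw [← h1, intervalIntegral.integral_of_le hle, ofReal_integral_eq_lintegral_ofReal]
  · exact setLIntegral_congr Ioo_ae_eq_Ioc
  · exact (intervalIntegrable_iff_integrableOn_Ioc_of_le hle).1 (hc.intervalIntegrable _ _)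
  · exact Filter.Eventually.of_forall fun x => Real.sqrt_nonneg _

/-- Replacing `z` by `xz` pulls out `|x|³ exp(-(1+|z|²)x²)`, whose integral over the line is
`(1+|z|²)^{-2}`. The planar integral thus becomes a Gaussian one on `ℝ × ℂ`, where rotations are
available. -/
theorem lintegral_gaussian_norm_eq_stereographic (k s : ℝ) :
    ∫⁻ x : ℝ, ∫⁻ z : ℂ, ENNReal.ofReal (Real.exp (-(x ^ 2 + ‖z‖ ^ 2)) * ‖(x * k + z * s : ℂ)‖) =
      ∫⁻ z : ℂ, ENNReal.ofReal (‖(k + z * s : ℂ)‖ / (1 + ‖z‖ ^ 2) ^ 2) := by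
  have h1 : ∀ᵐ x : ℝ, ∫⁻ z : ℂ,
      ENNReal.ofReal (Real.exp (-(x ^ 2 + ‖z‖ ^ 2)) * ‖(x * k + z * s : ℂ)‖) =
      ∫⁻ z : ℂ, ENNReal.ofReal (‖(k + z * s : ℂ)‖) *
        ENNReal.ofReal (|x| ^ (3 : ℝ) * Real.exp (-(1 + ‖z‖ ^ 2) * |x| ^ 2)) := by
    have h0 : ∀ᵐ x : ℝ, x ≠ 0 := by simp [ae_iff]
    filter_upwards [h0] with x hx
    rw [lintegral_comp_mul_left_complex (a := x) (by exact_mod_cast hx),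
      ← lintegral_const_mul _ (by fun_prop)]
    refine lintegral_congr fun z => ?_
    rw [← ENNReal.ofReal_mul (by positivity), ← ENNReal.ofReal_mul (by positivity)]
    congr 1
    rw [show (x * k + x * z * s : ℂ) = x * (k + z * s) by ring, norm_mul, norm_mul,
      Complex.norm_real, Real.norm_eq_abs, mul_pow, sq_abs,
      show -(1 + ‖z‖ ^ 2) * x ^ 2 = -(x ^ 2 + x ^ 2 * ‖z‖ ^ 2) by ring,
      show |x| ^ (3 : ℝ) = |x| ^ 2 * |x| by rw [← pow_succ]; exact_mod_cast Real.rpow_natCast |x| 3,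
      sq_abs]
    ring
  rw [lintegral_congr_ae h1, lintegral_lintegral_swap (by fun_prop)]
  refine lintegral_congr fun z => ?_
  have hz : 0 < 1 + ‖z‖ ^ 2 := by positivity
  rw [lintegral_const_mul _ (by fun_prop), lintegral_of_even (by simp)]
  have h2 : ∀ x ∈ Ioi (0 : ℝ),
      ENNReal.ofReal (|x| ^ (3 : ℝ) * Real.exp (-(1 + ‖z‖ ^ 2) * |x| ^ 2)) =
      ENNReal.ofReal (x ^ (3 : ℝ) * Real.exp (-(1 + ‖z‖ ^ 2) * x ^ 2)) := by
    intro x hx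
    rw [abs_of_pos hx]
  rw [setLIntegral_congr_fun measurableSet_Ioi h2,
    lintegral_rpow_mul_exp_neg_mul_sq (by norm_num) hz,
    show (2 : ℝ≥0∞) = ENNReal.ofReal 2 by simp, ← ENNReal.ofReal_mul zero_le_two,
    ← ENNReal.ofReal_mul (norm_nonneg _)]
  congr 1
  rw [show ((3 : ℝ) + 1) / 2 = 2 by norm_num, show -((3 : ℝ) + 1) / 2 = -2 by norm_num,
    Real.Gamma_two, Real.rpow_neg hz.le, Real.rpow_two]
  ring

/-- Write `z = x' + iy`. Rotating the `(x,x')` plane so that `xk + x's` becomes a coordinate leaves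
a variable that appears only in the Gaussian and integrates to `√π`. In polar coordinates of the
remaining plane, `cos² θ + s² sin² θ = 1 - k² sin² θ` is the elliptic integrand. -/
theorem lintegral_gaussian_norm_eq_ellipticE {k s : ℝ} (hks : k ^ 2 + s ^ 2 = 1) :
    ∫⁻ x : ℝ, ∫⁻ z : ℂ, ENNReal.ofReal (Real.exp (-(x ^ 2 + ‖z‖ ^ 2)) * ‖(x * k + z * s : ℂ)‖) =
      ENNReal.ofReal (Real.pi * ellipticE k) := by
  have hnsq : ∀ x y : ℝ, ‖(x + y * Complex.I : ℂ)‖ ^ 2 = x ^ 2 + y ^ 2 := fun x y => by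
    rw [← Complex.normSq_eq_norm_sq, Complex.normSq_add_mul_I]
  have h1 : ∀ x : ℝ, ∫⁻ z : ℂ,
      ENNReal.ofReal (Real.exp (-(x ^ 2 + ‖z‖ ^ 2)) * ‖(x * k + z * s : ℂ)‖) =
      ∫⁻ y : ℝ, ∫⁻ x' : ℝ, ENNReal.ofReal (Real.exp (-(x ^ 2 + x' ^ 2 + y ^ 2)) *
        √((x * k + x' * s) ^ 2 + (y * s) ^ 2)) := by
    intro x
    rw [lintegral_complex_re_im (by fun_prop), lintegral_lintegral_swap (by fun_prop)]
    refine lintegral_congr fun y => lintegral_congr fun x' => ?_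
    rw [add_assoc, show (x * k + (x' + y * Complex.I) * s : ℂ) =
      ((x * k + x' * s : ℝ) : ℂ) + ((y * s : ℝ) : ℂ) * Complex.I by push_cast; ring,
      ← hnsq (x * k + x' * s), Real.sqrt_sq (norm_nonneg _), hnsq]
  simp only [h1]
  rw [lintegral_lintegral_swap (by fun_prop)]
  have h2 : ∀ y : ℝ, ∫⁻ x : ℝ, ∫⁻ x' : ℝ, ENNReal.ofReal
      (Real.exp (-(x ^ 2 + x' ^ 2 + y ^ 2)) * √((x * k + x' * s) ^ 2 + (y * s) ^ 2)) =
      ∫⁻ x : ℝ, ENNReal.ofReal √Real.pi *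
        ENNReal.ofReal (Real.exp (-(x ^ 2 + y ^ 2)) * √(x ^ 2 + (y * s) ^ 2)) := by
    intro y
    have e1 := lintegral_complex_re_im (f := fun p : ℂ => ENNReal.ofReal
      (Real.exp (-(‖p‖ ^ 2 + y ^ 2)) * √((p.re * k + p.im * s) ^ 2 + (y * s) ^ 2))) (by fun_prop)
    have e2 := lintegral_complex_re_im (f := fun p : ℂ => ENNReal.ofReal
      (Real.exp (-(‖p‖ ^ 2 + y ^ 2)) * √(p.re ^ 2 + (y * s) ^ 2))) (by fun_prop)
    -- The rotation of the `(x,x')` plane is multiplication by the unit number `k + si`.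
    have ha2 : ‖(k + s * Complex.I : ℂ)‖ ^ 2 = 1 := by rw [hnsq, hks]
    have ha : (k + s * Complex.I : ℂ) ≠ 0 := by
      intro h
      rw [h] at ha2
      simp at ha2
    rw [lintegral_comp_mul_left_complex ha, ha2] at e1
    have e3 : ∀ p : ℂ, ENNReal.ofReal (Real.exp (-(‖(k + s * Complex.I : ℂ) * p‖ ^ 2 + y ^ 2)) *
        √((((k + s * Complex.I : ℂ) * p).re * k + ((k + s * Complex.I : ℂ) * p).im * s) ^ 2 +
          (y * s) ^ 2)) =
        ENNReal.ofReal (Real.exp (-(‖p‖ ^ 2 + y ^ 2)) * √(p.re ^ 2 + (y * s) ^ 2)) := by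
      intro p
      have : ((k + s * Complex.I : ℂ) * p).re * k + ((k + s * Complex.I : ℂ) * p).im * s =
          p.re := by
        simp
        linear_combination p.re * hks
      rw [this, norm_mul, mul_pow, ha2, one_mul]
    simp only [e3, e2, hnsq, ENNReal.ofReal_one, one_mul] at e1
    simp only [Complex.add_re, Complex.ofReal_re, Complex.mul_re, Complex.I_re, Complex.I_im,
        Complex.ofReal_im, Complex.add_im, Complex.mul_im, mul_zero, mul_one, add_zero, zero_add,
        sub_zero] at e1
    rw [← e1]
    refine lintegral_congr fun x => ?_
    rw [← lintegral_exp_neg_sq, ← lintegral_mul_const _ (by fun_prop)]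
    refine lintegral_congr fun z => ?_
    rw [← ENNReal.ofReal_mul (Real.exp_pos _).le, ← mul_assoc, ← Real.exp_add]
    congr 3
    ring
  simp only [h2]
  rw [lintegral_lintegral_swap (by fun_prop)]
  have h3 : ∀ θ : ℝ, Real.cos θ ^ 2 + (Real.sin θ * s) ^ 2 = 1 - k ^ 2 * Real.sin θ ^ 2 := by
    intro θ
    rw [Real.cos_sq']
    linear_combination Real.sin θ ^ 2 * hks
  have e2 := lintegral_complex_re_im (f := fun p : ℂ => ENNReal.ofReal √Real.pi *
    ENNReal.ofReal (Real.exp (-‖p‖ ^ 2) * √(p.re ^ 2 + (p.im * s) ^ 2))) (by fun_prop)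
  simp only [hnsq, Complex.add_re, Complex.ofReal_re, Complex.mul_re, Complex.I_re, Complex.I_im,
        Complex.ofReal_im, Complex.add_im, Complex.mul_im, mul_zero, mul_one, add_zero, zero_add,
        sub_zero] at e2
  rw [← e2, lintegral_const_mul _ (by fun_prop), lintegral_complex_eq_polar (by fun_prop)]
  have h4 : ∀ θ : ℝ, ∫⁻ r in Ioi (0 : ℝ), ENNReal.ofReal r * ENNReal.ofReal
      (Real.exp (-‖(r * (Real.cos θ + Real.sin θ * Complex.I) : ℂ)‖ ^ 2) *
        √((r * (Real.cos θ + Real.sin θ * Complex.I) : ℂ).re ^ 2 +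
          ((r * (Real.cos θ + Real.sin θ * Complex.I) : ℂ).im * s) ^ 2)) =
      ENNReal.ofReal (√Real.pi / 4) * ENNReal.ofReal √(1 - k ^ 2 * Real.sin θ ^ 2) := by
    intro θ
    have hg := lintegral_rpow_mul_exp_neg_mul_sq (by norm_num : (-1 : ℝ) < 2) one_pos
    rw [Real.one_rpow, one_mul, show ((2 : ℝ) + 1) / 2 = 1 / 2 + 1 by norm_num,
      Real.Gamma_add_one (by norm_num), Real.Gamma_one_half_eq,
      show 1 / 2 * (1 / 2 * √Real.pi) = √Real.pi / 4 by ring] at hg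
    rw [← hg, ← lintegral_mul_const _ (by fun_prop)]
    refine setLIntegral_congr_fun measurableSet_Ioi fun r hr => ?_
    have hr : 0 < r := hr
    simp only [norm_mul_cos_add_sin, sq_abs,
      Complex.add_re, Complex.ofReal_re, Complex.mul_re, Complex.I_re, Complex.I_im,
      Complex.ofReal_im, Complex.add_im, Complex.mul_im, mul_zero, mul_one, add_zero, zero_add,
      zero_mul, sub_zero]
    rw [← h3, show (r * Real.cos θ) ^ 2 + (r * Real.sin θ * s) ^ 2 =
      r ^ 2 * (Real.cos θ ^ 2 + (Real.sin θ * s) ^ 2) by ring, Real.sqrt_mul (sq_nonneg r),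
      Real.sqrt_sq hr.le, Real.rpow_two, ← ENNReal.ofReal_mul hr.le,
      ← ENNReal.ofReal_mul (by positivity), neg_one_mul]
    congr 1
    ring
  simp only [h4]
  rw [lintegral_const_mul _ (by fun_prop), lintegral_sqrt_eq_ellipticE, ← mul_assoc,
    ← ENNReal.ofReal_mul (by positivity), ← ENNReal.ofReal_mul (by positivity)]
  congr 1
  have := Real.mul_self_sqrt Real.pi_pos.le
  linear_combination ellipticE k * this

theorem lintegral_stereographic {k s : ℝ} (hks : k ^ 2 + s ^ 2 = 1) :
    ∫⁻ z : ℂ, ENNReal.ofReal (‖(k + z * s : ℂ)‖ / (1 + ‖z‖ ^ 2) ^ 2) =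
      ENNReal.ofReal (Real.pi * ellipticE k) := by
  rw [← lintegral_gaussian_norm_eq_stereographic, lintegral_gaussian_norm_eq_ellipticE hks]

/-! ### The boundary integral -/

/-- `∫ |k(r - u) + s v| |1 - r u|^{-(β+3)} (1 - |u|² - |v|²)^β` over the unit ball of `ℂ²`. -/
def ballIntegral (β k s r : ℝ) : ℝ≥0∞ :=
  ∫⁻ u : ℂ, ∫⁻ v : ℂ, ENNReal.ofReal (‖(k * (r - u) + s * v : ℂ)‖ / ‖(1 - r * u : ℂ)‖ ^ (β + 3)) *
    posPow β (1 - ‖u‖ ^ 2 - ‖v‖ ^ 2)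

/-- The support of the truncated power is the disc of centre `1-q` and radius `q = 1/(1+|z|²)`,
tangent to the unit circle at `1`. The map `v ↦ (1-q) + qv` fixes `1` and carries the unit disc onto
it; `q^{-β}` and `q^β` cancel, so only the Jacobian `q²` survives. -/
theorem lintegral_horodisc (β : ℝ) (z : ℂ) :
    ∫⁻ u : ℂ, ENNReal.ofReal (‖1 - u‖ ^ (-β)) *
        posPow β (1 - ‖u‖ ^ 2 - ‖1 - u‖ ^ 2 * ‖z‖ ^ 2) =
      ENNReal.ofReal (1 / (1 + ‖z‖ ^ 2) ^ 2) *
        ∫⁻ v : ℂ, ENNReal.ofReal (‖1 - v‖ ^ (-β)) * posPow β (1 - ‖v‖ ^ 2) := by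
  set q : ℝ := 1 / (1 + ‖z‖ ^ 2) with hq
  have hq0 : 0 < q := by positivity
  have hqz : q * ‖z‖ ^ 2 = 1 - q := by
    rw [hq]; field_simp; ring
  rw [← lintegral_add_left_eq_self _ ((1 - q : ℝ) : ℂ),
    lintegral_comp_mul_left_complex (a := q) (by exact_mod_cast hq0.ne'), Complex.norm_real,
    Real.norm_eq_abs, sq_abs, show 1 / (1 + ‖z‖ ^ 2) ^ 2 = q ^ 2 by rw [hq, div_pow, one_pow]]
  congr 1
  refine lintegral_congr fun v => ?_
  have e1 : (1 - (((1 - q : ℝ) : ℂ) + q * v) : ℂ) = q * (1 - v) := by push_cast; ring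
  have e2 : 1 - ‖((1 - q : ℝ) : ℂ) + q * v‖ ^ 2 - ‖q * (1 - v)‖ ^ 2 * ‖z‖ ^ 2 =
      q * (1 - ‖v‖ ^ 2) := by
    rw [norm_mul, mul_pow, Complex.norm_real, Real.norm_eq_abs, sq_abs,
      show q ^ 2 * ‖1 - v‖ ^ 2 * ‖z‖ ^ 2 = q * ‖1 - v‖ ^ 2 * (q * ‖z‖ ^ 2) by ring, hqz]
    simp only [← Complex.normSq_eq_norm_sq, Complex.normSq_apply, Complex.add_re, Complex.add_im,
      Complex.re_ofReal_mul, Complex.im_ofReal_mul, Complex.sub_re, Complex.sub_im, Complex.one_re,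
      Complex.one_im, Complex.ofReal_re, Complex.ofReal_im]
    ring
  rw [e1, e2, posPow_mul hq0, norm_mul, Complex.norm_real, Real.norm_of_nonneg hq0.le,
    Real.mul_rpow hq0.le (norm_nonneg _), ENNReal.ofReal_mul (by positivity)]
  have e3 : ENNReal.ofReal (q ^ (-β)) * ENNReal.ofReal (q ^ β) = 1 := by
    rw [← ENNReal.ofReal_mul (by positivity), ← Real.rpow_add hq0]
    simp
  calc _ = (ENNReal.ofReal (q ^ (-β)) * ENNReal.ofReal (q ^ β)) *
        (ENNReal.ofReal (‖1 - v‖ ^ (-β)) * posPow β (1 - ‖v‖ ^ 2)) := by ring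
    _ = _ := by rw [e3, one_mul]

/-- At `r = 1` the numerator is `|(1-u)(k+sz)|` for `v = (1-u)z`. With the Jacobian `|1-u|²` the
power of `|1-u|` drops to `-β`, and `k+sz` no longer involves `u`, so after Tonelli the two
integrals separate. -/
theorem ballIntegral_one {β k s : ℝ} (hβ : -1 < β) (hks : k ^ 2 + s ^ 2 = 1) :
    ballIntegral β k s 1 = ENNReal.ofReal
      (Real.pi ^ 2 * Real.Gamma (β + 1) / Real.Gamma (β / 2 + 2) ^ 2 * ellipticE k) := by
  have h1 : ∀ u : ℂ, ∫⁻ v : ℂ, ENNReal.ofReal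
      (‖(k * ((1 : ℝ) - u) + s * v : ℂ)‖ / ‖(1 - (1 : ℝ) * u : ℂ)‖ ^ (β + 3)) *
      posPow β (1 - ‖u‖ ^ 2 - ‖v‖ ^ 2) = ∫⁻ z : ℂ, ENNReal.ofReal ‖(k + z * s : ℂ)‖ *
        (ENNReal.ofReal (‖1 - u‖ ^ (-β)) *
          posPow β (1 - ‖u‖ ^ 2 - ‖1 - u‖ ^ 2 * ‖z‖ ^ 2)) := by
    intro u
    -- At `u = 1` the substitution degenerates, but the weight vanishes there for every `v` and `z`.
    rcases eq_or_ne u 1 with rfl | hu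
    · have : ∀ x : ℝ, 0 ≤ x → posPow β (1 - ‖(1 : ℂ)‖ ^ 2 - x) = 0 := fun x hx =>
        posPow_of_nonpos (by simpa using hx)
      simp only [this _ (sq_nonneg _), this _ (mul_nonneg (sq_nonneg _) (sq_nonneg _)), mul_zero]
    · have hu' : 1 - u ≠ 0 := sub_ne_zero.2 hu.symm
      have hpos : 0 < ‖1 - u‖ := norm_pos_iff.2 hu'
      rw [lintegral_comp_mul_left_complex hu', ← lintegral_const_mul _ (by fun_prop)]
      refine lintegral_congr fun z => ?_
      rw [norm_mul (1 - u), mul_pow, ← mul_assoc (ENNReal.ofReal (‖1 - u‖ ^ 2)),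
        ← mul_assoc (ENNReal.ofReal ‖(k + z * s : ℂ)‖), ← ENNReal.ofReal_mul (by positivity), ← ENNReal.ofReal_mul (by positivity)]
      congr 2
      rw [Complex.ofReal_one, one_mul,
        show (k * (1 - u) + s * ((1 - u) * z) : ℂ) = (1 - u) * (k + z * s) by ring, norm_mul,
        show β + 3 = β + (3 : ℕ) by norm_num, Real.rpow_add_natCast hpos.ne',
        Real.rpow_neg hpos.le]
      have := (Real.rpow_pos_of_pos hpos β).ne'
      field_simp
  unfold ballIntegral
  simp only [h1]
  rw [lintegral_lintegral_swap (by fun_prop)]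
  have h2 : ∀ z : ℂ, ∫⁻ u : ℂ, ENNReal.ofReal ‖(k + z * s : ℂ)‖ *
        (ENNReal.ofReal (‖1 - u‖ ^ (-β)) *
          posPow β (1 - ‖u‖ ^ 2 - ‖1 - u‖ ^ 2 * ‖z‖ ^ 2)) =
      ENNReal.ofReal (‖(k + z * s : ℂ)‖ / (1 + ‖z‖ ^ 2) ^ 2) *
        ENNReal.ofReal (Real.pi * Real.Gamma (β + 1) / Real.Gamma (β / 2 + 2) ^ 2) := by
    intro z
    rw [lintegral_const_mul _ (by fun_prop), lintegral_horodisc,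
      lintegral_norm_one_sub_rpow_mul_posPow hβ, ← mul_assoc, ← ENNReal.ofReal_mul (norm_nonneg _),
      mul_one_div]
  simp only [h2]
  have hg := Real.Gamma_pos_of_pos (by linarith : 0 < β + 1)
  rw [lintegral_mul_const _ (by fun_prop), lintegral_stereographic hks, mul_comm,
    ← ENNReal.ofReal_mul (by positivity)]
  congr 1
  ring

/-! ### Circular means of holomorphic functions -/

/-- The Poisson kernel of the unit disc at `r e^{iφ}` and `e^{iθ}`. -/
def discPoisson (r φ θ : ℝ) : ℝ := (1 - r ^ 2) / ‖circleMap 0 1 θ - circleMap 0 r φ‖ ^ 2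

theorem norm_circleMap_sub_comm (r φ θ : ℝ) :
    ‖circleMap 0 1 θ - circleMap 0 r φ‖ = ‖circleMap 0 1 φ - circleMap 0 r θ‖ := by
  rw [← sq_eq_sq₀ (norm_nonneg _) (norm_nonneg _)]
  simp only [← Complex.normSq_eq_norm_sq, Complex.normSq_apply, Complex.sub_re, Complex.sub_im,
    circleMap_zero, Complex.re_ofReal_mul, Complex.im_ofReal_mul, Complex.exp_ofReal_mul_I_re,
    Complex.exp_ofReal_mul_I_im]
  have h1 := Real.sin_sq_add_cos_sq θ
  have h2 := Real.sin_sq_add_cos_sq φ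
  linear_combination (1 - r ^ 2) * h1 - (1 - r ^ 2) * h2

theorem discPoisson_comm (r φ θ : ℝ) : discPoisson r φ θ = discPoisson r θ φ := by
  rw [discPoisson, discPoisson, norm_circleMap_sub_comm]

theorem discPoisson_nonneg {r : ℝ} (hr : r ∈ Ico (0 : ℝ) 1) (φ θ : ℝ) : 0 ≤ discPoisson r φ θ :=
  div_nonneg (by nlinarith [hr.1, hr.2]) (sq_nonneg _)

theorem circleMap_mem_unit_ball {r : ℝ} (hr : r ∈ Ico (0 : ℝ) 1) (φ : ℝ) :
    circleMap 0 r φ ∈ Metric.ball (0 : ℂ) 1 := by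
  rw [mem_ball_zero_iff, norm_circleMap_zero, abs_of_nonneg hr.1]
  exact hr.2

theorem continuous_discPoisson {r : ℝ} (hr : r ∈ Ico (0 : ℝ) 1) (φ : ℝ) :
    Continuous (discPoisson r φ) := by
  unfold discPoisson
  refine continuous_const.div (by fun_prop) fun θ h => ?_
  rw [sq_eq_zero_iff, norm_eq_zero, sub_eq_zero] at h
  have := circleMap_mem_unit_ball hr φ
  rw [← h, mem_ball_zero_iff, norm_circleMap_zero] at this
  simp at this

theorem poisson_integral {E : Type*} [NormedAddCommGroup E] [NormedSpace ℂ E] [CompleteSpace E]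
    {h : ℂ → E} (hh : DiffContOnCl ℂ h (Metric.ball 0 1)) {r : ℝ} (hr : r ∈ Ico (0 : ℝ) 1)
    (φ : ℝ) :
    (2 * Real.pi)⁻¹ • ∫ θ in (0 : ℝ)..2 * Real.pi, discPoisson r φ θ • h (circleMap 0 1 θ) =
      h (circleMap 0 r φ) := by
  rw [← hh.circleAverage_poissonKernel_smul' (circleMap_mem_unit_ball hr φ), Real.circleAverage]
  simp [discPoisson]

/-- Reproducing the constant `1` normalizes the kernel in the boundary angle; symmetry in the two
angles transfers this to the interior angle, as Tonelli requires below. -/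
theorem lintegral_discPoisson {r : ℝ} (hr : r ∈ Ico (0 : ℝ) 1) (θ : ℝ) :
    ∫⁻ φ in Ioc 0 (2 * Real.pi), ENNReal.ofReal (discPoisson r φ θ) =
      ENNReal.ofReal (2 * Real.pi) := by
  have h := poisson_integral (h := fun _ => (1 : ℂ)) diffContOnCl_const hr θ
  have hpi := Real.two_pi_pos
  have h2 : ∫ φ in (0 : ℝ)..2 * Real.pi, discPoisson r θ φ = 2 * Real.pi := by
    have h3 : ∫ φ in (0 : ℝ)..2 * Real.pi, (discPoisson r θ φ • (1 : ℂ)) =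
        ((∫ φ in (0 : ℝ)..2 * Real.pi, discPoisson r θ φ : ℝ) : ℂ) := by
      rw [← intervalIntegral.integral_ofReal]
      simp
    rw [h3, Complex.real_smul, ← Complex.ofReal_mul, Complex.ofReal_eq_one] at h
    field_simp at h
    exact h
  simp only [discPoisson_comm r _ θ]
  conv_rhs => rw [← h2]
  rw [intervalIntegral.integral_of_le hpi.le, ofReal_integral_eq_lintegral_ofReal]
  · exact (continuous_discPoisson hr θ).integrableOn_Ioc (μ := volume)
  · exact Filter.Eventually.of_forall fun x => discPoisson_nonneg hr _ _

theorem measurable_discPoisson (r : ℝ) : Measurable fun p : ℝ × ℝ => discPoisson r p.1 p.2 := by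
  unfold discPoisson
  have h1 : Measurable fun θ : ℝ => circleMap 0 1 θ := (continuous_circleMap 0 1).measurable
  have h2 : Measurable fun θ : ℝ => circleMap 0 r θ := (continuous_circleMap 0 r).measurable
  exact measurable_const.div
    (((h1.comp measurable_snd).sub (h2.comp measurable_fst)).norm.pow_const 2)

/-- The triangle inequality in the Poisson formula bounds `‖h‖` on the inner circle by the Poisson
integral of its boundary values; Tonelli and the normalization in the interior angle finish. -/
theorem lintegral_circle_enorm_le {E : Type*} [NormedAddCommGroup E] [NormedSpace ℂ E]
    [CompleteSpace E] {h : ℂ → E} (hh : DiffContOnCl ℂ h (Metric.ball 0 1))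
    {r : ℝ} (hr : r ∈ Ico (0 : ℝ) 1) :
    ∫⁻ φ in Ioc 0 (2 * Real.pi), ‖h (circleMap 0 r φ)‖ₑ ≤
      ∫⁻ θ in Ioc 0 (2 * Real.pi), ‖h (circleMap 0 1 θ)‖ₑ := by
  have hpi := Real.two_pi_pos
  have hcont : Continuous fun θ : ℝ => h (circleMap 0 1 θ) := by
    have := hh.continuousOn
    rw [closure_ball _ one_ne_zero] at this
    exact this.comp_continuous (continuous_circleMap 0 1) fun θ => by
      simp
  have h1 : ∀ φ : ℝ, ‖h (circleMap 0 r φ)‖ₑ ≤ ENNReal.ofReal (2 * Real.pi)⁻¹ *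
      ∫⁻ θ in Ioc 0 (2 * Real.pi), ENNReal.ofReal (discPoisson r φ θ) *
        ‖h (circleMap 0 1 θ)‖ₑ := by
    intro φ
    rw [← poisson_integral hh hr φ, enorm_smul, Real.enorm_of_nonneg (by positivity),
      intervalIntegral.integral_of_le hpi.le]
    gcongr
    refine (enorm_integral_le_lintegral_enorm _).trans (le_of_eq ?_)
    refine lintegral_congr fun θ => ?_
    rw [enorm_smul, Real.enorm_of_nonneg (discPoisson_nonneg hr _ _)]
  have hm : Measurable fun p : ℝ × ℝ => ENNReal.ofReal (discPoisson r p.1 p.2) *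
      ‖h (circleMap 0 1 p.2)‖ₑ :=
    (measurable_discPoisson r).ennreal_ofReal.mul
      (hcont.enorm.measurable.comp measurable_snd)
  refine (lintegral_mono h1).trans ?_
  rw [lintegral_const_mul _ hm.lintegral_prod_right',
    lintegral_lintegral_swap (f := fun φ θ => ENNReal.ofReal (discPoisson r φ θ) *
      ‖h (circleMap 0 1 θ)‖ₑ) hm.aemeasurable]
  have h2 : ∀ θ : ℝ, ∫⁻ φ in Ioc 0 (2 * Real.pi), ENNReal.ofReal (discPoisson r φ θ) *
      ‖h (circleMap 0 1 θ)‖ₑ = ENNReal.ofReal (2 * Real.pi) * ‖h (circleMap 0 1 θ)‖ₑ := by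
    intro θ
    have hθ : Measurable fun φ => discPoisson r φ θ :=
      Measurable.comp (g := fun p : ℝ × ℝ => discPoisson r p.1 p.2) (f := fun φ => (φ, θ))
        (measurable_discPoisson r) measurable_prodMk_right
    rw [lintegral_mul_const _ hθ.ennreal_ofReal, lintegral_discPoisson hr]
  simp only [h2]
  rw [lintegral_const_mul _ hcont.enorm.measurable, ← mul_assoc,
    ← ENNReal.ofReal_mul (by positivity), inv_mul_cancel₀ hpi.ne', ENNReal.ofReal_one, one_mul]

/-! ### Monotonicity in the radius -/

/-- Rotating `u` and `v` by `e^{-iθ}` turns `r` into `μ = r e^{iθ}`. The denominator is conjugated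
inside its modulus so that `μ`, and not its conjugate, occurs there: numerator and denominator are
then both holomorphic in `μ`. -/
theorem ballIntegral_eq_rotate (β k s r θ : ℝ) :
    ballIntegral β k s r = ∫⁻ u : ℂ, ∫⁻ v : ℂ,
      ENNReal.ofReal (‖(k * (circleMap 0 r θ - u) + s * v : ℂ)‖ /
        ‖(1 - circleMap 0 r θ * (starRingEnd ℂ) u : ℂ)‖ ^ (β + 3)) *
      posPow β (1 - ‖u‖ ^ 2 - ‖v‖ ^ 2) := by
  set e : ℂ := Complex.exp (θ * Complex.I) with he
  have hn : ‖e‖ = 1 := Complex.norm_exp_ofReal_mul_I θ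
  have hconj : (starRingEnd ℂ) e * e = 1 := by
    rw [mul_comm, Complex.mul_conj, Complex.normSq_eq_norm_sq, hn]; simp
  have hn' : ‖(starRingEnd ℂ) e‖ = 1 := by rw [RCLike.norm_conj, hn]
  have h0 : (starRingEnd ℂ) e ≠ 0 := by
    intro h; rw [h] at hn'; simp at hn'
  unfold ballIntegral
  rw [lintegral_comp_mul_left_complex h0, hn', one_pow, ENNReal.ofReal_one, one_mul]
  refine lintegral_congr fun u => ?_
  rw [lintegral_comp_mul_left_complex h0, hn', one_pow, ENNReal.ofReal_one, one_mul]
  refine lintegral_congr fun v => ?_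
  have e1 : ‖(k * (r - (starRingEnd ℂ) e * u) + s * ((starRingEnd ℂ) e * v) : ℂ)‖ =
      ‖(k * (circleMap 0 r θ - u) + s * v : ℂ)‖ := by
    rw [← one_mul ‖_‖, ← hn, ← norm_mul, circleMap_zero, ← he]
    congr 1
    linear_combination (-k * u + s * v) * hconj
  have e2 : ‖(1 - r * ((starRingEnd ℂ) e * u) : ℂ)‖ =
      ‖(1 - circleMap 0 r θ * (starRingEnd ℂ) u : ℂ)‖ := by
    rw [← RCLike.norm_conj, circleMap_zero, ← he]
    congr 1
    simp
    ring
  rw [e1, e2, norm_mul, norm_mul, hn', one_mul, one_mul]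

/-- Averaging over `θ` under the integral reduces the claim, for each `(u,v)` in the ball, to
comparing circular means of a function of `μ`. As `|u| < 1`, that function is holomorphic up to the
closed disc. -/
theorem ballIntegral_le_one (β k s : ℝ) {r : ℝ} (hr : r ∈ Ico (0 : ℝ) 1) :
    ballIntegral β k s r ≤ ballIntegral β k s 1 := by
  have hpi := Real.two_pi_pos
  have havg : ∀ r : ℝ, ENNReal.ofReal (2 * Real.pi) * ballIntegral β k s r =
      ∫⁻ u : ℂ, ∫⁻ v : ℂ, (∫⁻ θ in Ioc 0 (2 * Real.pi),
        ENNReal.ofReal (‖(k * (circleMap 0 r θ - u) + s * v : ℂ)‖ /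
        ‖(1 - circleMap 0 r θ * (starRingEnd ℂ) u : ℂ)‖ ^ (β + 3))) *
      posPow β (1 - ‖u‖ ^ 2 - ‖v‖ ^ 2) := by
    intro r
    have hmc : Measurable fun θ : ℝ => circleMap 0 r θ := (continuous_circleMap 0 r).measurable
    have h1 : ENNReal.ofReal (2 * Real.pi) * ballIntegral β k s r =
        ∫⁻ _ in Ioc 0 (2 * Real.pi), ballIntegral β k s r := by
      rw [setLIntegral_const, Real.volume_Ioc, sub_zero, mul_comm]
    rw [h1, lintegral_congr (ballIntegral_eq_rotate β k s r),
      lintegral_lintegral_swap (by fun_prop)]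
    refine lintegral_congr fun u => ?_
    rw [lintegral_lintegral_swap (by fun_prop)]
    refine lintegral_congr fun v => ?_
    rw [lintegral_mul_const _ (by fun_prop)]
  have h2pi : ENNReal.ofReal (2 * Real.pi) ≠ 0 := by simpa using hpi
  rw [← ENNReal.mul_le_mul_iff_right h2pi ENNReal.ofReal_ne_top, havg, havg]
  refine lintegral_mono fun u => lintegral_mono fun v => ?_
  rcases le_or_gt (1 - ‖u‖ ^ 2 - ‖v‖ ^ 2) 0 with huv | huv
  · simp only [posPow_of_nonpos huv, mul_zero, le_refl]
  gcongr ?_ * _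
  have hu : ‖u‖ < 1 := by nlinarith [norm_nonneg u, sq_nonneg ‖v‖]
  have hre : ∀ μ : ℂ, ‖μ‖ ≤ 1 → 0 < (1 - μ * (starRingEnd ℂ) u).re := by
    intro μ hμ
    have h1 := Complex.re_le_norm (μ * (starRingEnd ℂ) u)
    rw [norm_mul, RCLike.norm_conj] at h1
    rw [Complex.sub_re, Complex.one_re]
    nlinarith [norm_nonneg μ, norm_nonneg u]
  -- By `hre` the base of the power stays in the right half-plane, so the principal branch is
  -- holomorphic and its modulus is the real power of the modulus.
  set h : ℂ → ℂ := fun μ => (k * (μ - u) + s * v) /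
    (1 - μ * (starRingEnd ℂ) u) ^ ((β + 3 : ℝ) : ℂ) with hh
  have hnorm : ∀ μ : ℂ, ‖μ‖ ≤ 1 → ENNReal.ofReal (‖(k * (μ - u) + s * v : ℂ)‖ /
        ‖(1 - μ * (starRingEnd ℂ) u : ℂ)‖ ^ (β + 3)) = ‖h μ‖ₑ := by
    intro μ hμ
    have hne : (1 - μ * (starRingEnd ℂ) u) ≠ 0 := by
      intro h0; have := hre μ hμ; rw [h0] at this; simp at this
    rw [← ofReal_norm, hh, norm_div, Complex.norm_cpow_of_ne_zero hne]
    simp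
  have hdiff : DifferentiableOn ℂ h (Metric.closedBall 0 1) := by
    intro μ hμ
    rw [mem_closedBall_zero_iff] at hμ
    have hslit : (1 - μ * (starRingEnd ℂ) u) ∈ Complex.slitPlane := Or.inl (hre μ hμ)
    refine DifferentiableAt.differentiableWithinAt ?_
    refine DifferentiableAt.div (by fun_prop) ?_ ?_
    · exact DifferentiableAt.cpow (by fun_prop) (by fun_prop) hslit
    · rw [Complex.cpow_ne_zero_iff]
      exact Or.inl (Complex.slitPlane_ne_zero hslit)
  have hcl : DiffContOnCl ℂ h (Metric.ball 0 1) :=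
    DifferentiableOn.diffContOnCl (by rwa [closure_ball _ one_ne_zero])
  have hfin := lintegral_circle_enorm_le hcl hr
  have hn1 : ∀ θ : ℝ, ‖circleMap 0 1 θ‖ ≤ 1 := fun θ => by simp
  have hnr : ∀ θ : ℝ, ‖circleMap 0 r θ‖ ≤ 1 := fun θ => by
    rw [norm_circleMap_zero, abs_of_nonneg hr.1]; exact hr.2.le
  simp only [hnorm _ (hn1 _), hnorm _ (hnr _)]
  exact hfin

/-! ### Möbius substitution -/

theorem norm_one_sub_mul_pos {r : ℝ} (hr : r ∈ Ico (0 : ℝ) 1) {u : ℂ} (hu : ‖u‖ < 1) :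
    0 < ‖(1 - r * u : ℂ)‖ := by
  have h1 : ‖(r * u : ℂ)‖ < 1 := by
    rw [norm_mul, Complex.norm_real, Real.norm_of_nonneg hr.1]
    nlinarith [hr.1, hr.2, norm_nonneg u]
  have h2 := norm_sub_norm_le (1 : ℂ) (r * u)
  rw [norm_one] at h2
  linarith

theorem one_sub_norm_sq_mobius {r : ℝ} (hr : r ∈ Ico (0 : ℝ) 1) {u : ℂ} (hu : ‖u‖ < 1) :
    1 - ‖(r - u) / (1 - r * u : ℂ)‖ ^ 2 = (1 - r ^ 2) / ‖(1 - r * u : ℂ)‖ ^ 2 * (1 - ‖u‖ ^ 2) := by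
  have h := (norm_one_sub_mul_pos hr hu).ne'
  have h2 : ‖(1 - r * u : ℂ)‖ ^ 2 - ‖(r - u : ℂ)‖ ^ 2 = (1 - r ^ 2) * (1 - ‖u‖ ^ 2) := by
    simp only [← Complex.normSq_eq_norm_sq, Complex.normSq_apply, Complex.sub_re, Complex.sub_im,
      Complex.re_ofReal_mul, Complex.im_ofReal_mul, Complex.one_re,
      Complex.one_im, Complex.ofReal_re, Complex.ofReal_im]
    ring
  rw [norm_div, div_pow, div_mul_eq_mul_div, ← h2]
  field_simp

theorem one_sub_mul_mobius {r : ℝ} (hr : r ∈ Ico (0 : ℝ) 1) {u : ℂ} (hu : ‖u‖ < 1) :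
    (1 - r * ((r - u) / (1 - r * u)) : ℂ) = ((1 - r ^ 2 : ℝ) : ℂ) / (1 - r * u) := by
  have h := norm_pos_iff.1 (norm_one_sub_mul_pos hr hu)
  field_simp
  push_cast
  ring

theorem norm_mobius_lt_one {r : ℝ} (hr : r ∈ Ico (0 : ℝ) 1) {u : ℂ} (hu : ‖u‖ < 1) :
    ‖(r - u) / (1 - r * u : ℂ)‖ < 1 := by
  have h1 := one_sub_norm_sq_mobius hr hu
  have h2 : 0 < 1 - r ^ 2 := by nlinarith [hr.1, hr.2]
  have h3 := norm_one_sub_mul_pos hr hu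
  have h4 : 0 < 1 - ‖u‖ ^ 2 := by nlinarith [norm_nonneg u]
  have h5 : 0 < (1 - r ^ 2) / ‖(1 - r * u : ℂ)‖ ^ 2 * (1 - ‖u‖ ^ 2) := by positivity
  rw [← h1] at h5
  nlinarith [norm_nonneg ((r - u) / (1 - r * u : ℂ))]

theorem mobius_mobius {r : ℝ} (hr : r ∈ Ico (0 : ℝ) 1) {u : ℂ} (hu : ‖u‖ < 1) :
    (r - (r - u) / (1 - r * u)) / (1 - r * ((r - u) / (1 - r * u))) = u := by
  rw [one_sub_mul_mobius hr hu]
  have h := norm_pos_iff.1 (norm_one_sub_mul_pos hr hu)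
  have h2 : ((1 - r ^ 2 : ℝ) : ℂ) ≠ 0 := by
    have : 0 < 1 - r ^ 2 := by nlinarith [hr.1, hr.2]
    exact_mod_cast this.ne'
  field_simp
  push_cast
  ring

theorem det_smul_one_complex (a : ℂ) : (a • (1 : ℂ →L[ℝ] ℂ)).det = ‖a‖ ^ 2 := by
  have : ((a • (1 : ℂ →L[ℝ] ℂ) : ℂ →L[ℝ] ℂ) : ℂ →ₗ[ℝ] ℂ) = LinearMap.mulLeft ℝ a := by
    ext
    all_goals simp
  rw [ContinuousLinearMap.det, this, show LinearMap.det (LinearMap.mulLeft ℝ a) =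
    Algebra.norm ℝ a from rfl, Algebra.norm_complex_apply, Complex.normSq_eq_norm_sq]

/-- The Möbius map is an involution of the disc, which gives injectivity and the image together; the
Jacobian is the squared modulus of its complex derivative. -/
theorem setLIntegral_ball_mobius {r : ℝ} (hr : r ∈ Ico (0 : ℝ) 1) (g : ℂ → ℝ≥0∞) :
    ∫⁻ a in Metric.ball 0 1, g a = ∫⁻ u in Metric.ball 0 1,
      ENNReal.ofReal (((1 - r ^ 2) / ‖(1 - r * u : ℂ)‖ ^ 2) ^ 2) *
        g ((r - u) / (1 - r * u)) := by
  set m : ℂ → ℂ := fun u => (r - u) / (1 - r * u) with hm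
  have hmaps : ∀ u ∈ Metric.ball (0 : ℂ) 1, m u ∈ Metric.ball (0 : ℂ) 1 := fun u hu => by
    rw [mem_ball_zero_iff] at hu ⊢
    exact norm_mobius_lt_one hr hu
  have hinv : ∀ u ∈ Metric.ball (0 : ℂ) 1, m (m u) = u := fun u hu =>
    mobius_mobius hr (mem_ball_zero_iff.1 hu)
  have himg : m '' Metric.ball 0 1 = Metric.ball 0 1 :=
    Subset.antisymm (image_subset_iff.2 hmaps) fun u hu => ⟨m u, hmaps u hu, hinv u hu⟩
  have hinj : InjOn m (Metric.ball 0 1) := fun u hu v hv huv => by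
    rw [← hinv u hu, ← hinv v hv, huv]
  have hder : ∀ u ∈ Metric.ball (0 : ℂ) 1, HasFDerivWithinAt m
      ((-((1 - r ^ 2 : ℝ) : ℂ) / (1 - r * u) ^ 2) • (1 : ℂ →L[ℝ] ℂ)) (Metric.ball 0 1) u := by
    intro u hu
    have h := norm_pos_iff.1 (norm_one_sub_mul_pos hr (mem_ball_zero_iff.1 hu))
    have h1 : HasDerivAt m (-((1 - r ^ 2 : ℝ) : ℂ) / (1 - r * u) ^ 2) u := by
      have := ((hasDerivAt_id u).const_sub (r : ℂ)).div
        (((hasDerivAt_id u).const_mul (r : ℂ)).const_sub 1) h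
      refine this.congr_deriv ?_
      congr 1
      push_cast
      simp only [id]
      ring
    exact h1.complexToReal_fderiv.hasFDerivWithinAt
  have key := lintegral_image_eq_lintegral_abs_det_fderiv_mul volume measurableSet_ball hder hinj g
  rw [himg] at key
  rw [key]
  refine lintegral_congr fun u => ?_
  have h2 : 0 < 1 - r ^ 2 := by nlinarith [hr.1, hr.2]
  rw [det_smul_one_complex, abs_of_nonneg (sq_nonneg _), norm_div, norm_neg, Complex.norm_real,
    Real.norm_of_nonneg h2.le, norm_pow]

theorem setLIntegral_eq_lintegral_of_eq_zero {X : Type*} [MeasurableSpace X] {μ : Measure X}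
    {s : Set X} (hs : MeasurableSet s) {f : X → ℝ≥0∞} (hf : ∀ x ∉ s, f x = 0) :
    ∫⁻ x in s, f x ∂μ = ∫⁻ x, f x ∂μ := by
  rw [← lintegral_indicator hs, indicator_eq_self.2]
  intro x hx
  by_contra h
  exact hx (hf x h)

/-- Put `a = (r-u)/(1-ru)`, `b = σv/(1-ru)` with `σ = √(1-r²)`: up to the sign of `b`, an involutive
automorphism of the ball of `ℂ²`. Weight, kernel, numerator and Jacobian contribute powers of `σ`
that cancel exactly, so the new integral still makes sense at `r = 1`. -/
theorem lintegral_kernel_eq_ballIntegral (β k s : ℝ) {r : ℝ} (hr : r ∈ Ico (0 : ℝ) 1) :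
    ∫⁻ a : ℂ, ∫⁻ b : ℂ, ENNReal.ofReal (‖((1 - r ^ 2 : ℝ) * k * a + √(1 - r ^ 2) * s * b : ℂ)‖ /
      ‖(1 - r * a : ℂ)‖ ^ (β + 4)) * posPow β (1 - ‖a‖ ^ 2 - ‖b‖ ^ 2) =
      ballIntegral β k s r := by
  have hσ : 0 < 1 - r ^ 2 := by nlinarith [hr.1, hr.2]
  have hzero : ∀ a : ℂ, a ∉ Metric.ball (0 : ℂ) 1 → ∀ b : ℂ,
      posPow β (1 - ‖a‖ ^ 2 - ‖b‖ ^ 2) = 0 := by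
    intro a ha b
    rw [mem_ball_zero_iff, not_lt] at ha
    exact posPow_of_nonpos (by nlinarith [sq_nonneg ‖b‖])
  unfold ballIntegral
  refine (setLIntegral_eq_lintegral_of_eq_zero (measurableSet_ball (x := (0 : ℂ)) (ε := 1))
    fun a ha => by simp [hzero a ha]).symm.trans ?_
  refine Eq.trans ?_ (setLIntegral_eq_lintegral_of_eq_zero
    (measurableSet_ball (x := (0 : ℂ)) (ε := 1)) fun a ha => by simp [hzero a ha])
  rw [setLIntegral_ball_mobius hr]
  refine setLIntegral_congr_fun measurableSet_ball fun u hu => ?_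
  rw [mem_ball_zero_iff] at hu
  have hd := norm_one_sub_mul_pos hr hu
  have hd0 := norm_pos_iff.1 hd
  set σ : ℝ := √(1 - r ^ 2) with hσd
  have hσp : 0 < σ := Real.sqrt_pos.2 hσ
  have hσ2 : 1 - r ^ 2 = σ ^ 2 := (Real.sq_sqrt hσ.le).symm
  have hc : (σ / (1 - r * u) : ℂ) ≠ 0 := div_ne_zero (by exact_mod_cast hσp.ne') hd0
  rw [lintegral_comp_mul_left_complex hc, ← mul_assoc, ← lintegral_const_mul _ (by fun_prop)]
  refine lintegral_congr fun v => ?_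
  set d : ℝ := ‖(1 - r * u : ℂ)‖ with hdd
  have hnc : ‖(σ / (1 - r * u) : ℂ)‖ = σ / d := by
    rw [norm_div, Complex.norm_real, Real.norm_of_nonneg hσp.le]
  have e1 : 1 - ‖(r - u) / (1 - r * u : ℂ)‖ ^ 2 - ‖(σ / (1 - r * u) * v : ℂ)‖ ^ 2 =
      (σ / d) ^ 2 * (1 - ‖u‖ ^ 2 - ‖v‖ ^ 2) := by
    rw [one_sub_norm_sq_mobius hr hu, norm_mul, hnc, hσ2]
    ring
  have e2 : (((σ ^ 2 : ℝ) : ℂ) * k * ((r - u) / (1 - r * u)) + σ * s * (σ / (1 - r * u) * v) : ℂ) =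
      ((σ ^ 2 : ℝ) : ℂ) / (1 - r * u) * (k * (r - u) + s * v) := by
    push_cast
    field_simp
  have e3 : ‖((σ ^ 2 : ℝ) : ℂ) / (1 - r * u)‖ = σ ^ 2 / d := by
    rw [norm_div, Complex.norm_real, Real.norm_of_nonneg (by positivity)]
  rw [e1, posPow_mul (by positivity), one_sub_mul_mobius hr hu, hσ2, e2, e3, norm_mul, e3, hnc,
    ← mul_assoc, ← ENNReal.ofReal_mul (by positivity), ← ENNReal.ofReal_mul (by positivity), ← mul_assoc,
    ← ENNReal.ofReal_mul (by positivity)]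
  congr 2
  have hσβ := Real.rpow_pos_of_pos hσp β
  have hdβ := Real.rpow_pos_of_pos hd β
  have hsq : ∀ x : ℝ, 0 < x → (x ^ 2) ^ β = x ^ β * x ^ β := fun x hx => by
    rw [sq, Real.mul_rpow hx.le hx.le]
  rw [show β + 4 = β + (4 : ℕ) by norm_num, show β + 3 = β + (3 : ℕ) by norm_num,
    Real.rpow_add_natCast (by positivity), Real.rpow_add_natCast hd.ne',
    Real.div_rpow (by positivity) hd.le, hsq σ hσp, hsq _ (by positivity),
    Real.div_rpow hσp.le hd.le]
  field_simp

/-! ### The elliptic integral: monotonicity and power series -/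

theorem continuous_sqrt_one_sub (k : ℝ) : Continuous fun θ : ℝ => √(1 - k ^ 2 * Real.sin θ ^ 2) := by
  fun_prop

theorem ellipticE_zero : ellipticE 0 = Real.pi / 2 := by
  simp [ellipticE]
  ring

theorem ellipticE_nonneg (k : ℝ) : 0 ≤ ellipticE k :=
  mul_nonneg (by norm_num)
    (intervalIntegral.integral_nonneg Real.pi_pos.le fun _ _ => Real.sqrt_nonneg _)

theorem ellipticE_strictAntiOn : StrictAntiOn ellipticE (Icc 0 1) := by
  intro k hk l hl hkl
  have hpi := Real.pi_pos
  have hkl2 : k ^ 2 < l ^ 2 := by nlinarith [hk.1]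
  unfold ellipticE
  refine mul_lt_mul_of_pos_left ?_ (by norm_num)
  refine intervalIntegral.integral_lt_integral_of_continuousOn_of_le_of_exists_lt hpi
    (continuous_sqrt_one_sub l).continuousOn (continuous_sqrt_one_sub k).continuousOn ?_ ?_
  · intro θ _
    apply Real.sqrt_le_sqrt
    nlinarith [sq_nonneg (Real.sin θ)]
  -- Strictness is tested at `θ = π/2`, where `sin θ = 1`; there `l ≤ 1` keeps the radicand
  -- nonnegative, so the square root is not truncated.
  · refine ⟨Real.pi / 2, ⟨by linarith, by linarith⟩, ?_⟩
    rw [Real.sin_pi_div_two]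
    apply Real.sqrt_lt_sqrt
    · nlinarith [hl.1, hl.2]
    · linarith

theorem ellipticE_le (k : ℝ) : ellipticE k ≤ Real.pi / 2 := by
  rw [← ellipticE_zero]
  unfold ellipticE
  refine mul_le_mul_of_nonneg_left ?_ (by norm_num)
  refine intervalIntegral.integral_mono_on Real.pi_pos.le
    ((continuous_sqrt_one_sub k).intervalIntegrable _ _)
    ((continuous_sqrt_one_sub 0).intervalIntegrable _ _) fun θ _ => ?_
  apply Real.sqrt_le_sqrt
  nlinarith [sq_nonneg (Real.sin θ), sq_nonneg (k * Real.sin θ)]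

/-- The binomial coefficient of `(1-x)^{-3/2}` is the rising factorial of `3/2` over `m!`, and `√π/2
= Γ(3/2)`. -/
theorem factorial_mul_choose_three_half (m : ℕ) :
    (m.factorial : ℝ) * Ring.choose (3 / 2 + m - 1 : ℝ) m * (√Real.pi / 2) =
      Real.Gamma (m + 3 / 2) := by
  rw [← Ring.multichoose_eq, ← nsmul_eq_mul, Ring.factorial_nsmul_multichoose_eq_ascPochhammer,
    Polynomial.ascPochhammer_smeval_eq_eval]
  induction m with
  | zero =>
    rw [show ((0 : ℕ) : ℝ) + 3 / 2 = 1 / 2 + 1 by norm_num, Real.Gamma_add_one (by norm_num),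
      Real.Gamma_one_half_eq]
    simp
    ring
  | succ m ih =>
    rw [ascPochhammer_succ_eval, show ((m + 1 : ℕ) : ℝ) + 3 / 2 = (m + 3 / 2) + 1 by push_cast; ring,
      Real.Gamma_add_one (by positivity), ← ih]
    ring

theorem factorial_mul_integral_sin_pow (m : ℕ) :
    (m.factorial : ℝ) * ∫ θ in (0 : ℝ)..Real.pi, Real.sin θ ^ (2 * m) =
      √Real.pi * Real.Gamma (m + 1 / 2) := by
  rw [integral_sin_pow_even]
  induction m with
  | zero =>
    have := Real.mul_self_sqrt Real.pi_pos.le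
    have h2 := Real.Gamma_one_half_eq
    simp only [Nat.factorial_zero, Nat.cast_one, Finset.range_zero, Finset.prod_empty, Nat.cast_zero,
      zero_add, h2]
    linarith
  | succ m ih =>
    rw [Finset.prod_range_succ, Nat.factorial_succ,
      show ((m + 1 : ℕ) : ℝ) + 1 / 2 = (m + 1 / 2) + 1 by push_cast; ring,
      Real.Gamma_add_one (by positivity), mul_left_comm (√Real.pi), ← ih]
    push_cast
    field_simp

/-- Termwise integration of the binomial series at `x = k² sin² θ`: the binomial coefficient
supplies `Γ(m+3/2)/m!` and the integral of `sin^{2m}` supplies `Γ(m+1/2)/m!`. The coefficients are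
nonnegative, so the convergent series at `x = k²` dominates. -/
theorem hasSum_coeffA {k : ℝ} (hk : |k| < 1) :
    HasSum (fun m : ℕ => coeffA m * k ^ (2 * m))
      (1 / 2 * ∫ θ in (0 : ℝ)..Real.pi, 1 / (1 - k ^ 2 * Real.sin θ ^ 2) ^ (3 / 2 : ℝ)) := by
  have hk2 : k ^ 2 < 1 := by rw [← sq_abs]; nlinarith [abs_nonneg k]
  have hpi := Real.pi_pos
  set c : ℕ → ℝ := fun m => Ring.choose (3 / 2 + m - 1 : ℝ) m with hc
  have hc0 : ∀ m, 0 ≤ c m := by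
    intro m
    have h1 := factorial_mul_choose_three_half m
    have h2 : 0 < Real.Gamma (m + 3 / 2) := Real.Gamma_pos_of_pos (by positivity)
    rw [← h1] at h2
    have h3 : (0 : ℝ) < m.factorial := by exact_mod_cast m.factorial_pos
    have h4 : 0 < √Real.pi / 2 := by positivity
    exact (pos_of_mul_pos_right (pos_of_mul_pos_left h2 h4.le) h3.le).le
  have hser : ∀ x : ℝ, 0 ≤ x → x < 1 → HasSum (fun m => c m * x ^ m) (1 / (1 - x) ^ (3 / 2 : ℝ)) := by
    intro x hx0 hx1
    have h := (Real.one_div_one_sub_rpow_hasFPowerSeriesOnBall_zero (3 / 2)).hasSum (y := x) (by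
      simp [enorm_eq_nnnorm, ← NNReal.coe_lt_coe, abs_of_nonneg hx0, hx1])
    simpa [mul_comm] using h
  have hx : ∀ θ : ℝ, 0 ≤ k ^ 2 * Real.sin θ ^ 2 ∧ k ^ 2 * Real.sin θ ^ 2 ≤ k ^ 2 := by
    intro θ
    have := Real.sin_sq_le_one θ
    exact ⟨by positivity, by nlinarith [sq_nonneg k]⟩
  have hInt : ∀ m : ℕ, Continuous fun θ : ℝ => c m * (k ^ 2 * Real.sin θ ^ 2) ^ m := by
    intro m; fun_prop
  have hsum := hasSum_integral_of_summable_integral_norm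
    (μ := volume.restrict (Ioc 0 Real.pi)) (F := fun m θ => c m * (k ^ 2 * Real.sin θ ^ 2) ^ m)
    (fun m => (hInt m).integrableOn_Ioc) (by
      refine Summable.of_nonneg_of_le (fun m => integral_nonneg fun θ => norm_nonneg _) (fun m => ?_)
        ((hser (k ^ 2) (sq_nonneg k) hk2).summable.mul_left Real.pi)
      have h1 : ∫ θ in Ioc 0 Real.pi, ‖c m * (k ^ 2 * Real.sin θ ^ 2) ^ m‖ ≤
          ∫ _ in Ioc 0 Real.pi, c m * (k ^ 2) ^ m := by
        refine integral_mono ((hInt m).norm.integrableOn_Ioc) (integrable_const _) fun θ => ?_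
        rw [Real.norm_of_nonneg (mul_nonneg (hc0 m) (pow_nonneg (hx θ).1 _))]
        exact mul_le_mul_of_nonneg_left (pow_le_pow_left₀ (hx θ).1 (hx θ).2 m) (hc0 m)
      refine h1.trans (le_of_eq ?_)
      simp [hpi.le])
  simp only [← intervalIntegral.integral_of_le hpi.le] at hsum
  have hsum2 := hsum.mul_left (1 / 2 : ℝ)
  have hterm : ∀ m : ℕ, coeffA m * k ^ (2 * m) =
      1 / 2 * ∫ θ in (0 : ℝ)..Real.pi, c m * (k ^ 2 * Real.sin θ ^ 2) ^ m := by
    intro m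
    have h1 : m.factorial * c m * (√Real.pi / 2) = Real.Gamma (m + 3 / 2) :=
      factorial_mul_choose_three_half m
    have h2 := factorial_mul_integral_sin_pow m
    have h3 : (m.factorial : ℝ) ≠ 0 := by exact_mod_cast m.factorial_ne_zero
    have h4 : ∀ θ : ℝ, c m * (k ^ 2 * Real.sin θ ^ 2) ^ m =
        c m * k ^ (2 * m) * Real.sin θ ^ (2 * m) := by
      intro θ
      rw [mul_pow, ← pow_mul, ← pow_mul, mul_assoc]
    simp only [h4]
    rw [intervalIntegral.integral_const_mul, coeffA, ← h1]
    have hs : √Real.pi ≠ 0 := by positivity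
    have h5 : Real.Gamma (m + 1 / 2) = (m.factorial : ℝ) *
        (∫ θ in (0 : ℝ)..Real.pi, Real.sin θ ^ (2 * m)) / √Real.pi := by
      rw [h2]; field_simp
    rw [h5]
    field_simp
  have hlim : ∀ θ : ℝ, ∑' m, c m * (k ^ 2 * Real.sin θ ^ 2) ^ m =
      1 / (1 - k ^ 2 * Real.sin θ ^ 2) ^ (3 / 2 : ℝ) := fun θ =>
    (hser _ (hx θ).1 ((hx θ).2.trans_lt hk2)).tsum_eq
  simp only [hlim, ← hterm] at hsum2
  exact hsum2

/-- With `Δ = 1 - k² sin² θ`, the difference `√Δ - (1-k²) Δ^{-3/2}` is the derivative of `k² sin θ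
cos θ / √Δ`, which vanishes at `0` and at `π`. -/
theorem ellipticE_eq_integral_rpow {k : ℝ} (hk : |k| < 1) :
    ellipticE k = (1 - k ^ 2) *
      (1 / 2 * ∫ θ in (0 : ℝ)..Real.pi, 1 / (1 - k ^ 2 * Real.sin θ ^ 2) ^ (3 / 2 : ℝ)) := by
  have hk2 : k ^ 2 < 1 := by rw [← sq_abs]; nlinarith [abs_nonneg k]
  have hD : ∀ θ : ℝ, 0 < 1 - k ^ 2 * Real.sin θ ^ 2 := by
    intro θ
    have := Real.sin_sq_le_one θ
    nlinarith [sq_nonneg k]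
  have hcont : Continuous fun θ : ℝ => 1 / (1 - k ^ 2 * Real.sin θ ^ 2) ^ (3 / 2 : ℝ) := by
    refine continuous_const.div ?_ fun θ => (Real.rpow_pos_of_pos (hD θ) _).ne'
    exact Continuous.rpow_const (by fun_prop) fun θ => Or.inl (hD θ).ne'
  have hderiv : ∀ θ : ℝ, HasDerivAt
      (fun θ => k ^ 2 * (Real.sin θ * Real.cos θ / √(1 - k ^ 2 * Real.sin θ ^ 2)))
      (√(1 - k ^ 2 * Real.sin θ ^ 2) -
        (1 - k ^ 2) * (1 / (1 - k ^ 2 * Real.sin θ ^ 2) ^ (3 / 2 : ℝ))) θ := by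
    intro θ
    have hs := Real.hasDerivAt_sin θ
    have hc := Real.hasDerivAt_cos θ
    have hd := (((hs.pow 2).const_mul (k ^ 2)).const_sub 1).sqrt (hD θ).ne'
    have hsq : 0 < √(1 - k ^ 2 * Real.sin θ ^ 2) := Real.sqrt_pos.2 (hD θ)
    have := ((hs.mul hc).div hd hsq.ne').const_mul (k ^ 2)
    refine this.congr_deriv ?_
    have h32 : (1 - k ^ 2 * Real.sin θ ^ 2) ^ (3 / 2 : ℝ) = √(1 - k ^ 2 * Real.sin θ ^ 2) ^ 3 := by
      rw [Real.sqrt_eq_rpow, ← Real.rpow_natCast _ 3, ← Real.rpow_mul (hD θ).le]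
      norm_num
    have h2 : √(1 - k ^ 2 * Real.sin θ ^ 2) ^ 2 = 1 - k ^ 2 * Real.sin θ ^ 2 :=
      Real.sq_sqrt (hD θ).le
    have hcs := Real.cos_sq' θ
    rw [h32]
    simp only [Pi.mul_apply, Pi.pow_apply]
    set S := Real.sin θ
    set K := Real.cos θ
    set q := √(1 - k ^ 2 * S ^ 2)
    field_simp
    rw [show q ^ 4 = (q ^ 2) ^ 2 by ring, h2, hcs]
    push_cast
    ring
  have hcont2 : Continuous fun θ : ℝ =>
      (1 - k ^ 2) * (1 / (1 - k ^ 2 * Real.sin θ ^ 2) ^ (3 / 2 : ℝ)) := continuous_const.mul hcont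
  have hInt := intervalIntegral.integral_eq_sub_of_hasDerivAt (a := 0) (b := Real.pi)
    (fun θ _ => hderiv θ) (((continuous_sqrt_one_sub k).sub hcont2).intervalIntegrable _ _)
  rw [intervalIntegral.integral_sub ((continuous_sqrt_one_sub k).intervalIntegrable _ _)
    (hcont2.intervalIntegrable _ _),
    intervalIntegral.integral_const_mul] at hInt
  simp only [Real.sin_pi, Real.sin_zero, zero_mul, zero_div, mul_zero, sub_zero] at hInt
  rw [ellipticE]
  linarith

theorem ellipticE_eq_tsum {k : ℝ} (hk : |k| < 1) :
    ellipticE k = (1 - k ^ 2) * ∑' m : ℕ, coeffA m * k ^ (2 * m) := by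
  rw [(hasSum_coeffA hk).tsum_eq, ellipticE_eq_integral_rpow hk]

/-! ### The function `l` -/

theorem Gamma_div_pos {n : ℕ} (hn : 2 ≤ n) {α : ℝ} (hα : -1 < α) :
    0 < Real.Gamma (n + α + 1) / (Real.Gamma (n + α - 1) * Real.pi ^ 2) := by
  have hn' : (2 : ℝ) ≤ n := by exact_mod_cast hn
  have h1 := Real.Gamma_pos_of_pos (by linarith : 0 < (n : ℝ) + α + 1)
  have h2 := Real.Gamma_pos_of_pos (by linarith : 0 < (n : ℝ) + α - 1)
  positivity

theorem CConst_pos {n : ℕ} {α : ℝ} (hα : -1 < α) : 0 < CConst n α := by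
  have hn' : (0 : ℝ) ≤ n := n.cast_nonneg
  have h1 := Real.Gamma_pos_of_pos (by linarith : 0 < (n : ℝ) + α + 2)
  have h2 := Real.Gamma_pos_of_pos (by linarith : 0 < ((n : ℝ) + α) / 2 + 1)
  unfold CConst
  positivity

/-- For `β = n+α-2` the value at `r = 1` has numerator `Γ(n+α-1)`, which cancels against the
constant from integrating out coordinates, as does `π²`; `Γ(n+α+2) = (n+α+1) Γ(n+α+1)` accounts for
the divisor. -/
theorem ofReal_mul_ballIntegral_one {n : ℕ} (hn : 2 ≤ n) {α k s : ℝ} (hα : -1 < α)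
    (hks : k ^ 2 + s ^ 2 = 1) :
    ENNReal.ofReal (Real.Gamma (n + α + 1) / (Real.Gamma (n + α - 1) * Real.pi ^ 2)) *
      ballIntegral (n + α - 2) k s 1 =
      ENNReal.ofReal (CConst n α * ellipticE k / (n + α + 1)) := by
  have hn' : (2 : ℝ) ≤ n := by exact_mod_cast hn
  rw [ballIntegral_one (by linarith) hks, ← ENNReal.ofReal_mul (Gamma_div_pos hn hα).le]
  congr 1
  have h2 := Real.Gamma_pos_of_pos (by linarith : 0 < (n : ℝ) + α - 1)
  have h3 := Real.Gamma_pos_of_pos (by linarith : 0 < ((n : ℝ) + α) / 2 + 1)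
  have h4 : (n : ℝ) + α + 1 ≠ 0 := by linarith
  rw [CConst, show (n : ℝ) + α + 2 = (n + α + 1) + 1 by ring, Real.Gamma_add_one h4,
    show ((n : ℝ) + α - 2) / 2 + 2 = (n + α) / 2 + 1 by ring,
    show (n : ℝ) + α - 2 + 1 = n + α - 1 by ring]
  have := Real.pi_pos
  field_simp

/-- The integrand of `l` involves two coordinates only and is the `r = 1` integrand with `k = cos
t`, `s = sin t`, `β + 3 = n + α + 1`. -/
theorem lintegral_lIntegrand {n : ℕ} (hn : 2 ≤ n) {α : ℝ} (hα : -1 < α) (t : ℝ) :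
    ∫⁻ w, ENNReal.ofReal (lIntegrand n hn α t w) ∂(weightedMeasure n α) =
      ENNReal.ofReal (CConst n α * ellipticE (Real.cos t) / (n + α + 1)) := by
  rw [← ofReal_mul_ballIntegral_one hn hα (Real.cos_sq_add_sin_sq t)]
  unfold lIntegrand ballIntegral
  rw [lintegral_weightedMeasure_two hn hα (h := fun a b => ENNReal.ofReal
    (‖(1 - a) * (Real.cos t : ℂ) + b * (Real.sin t : ℂ)‖ / ‖a - 1‖ ^ (n + α + 1))) (by fun_prop)]
  congr 1
  refine lintegral_congr fun a => lintegral_congr fun b => ?_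
  rw [show (n : ℝ) + α - 2 + 3 = n + α + 1 by ring, norm_sub_rev a 1, Complex.ofReal_one, one_mul,
    mul_comm (1 - a), mul_comm b]

theorem measurable_lIntegrand {n : ℕ} (hn : 2 ≤ n) (α t : ℝ) :
    Measurable (lIntegrand n hn α t) := by
  unfold lIntegrand
  fun_prop

theorem lIntegrand_nonneg {n : ℕ} (hn : 2 ≤ n) (α t : ℝ) (w : Cn n) :
    0 ≤ lIntegrand n hn α t w := by
  unfold lIntegrand
  positivity

theorem integrable_lIntegrand {n : ℕ} (hn : 2 ≤ n) {α : ℝ} (hα : -1 < α) (t : ℝ) :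
    Integrable (lIntegrand n hn α t) (weightedMeasure n α) := by
  refine ⟨(measurable_lIntegrand hn α t).aestronglyMeasurable, ?_⟩
  rw [hasFiniteIntegral_iff_ofReal (Filter.Eventually.of_forall (lIntegrand_nonneg hn α t)),
    lintegral_lIntegrand hn hα]
  exact ENNReal.ofReal_lt_top

theorem lFun_eq {n : ℕ} (hn : 2 ≤ n) {α : ℝ} (hα : -1 < α) (t : ℝ) :
    lFun n hn α t = CConst n α * ellipticE (Real.cos t) := by
  have hn' : (2 : ℝ) ≤ n := by exact_mod_cast hn
  have h4 : 0 < (n : ℝ) + α + 1 := by linarith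
  have hC := CConst_pos (n := n) hα
  have hE := ellipticE_nonneg (Real.cos t)
  rw [lFun, integral_eq_lintegral_of_nonneg_ae
    (Filter.Eventually.of_forall (lIntegrand_nonneg hn α t))
    (measurable_lIntegrand hn α t).aestronglyMeasurable, lintegral_lIntegrand hn hα,
    ENNReal.toReal_ofReal (by positivity)]
  field_simp

theorem strictMonoOn_lFun {n : ℕ} (hn : 2 ≤ n) {α : ℝ} (hα : -1 < α) :
    StrictMonoOn (lFun n hn α) (Icc 0 (Real.pi / 2)) := by
  intro t ht u hu htu
  rw [lFun_eq hn hα, lFun_eq hn hα]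
  have hpi := Real.pi_pos
  refine mul_lt_mul_of_pos_left ?_ (CConst_pos hα)
  refine ellipticE_strictAntiOn ⟨?_, Real.cos_le_one u⟩ ⟨?_, Real.cos_le_one t⟩ ?_
  · exact Real.cos_nonneg_of_mem_Icc ⟨by linarith [hu.1], hu.2⟩
  · exact Real.cos_nonneg_of_mem_Icc ⟨by linarith [ht.1], ht.2⟩
  · exact Real.cos_lt_cos_of_nonneg_of_le_pi_div_two ht.1 hu.2 htu

theorem abs_cos_lt_one_of_mem_Ioc {t : ℝ} (ht : t ∈ Ioc 0 (Real.pi / 2)) : |Real.cos t| < 1 := by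
  have hpi := Real.pi_pos
  rw [abs_of_nonneg (Real.cos_nonneg_of_mem_Icc ⟨by linarith [ht.1], ht.2⟩), ← Real.cos_zero]
  exact Real.cos_lt_cos_of_nonneg_of_le_pi_div_two le_rfl ht.2 ht.1

/-! ### The measure `v_α` -/

theorem isProbabilityMeasure_weightedMeasure {n : ℕ} (hn : 2 ≤ n) {α : ℝ} (hα : -1 < α) :
    IsProbabilityMeasure (weightedMeasure n α) := by
  have hn' : (2 : ℝ) ≤ n := by exact_mod_cast hn
  constructor
  have h1 := lintegral_weightedMeasure_two hn hα (h := fun _ _ => 1) measurable_const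
  simp only [lintegral_one, one_mul] at h1
  rw [h1]
  have h2 : ∀ a : ℂ, ∫⁻ b : ℂ, posPow (n + α - 2) (1 - ‖a‖ ^ 2 - ‖b‖ ^ 2) = _ :=
    fun a => lintegral_posPow_sub_norm_sq (by linarith) _
  simp only [h2]
  rw [lintegral_const_mul _ (by fun_prop), lintegral_posPow_sub_norm_sq (by linarith),
    posPow_of_pos one_pos, Real.one_rpow, ENNReal.ofReal_one, mul_one,
    ← ENNReal.ofReal_mul (by have : 0 < (n : ℝ) + α - 2 + 1 := by linarith
                             positivity), ← ENNReal.ofReal_mul (Gamma_div_pos hn hα).le,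
    ← ENNReal.ofReal_one]
  congr 1
  rw [show (n : ℝ) + α + 1 = (n + α - 1) + 1 + 1 by ring, Real.Gamma_add_one (by linarith),
    Real.Gamma_add_one (by linarith)]
  have h3 := Real.Gamma_pos_of_pos (by linarith : 0 < (n : ℝ) + α - 1)
  have h4 : (n : ℝ) + α - 1 ≠ 0 := by linarith
  have h5 : (n : ℝ) + α ≠ 0 := by linarith
  have := Real.pi_pos
  rw [show (n : ℝ) + α - 2 + 1 = n + α - 1 by ring, show (n : ℝ) + α - 1 + 1 = n + α by ring]
  field_simp

theorem weightedMeasure_absolutelyContinuous (n : ℕ) (α : ℝ) :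
    weightedMeasure n α ≪ ballVolume n :=
  withDensity_absolutelyContinuous _ _

theorem ae_mem_unitBall (n : ℕ) (α : ℝ) : ∀ᵐ w ∂(weightedMeasure n α), w ∈ unitBall n :=
  (weightedMeasure_absolutelyContinuous n α).ae_le (ae_restrict_mem measurableSet_ball)

theorem lintegral_weightedMeasure_unitary {n : ℕ} (α : ℝ) (U : Cn n ≃ₗᵢ[ℂ] Cn n)
    {g : Cn n → ℝ≥0∞} (hg : Measurable g) :
    ∫⁻ w, g (U w) ∂(weightedMeasure n α) = ∫⁻ w, g w ∂(weightedMeasure n α) := by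
  have hd : Measurable fun w : Cn n => ENNReal.ofReal (cConst n α * (1 - ‖w‖ ^ 2) ^ α) := by
    fun_prop
  have hU : Measurable U := U.continuous.measurable
  have hgU : Measurable fun w => g (U w) := hg.comp hU
  rw [weightedMeasure, lintegral_withDensity_eq_lintegral_mul _ hd hg,
    lintegral_withDensity_eq_lintegral_mul _ hd hgU, ballVolume,
    ← lintegral_indicator measurableSet_ball, ← lintegral_indicator measurableSet_ball,
    ← (measurePreserving_unitary U).lintegral_comp ((hd.mul hg).indicator measurableSet_ball)]
  refine lintegral_congr fun w => ?_
  by_cases hw : w ∈ Metric.ball (0 : Cn n) 1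
  · have hw' : U w ∈ Metric.ball (0 : Cn n) 1 := by simpa using hw
    rw [indicator_of_mem hw, indicator_of_mem hw']
    simp
  · have hw' : U w ∉ Metric.ball (0 : Cn n) 1 := by simpa using hw
    rw [indicator_of_notMem hw, indicator_of_notMem hw']

/-! ### Unitary reduction of the kernel to two coordinates -/

theorem exists_orthonormalBasis_pair {n : ℕ} (hn : 2 ≤ n) {x y : Cn n} (hx : ‖x‖ = 1)
    (hy : ‖y‖ = 1) (hxy : inner ℂ x y = 0) :
    ∃ b : OrthonormalBasis (Fin n) ℂ (Cn n), b ⟨0, by omega⟩ = x ∧ b ⟨1, by omega⟩ = y := by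
  let i0 : Fin n := ⟨0, by omega⟩
  let i1 : Fin n := ⟨1, by omega⟩
  have h01 : i1 ≠ i0 := by simp [i0, i1]
  let v : Fin n → Cn n := fun i => if i = i0 then x else y
  have hv : Orthonormal ℂ (({i0, i1} : Set (Fin n)).domRestrict v) := by
    have hyx : inner ℂ y x = 0 := by rw [← inner_conj_symm, hxy, map_zero]
    constructor
    · rintro ⟨i, rfl | rfl⟩ <;> simp [v, h01, hx, hy]
    · rintro ⟨i, rfl | rfl⟩ ⟨j, rfl | rfl⟩ hij
      · exact absurd rfl hij
      · simpa [v, h01] using hxy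
      · simpa [v, h01] using hyx
      · exact absurd rfl hij
  obtain ⟨b, hb⟩ := hv.exists_orthonormalBasis_extension_of_card_eq (by simp)
  refine ⟨b, ?_, ?_⟩
  · rw [hb i0 (by simp)]; simp [v]
  · rw [hb i1 (by simp)]; simp [v, h01]

theorem exists_orthogonal_unit {n : ℕ} (hn : 2 ≤ n) {x : Cn n} (hx : ‖x‖ = 1) :
    ∃ y : Cn n, ‖y‖ = 1 ∧ inner ℂ x y = 0 := by
  let i0 : Fin n := ⟨0, by omega⟩
  let i1 : Fin n := ⟨1, by omega⟩
  have h01 : i0 ≠ i1 := by simp [i0, i1]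
  have hv : Orthonormal ℂ (({i0} : Set (Fin n)).domRestrict fun _ => x) := by
    rw [orthonormal_iff_ite]
    rintro ⟨i, hi⟩ ⟨j, hj⟩
    rcases hi with rfl
    rcases hj with rfl
    simp [hx, inner_self_eq_norm_sq_to_K]
  obtain ⟨b, hb⟩ := hv.exists_orthonormalBasis_extension_of_card_eq (by simp)
  refine ⟨b i1, b.orthonormal.1 i1, ?_⟩
  rw [← hb i0 rfl]
  exact b.orthonormal.2 h01

/-- Split `ζ` into its parts along and orthogonal to `z`. The phase `c` of the first coefficient is
factored out and its conjugate absorbed into `y`, so that both coefficients become real. -/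
theorem exists_orthonormal_decomposition {n : ℕ} (hn : 2 ≤ n) (z : Cn n) {ζ : Cn n}
    (hζ : ‖ζ‖ = 1) :
    ∃ (x y : Cn n) (k s : ℝ) (c : ℂ), ‖x‖ = 1 ∧ ‖y‖ = 1 ∧ inner ℂ x y = 0 ∧ ‖c‖ = 1 ∧
      k ^ 2 + s ^ 2 = 1 ∧ z = (‖z‖ : ℂ) • x ∧ ζ = c • ((k : ℂ) • x + (s : ℂ) • y) := by
  obtain ⟨x, hx, hz⟩ : ∃ x : Cn n, ‖x‖ = 1 ∧ z = (‖z‖ : ℂ) • x := by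
    rcases eq_or_ne z 0 with rfl | hz
    · exact ⟨ζ, hζ, by simp⟩
    · have hz0 : (‖z‖ : ℂ) ≠ 0 := by simpa using hz
      refine ⟨(‖z‖ : ℂ)⁻¹ • z, ?_, ?_⟩
      · rw [norm_smul]; simp [hz]
      · rw [smul_smul, mul_inv_cancel₀ hz0, one_smul]
  set a : ℂ := inner ℂ x ζ with ha
  set q : Cn n := ζ - a • x with hq
  have hxx : inner ℂ x x = (1 : ℂ) := by rw [inner_self_eq_norm_sq_to_K, hx]; simp
  have hxq : inner ℂ x q = 0 := by
    rw [hq, inner_sub_right, inner_smul_right, hxx, ← ha]; simp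
  obtain ⟨y, hy, hxy, hqy⟩ : ∃ y : Cn n, ‖y‖ = 1 ∧ inner ℂ x y = 0 ∧ q = (‖q‖ : ℂ) • y := by
    rcases eq_or_ne q 0 with h0 | h0
    · obtain ⟨y, hy, hxy⟩ := exists_orthogonal_unit hn hx
      exact ⟨y, hy, hxy, by simp [h0]⟩
    · have hq0 : (‖q‖ : ℂ) ≠ 0 := by simpa using h0
      refine ⟨(‖q‖ : ℂ)⁻¹ • q, ?_, ?_, ?_⟩
      · rw [norm_smul]; simp [h0]
      · rw [inner_smul_right, hxq, mul_zero]
      · rw [smul_smul, mul_inv_cancel₀ hq0, one_smul]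
  obtain ⟨c, hc, hac⟩ : ∃ c : ℂ, ‖c‖ = 1 ∧ a = c * ‖a‖ := by
    rcases eq_or_ne a 0 with h0 | h0
    · exact ⟨1, by simp, by simp [h0]⟩
    · have ha0 : (‖a‖ : ℂ) ≠ 0 := by simpa using h0
      refine ⟨a / ‖a‖, by simp [h0], by field_simp⟩
  have hcc : c * (starRingEnd ℂ) c = 1 := by
    rw [Complex.mul_conj, Complex.normSq_eq_norm_sq, hc]; simp
  refine ⟨x, (starRingEnd ℂ) c • y, ‖a‖, ‖q‖, c, hx, ?_, ?_, hc, ?_, hz, ?_⟩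
  · rw [norm_smul, RCLike.norm_conj, hc, hy, one_mul]
  · rw [inner_smul_right, hxy, mul_zero]
  · have h1 : ζ = a • x + q := by rw [hq]; abel
    have h2 := norm_add_sq (𝕜 := ℂ) (a • x) q
    rw [← h1, hζ, inner_smul_left, hxq, norm_smul, hx] at h2
    simp at h2
    linarith
  · rw [smul_add, smul_smul, smul_smul, smul_smul, ← hac,
      show c * ‖q‖ * (starRingEnd ℂ) c = (‖q‖ : ℂ) * (c * (starRingEnd ℂ) c) by ring, hcc, mul_one,
      ← hqy, hq]
    abel

/-- Only `⟨x,w⟩` and `⟨y,w⟩` enter the integrand; completing `x`, `y` to an orthonormal basis makes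
them the first two coordinates, up to conjugations that do not change moduli. -/
theorem lintegral_kernel_weightedMeasure {n : ℕ} (hn : 2 ≤ n) {α : ℝ} (hα : -1 < α) {x y : Cn n}
    (hx : ‖x‖ = 1) (hy : ‖y‖ = 1) (hxy : inner ℂ x y = 0) (k s : ℝ) {r : ℝ}
    (hr : r ∈ Ico (0 : ℝ) 1) :
    ∫⁻ w, ENNReal.ofReal (‖ip (((1 - r ^ 2 : ℝ) * k : ℂ) • x + (√(1 - r ^ 2) * s : ℂ) • y) w‖ /
        ‖1 - ip ((r : ℂ) • x) w‖ ^ (n + α + 2)) ∂(weightedMeasure n α) =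
      ENNReal.ofReal (Real.Gamma (n + α + 1) / (Real.Gamma (n + α - 1) * Real.pi ^ 2)) *
        ballIntegral (n + α - 2) k s r := by
  obtain ⟨b, hb0, hb1⟩ := exists_orthonormalBasis_pair hn hx hy hxy
  rw [← lintegral_kernel_eq_ballIntegral _ _ _ hr, ← lintegral_weightedMeasure_two hn hα
    (h := fun a c => ENNReal.ofReal (‖((1 - r ^ 2 : ℝ) * k * a + √(1 - r ^ 2) * s * c : ℂ)‖ /
      ‖(1 - r * a : ℂ)‖ ^ ((n : ℝ) + α - 2 + 4))) (by fun_prop)]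
  refine Eq.trans ?_ (lintegral_weightedMeasure_unitary α b.repr (by fun_prop))
  refine lintegral_congr fun w => ?_
  rw [b.repr_apply_apply, b.repr_apply_apply, hb0, hb1,
    show (n : ℝ) + α - 2 + 4 = n + α + 2 by ring]
  congr 2
  · rw [ip, norm_inner_symm, inner_add_left, inner_smul_left, inner_smul_left]
    simp
  · congr 1
    rw [ip, ← RCLike.norm_conj, map_sub, map_one, inner_conj_symm, inner_smul_left]
    simp

/-! ### Differentiation of the Bergman projection -/

theorem norm_ip_le {n : ℕ} (z w : Cn n) : ‖ip z w‖ ≤ ‖w‖ * ‖z‖ := norm_inner_le_norm w z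

theorem one_sub_norm_le_norm_one_sub_ip {n : ℕ} (z : Cn n) {w : Cn n} (hw : w ∈ unitBall n) :
    1 - ‖z‖ ≤ ‖1 - ip z w‖ := by
  rw [mem_ball_zero_iff] at hw
  have h1 := norm_ip_le z w
  have h2 := norm_sub_norm_le (1 : ℂ) (ip z w)
  rw [norm_one] at h2
  nlinarith [norm_nonneg z]

theorem one_sub_ip_mem_slitPlane {n : ℕ} {z w : Cn n} (hz : z ∈ unitBall n)
    (hw : w ∈ unitBall n) : 1 - ip z w ∈ Complex.slitPlane := by
  rw [mem_ball_zero_iff] at hw hz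
  refine Or.inl ?_
  have h1 := (Complex.re_le_norm (ip z w)).trans (norm_ip_le z w)
  rw [Complex.sub_re, Complex.one_re]
  nlinarith [norm_nonneg z, norm_nonneg w]

theorem norm_cpow_ofReal {a : ℂ} (ha : a ≠ 0) (x : ℝ) : ‖a ^ (x : ℂ)‖ = ‖a‖ ^ x := by
  rw [Complex.norm_cpow_of_ne_zero ha]
  simp

@[fun_prop]
theorem measurable_ip {n : ℕ} (z : Cn n) : Measurable fun w : Cn n => ip z w := by
  unfold ip
  fun_prop

/-- The scalar factor `(n+α+1) (1 - ⟨z,w⟩)^{-(n+α+2)}` in the derivative of the kernel. -/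
def kernelFactor (n : ℕ) (α : ℝ) (z w : Cn n) : ℂ :=
  ((n + α + 1 : ℝ) : ℂ) / (1 - ip z w) ^ ((n + α + 2 : ℝ) : ℂ)

@[fun_prop]
theorem measurable_kernelFactor (n : ℕ) (α : ℝ) (z : Cn n) : Measurable (kernelFactor n α z) := by
  unfold kernelFactor
  fun_prop

@[fun_prop]
theorem measurable_bergmanKernel (n : ℕ) (α : ℝ) (z : Cn n) :
    Measurable (bergmanKernel n α z) := by
  unfold bergmanKernel
  fun_prop

theorem norm_kernelFactor {n : ℕ} {α : ℝ} (hα : -1 < α) {z w : Cn n} (hz : z ∈ unitBall n)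
    (hw : w ∈ unitBall n) :
    ‖kernelFactor n α z w‖ = (n + α + 1) / ‖1 - ip z w‖ ^ (n + α + 2) := by
  have hn : (0 : ℝ) ≤ n := n.cast_nonneg
  rw [kernelFactor, norm_div, norm_cpow_ofReal (Complex.slitPlane_ne_zero
    (one_sub_ip_mem_slitPlane hz hw)), Complex.norm_real, Real.norm_of_nonneg (by linarith)]

theorem hasFDerivAt_bergmanKernel {n : ℕ} {α : ℝ} {z w : Cn n} (hz : z ∈ unitBall n)
    (hw : w ∈ unitBall n) :
    HasFDerivAt (fun z => bergmanKernel n α z w) (kernelFactor n α z w • innerSL ℂ w) z := by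
  have hs := one_sub_ip_mem_slitPlane hz hw
  have hne := Complex.slitPlane_ne_zero hs
  have h1 : HasFDerivAt (fun z => 1 - ip z w) (-(innerSL ℂ w)) z :=
    ((innerSL ℂ w).hasFDerivAt (x := z)).const_sub 1
  have h2 : HasDerivAt (fun a : ℂ => 1 / a ^ ((n + α + 1 : ℝ) : ℂ)) (-kernelFactor n α z w)
      (1 - ip z w) := by
    have h3 := (hasDerivAt_id (1 - ip z w)).cpow_const (c := -((n + α + 1 : ℝ) : ℂ)) hs
    have h4 : (fun a : ℂ => id a ^ (-((n + α + 1 : ℝ) : ℂ))) =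
        fun a : ℂ => 1 / a ^ ((n + α + 1 : ℝ) : ℂ) := by
      funext a
      rw [id, Complex.cpow_neg, one_div]
    rw [h4] at h3
    refine h3.congr_deriv ?_
    rw [kernelFactor, id, show -((n + α + 1 : ℝ) : ℂ) - 1 = -((n + α + 2 : ℝ) : ℂ) by push_cast; ring,
      Complex.cpow_neg]
    ring
  have h5 := h2.comp_hasFDerivAt z h1
  refine h5.congr_fderiv ?_
  rw [smul_neg, neg_smul, neg_neg]

theorem ae_norm_le_of_LInfty {n : ℕ} (α : ℝ) (f : LInfty n) :
    ∀ᵐ w ∂(weightedMeasure n α), ‖f w‖ ≤ ‖f‖ := by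
  refine (weightedMeasure_absolutelyContinuous n α).ae_le ?_
  have hne : eLpNormEssSup f (ballVolume n) ≠ ∞ := by
    rw [← eLpNorm_exponent_top]
    exact Lp.eLpNorm_ne_top f
  filter_upwards [enorm_ae_le_eLpNormEssSup f (ballVolume n)] with w hw
  rw [Lp.norm_def, eLpNorm_exponent_top, ← toReal_enorm]
  exact ENNReal.toReal_mono hne hw

theorem aestronglyMeasurable_LInfty {n : ℕ} (α : ℝ) (f : LInfty n) :
    AEStronglyMeasurable f (weightedMeasure n α) :=
  (Lp.aestronglyMeasurable f).mono_ac (weightedMeasure_absolutelyContinuous n α)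

theorem hasFDerivAt_bergmanProj {n : ℕ} (hn : 2 ≤ n) {α : ℝ} (hα : -1 < α) (f : LInfty n)
    {z : Cn n} (hz : z ∈ unitBall n) :
    Integrable (fun w => f w • (kernelFactor n α z w • innerSL ℂ w)) (weightedMeasure n α) ∧
    HasFDerivAt (bergmanProj n α f)
      (∫ w, f w • (kernelFactor n α z w • innerSL ℂ w) ∂(weightedMeasure n α)) z := by
  have := isProbabilityMeasure_weightedMeasure hn hα
  have hn' : (2 : ℝ) ≤ n := by exact_mod_cast hn
  -- Half the distance to the sphere: for `y` within `ε` of `z`, `|1-⟨y,w⟩| ≥ 1-|y| ≥ ε`, which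
  -- gives a constant dominating function.
  set ε : ℝ := (1 - ‖z‖) / 2 with hε
  have hz' : ‖z‖ < 1 := mem_ball_zero_iff.1 hz
  have hε0 : 0 < ε := by rw [hε]; linarith
  have hball : ∀ y ∈ Metric.ball z ε, y ∈ unitBall n ∧ ε ≤ 1 - ‖y‖ := by
    intro y hy
    rw [mem_ball_iff_norm] at hy
    have h1 : ‖y‖ ≤ ‖y - z‖ + ‖z‖ := by simpa using norm_add_le (y - z) z
    refine ⟨mem_ball_zero_iff.2 ?_, ?_⟩
    · linarith
    · linarith
  have hbd : ∀ᵐ w ∂(weightedMeasure n α), ∀ y ∈ Metric.ball z ε,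
      ‖f w • (kernelFactor n α y w • innerSL ℂ w)‖ ≤
        ‖f‖ * ((n + α + 1) / ε ^ (n + α + 2)) := by
    filter_upwards [ae_mem_unitBall n α, ae_norm_le_of_LInfty α f] with w hw hfw y hy
    obtain ⟨hy1, hy2⟩ := hball y hy
    rw [norm_smul, norm_smul, innerSL_apply_norm, norm_kernelFactor hα hy1 hw]
    have hle := one_sub_norm_le_norm_one_sub_ip y hw
    have h0 : ‖w‖ ≤ 1 := (mem_ball_zero_iff.1 hw).le
    have h1 : (n + α + 1) / ‖1 - ip y w‖ ^ (n + α + 2) ≤ (n + α + 1) / ε ^ (n + α + 2) := by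
      refine div_le_div_of_nonneg_left (by linarith) (by positivity) ?_
      exact Real.rpow_le_rpow hε0.le (hy2.trans hle) (by linarith)
    have h2 : 0 ≤ (n + α + 1) / ‖1 - ip y w‖ ^ (n + α + 2) :=
      div_nonneg (by linarith) (by positivity)
    refine mul_le_mul hfw ?_ (by positivity) (norm_nonneg _)
    calc _ ≤ (n + α + 1) / ‖1 - ip y w‖ ^ (n + α + 2) * 1 := by gcongr
      _ ≤ _ := by rw [mul_one]; exact h1
  have hmeas' : ∀ y : Cn n, AEStronglyMeasurable
      (fun w => f w • (kernelFactor n α y w • innerSL ℂ w)) (weightedMeasure n α) := by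
    intro y
    have h1 : AEStronglyMeasurable (kernelFactor n α y) (weightedMeasure n α) :=
      (measurable_kernelFactor n α y).aestronglyMeasurable
    have h2 : AEStronglyMeasurable (fun w : Cn n => innerSL ℂ w) (weightedMeasure n α) :=
      (innerSL ℂ).continuous.aestronglyMeasurable
    exact (aestronglyMeasurable_LInfty α f).smul (h1.smul h2)
  have hmeas : ∀ y : Cn n, AEStronglyMeasurable
      (fun w => bergmanKernel n α y w * f w) (weightedMeasure n α) := fun y =>
    (measurable_bergmanKernel n α y).aestronglyMeasurable.mul (aestronglyMeasurable_LInfty α f)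
  have hInt : Integrable (fun w => bergmanKernel n α z w * f w) (weightedMeasure n α) := by
    refine Integrable.of_bound (hmeas z) (1 / (1 - ‖z‖) ^ (n + α + 1) * ‖f‖) ?_
    filter_upwards [ae_mem_unitBall n α, ae_norm_le_of_LInfty α f] with w hw hfw
    have hz1 : 0 < 1 - ‖z‖ := by linarith
    rw [norm_mul, bergmanKernel, norm_div, norm_one, norm_cpow_ofReal (Complex.slitPlane_ne_zero
      (one_sub_ip_mem_slitPlane hz hw))]
    refine mul_le_mul ?_ hfw (norm_nonneg _) (by positivity)
    refine one_div_le_one_div_of_le (by positivity) ?_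
    exact Real.rpow_le_rpow hz1.le (one_sub_norm_le_norm_one_sub_ip z hw) (by linarith)
  refine ⟨Integrable.of_bound (hmeas' z) _ (hbd.mono fun w hw => hw z (Metric.mem_ball_self hε0)), ?_⟩
  have hd : ∀ᵐ w ∂(weightedMeasure n α), ∀ y ∈ Metric.ball z ε,
      HasFDerivAt (fun y => bergmanKernel n α y w * f w)
        (f w • (kernelFactor n α y w • innerSL ℂ w)) y := by
    filter_upwards [ae_mem_unitBall n α] with w hw y hy
    exact (hasFDerivAt_bergmanKernel (hball y hy).1 hw).mul_const (f w)
  exact hasFDerivAt_integral_of_dominated_of_fderiv_le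
    (F := fun y w => bergmanKernel n α y w * f w)
    (F' := fun y w => f w • (kernelFactor n α y w • innerSL ℂ w))
    (Metric.ball_mem_nhds z hε0)
    (Filter.Eventually.of_forall hmeas) hInt (hmeas' z) hbd (integrable_const _) hd

/-! ### The derivative of the involutions -/

/-- The derivative of `φ_z` at the origin. -/
def ballAutDeriv {n : ℕ} (z ζ : Cn n) : Cn n :=
  -(((1 - ‖z‖ ^ 2 : ℝ) : ℂ) • lineProj z ζ + ((√(1 - ‖z‖ ^ 2) : ℝ) : ℂ) • (ζ - lineProj z ζ))

/-- By the product rule the scalar prefactor contributes `⟨ζ,z⟩ z = |z|² P_z ζ`, which turns the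
complex-radial part `-P_z ζ` into `-(1-|z|²) P_z ζ`; the orthogonal part is only scaled by
`√(1-|z|²)`. -/
theorem exists_hasFDerivAt_ballAut {n : ℕ} (z : Cn n) :
    ∃ D : Cn n →L[ℂ] Cn n, HasFDerivAt (ballAut z) D 0 ∧ ∀ ζ, D ζ = ballAutDeriv z ζ := by
  let P : Cn n →L[ℂ] Cn n := (innerSL ℂ z).smulRight ((((‖z‖ ^ 2 : ℝ) : ℂ)⁻¹) • z)
  have hP : ∀ w, P w = lineProj z w := by
    intro w
    simp only [P, lineProj, ContinuousLinearMap.smulRight_apply, smul_smul, div_eq_mul_inv]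
    rfl
  have hip : HasFDerivAt (fun w : Cn n => ip w z) (innerSL ℂ z) 0 := (innerSL ℂ z).hasFDerivAt
  have hlp : HasFDerivAt (fun w : Cn n => lineProj z w) P 0 := by
    have := P.hasFDerivAt (x := 0)
    simpa only [funext hP] using this
  have h0 : ip (0 : Cn n) z = 0 := by simp [ip]
  have hinv : HasFDerivAt (fun w : Cn n => (1 - ip w z)⁻¹) (innerSL ℂ z) 0 := by
    have h1 : HasDerivAt (fun a : ℂ => a⁻¹) (-1) (1 - ip (0 : Cn n) z) := by
      rw [h0]
      simpa using hasDerivAt_inv (x := (1 - 0 : ℂ)) (by simp)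
    have h2 := h1.comp_hasFDerivAt 0 (hip.const_sub 1)
    refine h2.congr_fderiv ?_
    rw [smul_neg, neg_smul, one_smul, neg_neg]
  have hlin := (hlp.const_sub z).sub
    (((hasFDerivAt_id (0 : Cn n)).sub hlp).const_smul ((√(1 - ‖z‖ ^ 2) : ℝ) : ℂ))
  refine ⟨_, hinv.smul hlin, fun ζ => ?_⟩
  have hlp0 : lineProj z 0 = 0 := by simp [lineProj, ip]
  have hz := norm_sq_smul_lineProj z ζ
  simp only [h0, hlp0, _root_.add_apply, _root_.smul_apply,
    _root_.sub_apply, _root_.neg_apply,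
    ContinuousLinearMap.smulRight_apply, hP, innerSL_apply_apply, ContinuousLinearMap.id_apply,
    sub_zero, inv_one, one_smul, smul_zero]
  have hz' : inner ℂ z ζ • z = ((‖z‖ ^ 2 : ℝ) : ℂ) • lineProj z ζ := hz.symm
  rw [hz', ballAutDeriv]
  push_cast
  module

theorem ballAutDeriv_smul {n : ℕ} {x y : Cn n} (hx : ‖x‖ = 1) (hxy : inner ℂ x y = 0) {r : ℝ}
    (hr : 0 ≤ r) (k s : ℝ) (c : ℂ) :
    ballAutDeriv ((r : ℂ) • x) (c • ((k : ℂ) • x + (s : ℂ) • y)) =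
      -c • (((1 - r ^ 2 : ℝ) * k : ℂ) • x + (√(1 - r ^ 2) * s : ℂ) • y) := by
  have hnorm : ‖(r : ℂ) • x‖ = r := by
    rw [norm_smul, hx, mul_one, Complex.norm_real, Real.norm_of_nonneg hr]
  rw [ballAutDeriv, hnorm]
  -- At `r = 0` the line projection is zero by convention and not the projection onto `x`, but both
  -- scale factors are `1` and the formula persists.
  rcases eq_or_ne r 0 with rfl | hr0
  · have hl : ∀ ζ : Cn n, lineProj (((0 : ℝ) : ℂ) • x) ζ = 0 := fun ζ => by simp [lineProj]
    rw [hl]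
    simp only [zero_pow two_ne_zero, sub_zero, Real.sqrt_one, Complex.ofReal_one]
    module
  · have hne : (r : ℂ) ≠ 0 := by exact_mod_cast hr0
    have hip : ip (c • ((k : ℂ) • x + (s : ℂ) • y)) ((r : ℂ) • x) = r * (c * k) := by
      rw [ip, inner_smul_left, inner_smul_right, inner_add_right, inner_smul_right,
        inner_smul_right, hxy, inner_self_eq_norm_sq_to_K, hx]
      simp
    have hl : lineProj ((r : ℂ) • x) (c • ((k : ℂ) • x + (s : ℂ) • y)) = (c * k) • x := by
      rw [lineProj, hip, hnorm, smul_smul]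
      congr 1
      push_cast
      field_simp
    rw [hl]
    module

/-! ### The upper bound -/

theorem fderiv_bergmanProj_comp_ballAut {n : ℕ} (hn : 2 ≤ n) {α : ℝ} (hα : -1 < α) (f : LInfty n)
    {z : Cn n} (hz : z ∈ unitBall n) (ζ : Cn n) :
    fderiv ℂ (bergmanProj n α f ∘ ballAut z) 0 ζ =
      ∫ w, f w * (kernelFactor n α z w * ip (ballAutDeriv z ζ) w) ∂(weightedMeasure n α) := by
  obtain ⟨hInt, hder⟩ := hasFDerivAt_bergmanProj hn hα f hz
  obtain ⟨D, hD, hDζ⟩ := exists_hasFDerivAt_ballAut z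
  rw [← ballAut_zero z] at hder
  rw [(hder.comp 0 hD).fderiv, ContinuousLinearMap.comp_apply, hDζ, ballAut_zero,
    ContinuousLinearMap.integral_apply hInt]
  rfl

theorem differentiableOn_bergmanProj {n : ℕ} (hn : 2 ≤ n) {α : ℝ} (hα : -1 < α) (f : LInfty n) :
    DifferentiableOn ℂ (bergmanProj n α f) (unitBall n) := fun _ hz =>
  (hasFDerivAt_bergmanProj hn hα f hz).2.differentiableAt.differentiableWithinAt

theorem smul_mem_unitBall {n : ℕ} {x : Cn n} (hx : ‖x‖ = 1) {r : ℝ} (hr : r ∈ Ico (0 : ℝ) 1) :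
    (r : ℂ) • x ∈ unitBall n := by
  rw [mem_ball_zero_iff, norm_smul, hx, mul_one, Complex.norm_real, Real.norm_of_nonneg hr.1]
  exact hr.2

theorem lintegral_enorm_kernel {n : ℕ} (hn : 2 ≤ n) {α : ℝ} (hα : -1 < α) {x y : Cn n}
    (hx : ‖x‖ = 1) (hy : ‖y‖ = 1) (hxy : inner ℂ x y = 0) (k s : ℝ) {c : ℂ} (hc : ‖c‖ = 1)
    {r : ℝ} (hr : r ∈ Ico (0 : ℝ) 1) :
    ∫⁻ w, ‖kernelFactor n α ((r : ℂ) • x) w *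
        ip (ballAutDeriv ((r : ℂ) • x) (c • ((k : ℂ) • x + (s : ℂ) • y))) w‖ₑ
          ∂(weightedMeasure n α) =
      ENNReal.ofReal (n + α + 1) *
        (ENNReal.ofReal (Real.Gamma (n + α + 1) / (Real.Gamma (n + α - 1) * Real.pi ^ 2)) *
          ballIntegral (n + α - 2) k s r) := by
  have hn' : (2 : ℝ) ≤ n := by exact_mod_cast hn
  rw [← lintegral_kernel_weightedMeasure hn hα hx hy hxy k s hr,
    ← lintegral_const_mul _ (by fun_prop)]
  refine lintegral_congr_ae ?_
  filter_upwards [ae_mem_unitBall n α] with w hw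
  rw [ballAutDeriv_smul hx hxy hr.1, ← ENNReal.ofReal_mul (by linarith), ← ofReal_norm, norm_mul,
    norm_kernelFactor hα (smul_mem_unitBall hx hr) hw]
  congr 1
  have h1 : ∀ η : Cn n, ‖ip (-c • η) w‖ = ‖ip η w‖ := by
    intro η
    rw [ip, inner_smul_right, norm_mul, norm_neg, hc, one_mul, ip]
  rw [h1]
  ring

/-- Passing from `r = |z|` to `r = 1` bounds the `L¹` norm by `C_α E(k)`, and `E(k) ≤ π/2` for every
direction. -/
theorem lintegral_enorm_kernel_le {n : ℕ} (hn : 2 ≤ n) {α : ℝ} (hα : -1 < α) {z ζ : Cn n}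
    (hz : z ∈ unitBall n) (hζ : ‖ζ‖ = 1) :
    ∫⁻ w, ‖kernelFactor n α z w * ip (ballAutDeriv z ζ) w‖ₑ ∂(weightedMeasure n α) ≤
      ENNReal.ofReal (Real.pi / 2 * CConst n α) := by
  have hn' : (2 : ℝ) ≤ n := by exact_mod_cast hn
  obtain ⟨x, y, k, s, c, hx, hy, hxy, hc, hks, hzx, hζx⟩ := exists_orthonormal_decomposition hn z hζ
  have hr : ‖z‖ ∈ Ico (0 : ℝ) 1 := ⟨norm_nonneg z, mem_ball_zero_iff.1 hz⟩
  have h1 := lintegral_enorm_kernel hn hα hx hy hxy k s hc hr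
  rw [← hzx, ← hζx] at h1
  rw [h1]
  calc _ ≤ ENNReal.ofReal (n + α + 1) *
        (ENNReal.ofReal (Real.Gamma (n + α + 1) / (Real.Gamma (n + α - 1) * Real.pi ^ 2)) *
          ballIntegral (n + α - 2) k s 1) := by
        gcongr
        exact ballIntegral_le_one _ _ _ hr
    _ = ENNReal.ofReal (CConst n α * ellipticE k) := by
        rw [ofReal_mul_ballIntegral_one hn hα hks, ← ENNReal.ofReal_mul (by linarith)]
        congr 1
        have : (n : ℝ) + α + 1 ≠ 0 := by linarith
        field_simp
    _ ≤ _ := by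
        refine ENNReal.ofReal_le_ofReal ?_
        rw [mul_comm]
        exact mul_le_mul_of_nonneg_right (ellipticE_le k) (CConst_pos hα).le

theorem enorm_invGrad_bergmanProj_le {n : ℕ} (hn : 2 ≤ n) {α : ℝ} (hα : -1 < α) (f : LInfty n)
    {z : Cn n} (hz : z ∈ unitBall n) :
    ‖invGrad (bergmanProj n α f) z‖ₑ ≤
      ENNReal.ofReal (‖f‖ * (Real.pi / 2 * CConst n α)) := by
  have hC := CConst_pos (n := n) hα
  have hpi := Real.pi_pos
  rw [← ofReal_norm, invGrad, norm_cgrad]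
  refine ENNReal.ofReal_le_ofReal ?_
  refine ContinuousLinearMap.opNorm_le_of_unit_norm (by positivity) fun ζ hζ => ?_
  rw [fderiv_bergmanProj_comp_ballAut hn hα f hz, ← ENNReal.ofReal_le_ofReal_iff (by positivity),
    ofReal_norm]
  calc _ ≤ ∫⁻ w, ‖f w * (kernelFactor n α z w * ip (ballAutDeriv z ζ) w)‖ₑ
        ∂(weightedMeasure n α) := enorm_integral_le_lintegral_enorm _
    _ ≤ ∫⁻ w, ENNReal.ofReal ‖f‖ * ‖kernelFactor n α z w * ip (ballAutDeriv z ζ) w‖ₑ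
        ∂(weightedMeasure n α) := by
      refine lintegral_mono_ae ?_
      filter_upwards [ae_norm_le_of_LInfty α f] with w hw
      rw [enorm_mul]
      gcongr
      rw [← ofReal_norm]
      exact ENNReal.ofReal_le_ofReal hw
    _ ≤ ENNReal.ofReal ‖f‖ * ENNReal.ofReal (Real.pi / 2 * CConst n α) := by
      rw [lintegral_const_mul _ (by fun_prop)]
      gcongr
      exact lintegral_enorm_kernel_le hn hα hz hζ
    _ = _ := by rw [← ENNReal.ofReal_mul (norm_nonneg _)]

theorem blochSeminorm_bergmanProj_le {n : ℕ} (hn : 2 ≤ n) {α : ℝ} (hα : -1 < α) (f : LInfty n) :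
    blochSeminorm (bergmanProj n α f) ≤ ENNReal.ofReal (‖f‖ * (Real.pi / 2 * CConst n α)) :=
  iSup₂_le fun _ hz => enorm_invGrad_bergmanProj_le hn hα f hz

theorem memBloch_bergmanProj {n : ℕ} (hn : 2 ≤ n) {α : ℝ} (hα : -1 < α) (f : LInfty n) :
    MemBloch (bergmanProj n α f) :=
  ⟨differentiableOn_bergmanProj hn hα f,
    (blochSeminorm_bergmanProj_le hn hα f).trans_lt ENNReal.ofReal_lt_top⟩

theorem projSeminorm_le {n : ℕ} (hn : 2 ≤ n) {α : ℝ} (hα : -1 < α) :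
    projSeminorm n α ≤ ENNReal.ofReal (Real.pi / 2 * CConst n α) := by
  refine iSup₂_le fun f hf => (blochSeminorm_bergmanProj_le hn hα f).trans ?_
  refine ENNReal.ofReal_le_ofReal (mul_le_of_le_one_left ?_ hf)
  have := CConst_pos (n := n) hα
  have := Real.pi_pos
  positivity

theorem bergmanProj_zero_eq {n : ℕ} (α : ℝ) (f : LInfty n) :
    bergmanProj n α f 0 = ∫ w, f w ∂(weightedMeasure n α) := by
  simp [bergmanProj, bergmanKernel, ip]

theorem projNorm_le_one_add_projSeminorm {n : ℕ} (hn : 2 ≤ n) {α : ℝ} (hα : -1 < α) :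
    projNorm n α ≤ 1 + projSeminorm n α := by
  have := isProbabilityMeasure_weightedMeasure hn hα
  refine iSup₂_le fun f hf => ?_
  refine add_le_add ?_ (le_iSup₂_of_le f hf le_rfl)
  rw [bergmanProj_zero_eq]
  refine (enorm_integral_le_lintegral_enorm _).trans ?_
  calc _ ≤ ∫⁻ _, 1 ∂(weightedMeasure n α) := by
        refine lintegral_mono_ae ?_
        filter_upwards [ae_norm_le_of_LInfty α f] with w hw
        rw [← ofReal_norm, ← ENNReal.ofReal_one]
        exact ENNReal.ofReal_le_ofReal (hw.trans hf)
    _ = 1 := by simp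

/-! ### The lower bound -/

theorem posPow_ne_top (β x : ℝ) : posPow β x ≠ ∞ := by
  unfold posPow
  split_ifs <;> simp

theorem lintegral_lintegral_le_liminf {F : ℕ → ℂ → ℂ → ℝ≥0∞} {G : ℂ → ℂ → ℝ≥0∞}
    (hF : ∀ j, Measurable fun p : ℂ × ℂ => F j p.1 p.2)
    (hG : ∀ u v, G u v ≤ Filter.liminf (fun j => F j u v) Filter.atTop) :
    ∫⁻ u, ∫⁻ v, G u v ≤ Filter.liminf (fun j => ∫⁻ u, ∫⁻ v, F j u v) Filter.atTop :=
  calc ∫⁻ u, ∫⁻ v, G u v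
      ≤ ∫⁻ u, ∫⁻ v, Filter.liminf (fun j => F j u v) Filter.atTop :=
        lintegral_mono fun u => lintegral_mono fun v => hG u v
    _ ≤ ∫⁻ u, Filter.liminf (fun j => ∫⁻ v, F j u v) Filter.atTop :=
        lintegral_mono fun _ => lintegral_liminf_le fun j => (hF j).comp measurable_prodMk_left
    _ ≤ Filter.liminf (fun j => ∫⁻ u, ∫⁻ v, F j u v) Filter.atTop :=
        lintegral_liminf_le fun j => (hF j).lintegral_prod_right'

theorem continuousAt_norm_div_rpow (β k s : ℝ) {u : ℂ} (hu : u ≠ 1) (v : ℂ) :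
    ContinuousAt (fun r : ℝ =>
      ‖(k * (r - u) + s * v : ℂ)‖ / ‖(1 - r * u : ℂ)‖ ^ (β + 3)) 1 := by
  have hne : ‖(1 - (1 : ℝ) * u : ℂ)‖ ≠ 0 := by
    rw [norm_ne_zero_iff, Complex.ofReal_one, one_mul]
    exact sub_ne_zero.2 hu.symm
  refine ContinuousAt.div (by fun_prop) ?_ ?_
  · exact ContinuousAt.rpow_const (by fun_prop) (Or.inl hne)
  · exact (Real.rpow_pos_of_pos (lt_of_le_of_ne (norm_nonneg _) hne.symm) _).ne'

/-- Fatou: off `u = 1` the integrand converges pointwise, and at `u = 1` the weight is zero. This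
half suffices, the reverse inequality being `ballIntegral_le_one`. -/
theorem ballIntegral_one_le_liminf (β k s : ℝ) {r : ℕ → ℝ}
    (hr : Filter.Tendsto r Filter.atTop (nhds 1)) :
    ballIntegral β k s 1 ≤ Filter.liminf (fun j => ballIntegral β k s (r j)) Filter.atTop := by
  unfold ballIntegral
  refine lintegral_lintegral_le_liminf (fun j => ?_) fun u v => ?_
  · have := (measurable_posPow β).comp
      (show Measurable fun p : ℂ × ℂ => 1 - ‖p.1‖ ^ 2 - ‖p.2‖ ^ 2 by fun_prop)
    exact Measurable.mul (by fun_prop) this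
  · rcases eq_or_ne u 1 with rfl | hu
    · rw [posPow_of_nonpos (by simp), mul_zero]
      exact zero_le
    · refine le_of_eq (Filter.Tendsto.liminf_eq ?_).symm
      exact ENNReal.Tendsto.mul_const (ENNReal.tendsto_ofReal
        ((continuousAt_norm_div_rpow β k s hu v).tendsto.comp hr)) (Or.inr (posPow_ne_top _ _))

/-- A test function of modulus at most one that aligns the phase of `κ` on `A` and equals `1`
off `A`. -/
theorem exists_phase_LInfty {n : ℕ} (α : ℝ) {κ : Cn n → ℂ} (hκ : Measurable κ) {A : Set (Cn n)}
    (hA : MeasurableSet A) :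
    ∃ f : LInfty n, ‖f‖ ≤ 1 ∧ ∀ᵐ w ∂(weightedMeasure n α),
      (w ∈ A → f w * κ w = (‖κ w‖ : ℂ)) ∧ (w ∉ A → f w = 1) := by
  classical
  let g : Cn n → ℂ := fun w => if w ∈ A then (starRingEnd ℂ) (κ w) / (‖κ w‖ : ℂ) else 1
  have hgm : Measurable g := by
    refine Measurable.ite hA ?_ measurable_const
    exact (Complex.continuous_conj.measurable.comp hκ).div
      (Complex.continuous_ofReal.measurable.comp hκ.norm)
  have hg1 : ∀ w, ‖g w‖ ≤ 1 := by
    intro w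
    simp only [g]
    split_ifs
    · rw [norm_div, RCLike.norm_conj, Complex.norm_real, norm_norm]
      exact div_self_le_one _
    · simp
  have hg : MemLp g ∞ (ballVolume n) :=
    memLp_top_of_bound hgm.aestronglyMeasurable 1 (Filter.Eventually.of_forall hg1)
  refine ⟨hg.toLp g, ?_, ?_⟩
  · rw [Lp.norm_toLp]
    refine ENNReal.toReal_le_of_le_ofReal zero_le_one ?_
    rw [eLpNorm_exponent_top]
    exact eLpNormEssSup_le_of_ae_bound (Filter.Eventually.of_forall hg1)
  · refine (weightedMeasure_absolutelyContinuous n α).ae_le ?_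
    filter_upwards [hg.coeFn_toLp] with w hw
    rw [hw]
    refine ⟨fun h => ?_, fun h => if_neg h⟩
    simp only [g, if_pos h]
    -- Where `κ` vanishes the quotient defining `g` is `0` by convention, and both sides are `0`.
    rcases eq_or_ne (κ w) 0 with h0 | h0
    · simp [h0]
    · have h1 : (‖κ w‖ : ℂ) ≠ 0 := by simpa using h0
      rw [div_mul_eq_mul_div, div_eq_iff h1, mul_comm, Complex.mul_conj']
      ring

/-- `|1 - f|` is at most `2` on `A` and zero elsewhere. -/
theorem one_sub_two_mul_measureReal_le {Ω : Type*} [MeasurableSpace Ω] {μ : Measure Ω}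
    [IsProbabilityMeasure μ] {f : Ω → ℂ} (hf : AEStronglyMeasurable f μ)
    (hf1 : ∀ᵐ w ∂μ, ‖f w‖ ≤ 1) {A : Set Ω} (hA : MeasurableSet A)
    (hfA : ∀ᵐ w ∂μ, w ∉ A → f w = 1) :
    1 - 2 * μ.real A ≤ ‖∫ w, f w ∂μ‖ := by
  have hi : Integrable f μ := Integrable.of_bound hf 1 hf1
  have h1 : ∫ w, (1 - f w) ∂μ = 1 - ∫ w, f w ∂μ := by
    rw [integral_sub (integrable_const _) hi]
    simp
  have h2 : ‖∫ w, (1 - f w) ∂μ‖ ≤ ∫ w, A.indicator (fun _ => (2 : ℝ)) w ∂μ := by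
    refine norm_integral_le_of_norm_le ((integrable_const _).indicator hA) ?_
    filter_upwards [hf1, hfA] with w hw hwA
    by_cases h : w ∈ A
    · rw [indicator_of_mem h]
      have := norm_sub_le (1 : ℂ) (f w)
      rw [norm_one] at this
      linarith
    · rw [indicator_of_notMem h, hwA h]
      simp
  rw [h1, integral_indicator_const _ hA, smul_eq_mul] at h2
  have h3 := norm_sub_norm_le (1 : ℂ) (∫ w, f w ∂μ)
  rw [norm_one] at h3
  linarith

/-- The defect `|κ| - f κ` vanishes on `A` and is at most `2M` in modulus off `A`, where the phase
is not aligned. -/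
theorem integral_norm_sub_le_norm_integral_mul {Ω : Type*} [MeasurableSpace Ω] {μ : Measure Ω}
    [IsProbabilityMeasure μ] {f κ : Ω → ℂ} (hf : AEStronglyMeasurable f μ)
    (hf1 : ∀ᵐ w ∂μ, ‖f w‖ ≤ 1) (hκ : Integrable κ μ) {A : Set Ω} {M : ℝ} (hM : 0 ≤ M)
    (hfA : ∀ᵐ w ∂μ, w ∈ A → f w * κ w = (‖κ w‖ : ℂ)) (hκA : ∀ᵐ w ∂μ, w ∉ A → ‖κ w‖ ≤ M) :
    ∫ w, ‖κ w‖ ∂μ - 2 * M ≤ ‖∫ w, f w * κ w ∂μ‖ := by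
  have hi : Integrable (fun w => f w * κ w) μ := hκ.bdd_mul hf hf1
  have h1 : ∫ w, ((‖κ w‖ : ℂ) - f w * κ w) ∂μ = (∫ w, ‖κ w‖ ∂μ : ℝ) - ∫ w, f w * κ w ∂μ := by
    rw [← integral_complex_ofReal]
    exact integral_sub hκ.norm.ofReal hi
  have h2 : ‖∫ w, ((‖κ w‖ : ℂ) - f w * κ w) ∂μ‖ ≤ ∫ _, 2 * M ∂μ := by
    refine norm_integral_le_of_norm_le (integrable_const _) ?_
    filter_upwards [hf1, hfA, hκA] with w hw hwA hwM
    by_cases h : w ∈ A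
    · rw [hwA h]
      simpa using hM
    · have := norm_sub_le (‖κ w‖ : ℂ) (f w * κ w)
      rw [norm_mul, Complex.norm_real, norm_norm] at this
      nlinarith [hwM h, norm_nonneg (κ w)]
  rw [h1] at h2
  have h3 := norm_sub_norm_le ((∫ w, ‖κ w‖ ∂μ : ℝ) : ℂ) (∫ w, f w * κ w ∂μ)
  rw [Complex.norm_real] at h3
  have h4 := le_abs_self (∫ w, ‖κ w‖ ∂μ)
  rw [Real.norm_eq_abs] at h3
  simp at h2
  linarith

/-- As `δ` decreases these sets shrink to `{⟨x,w⟩ = 1}`, which misses the open ball; continuity from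
above of a finite measure applies. -/
theorem exists_measureReal_norm_one_sub_ip_le {n : ℕ} (hn : 2 ≤ n) {α : ℝ} (hα : -1 < α)
    {x : Cn n} (hx : ‖x‖ = 1) {ε : ℝ} (hε : 0 < ε) :
    ∃ δ > 0, (weightedMeasure n α).real {w | ‖1 - ip x w‖ ≤ δ} < ε := by
  have := isProbabilityMeasure_weightedMeasure hn hα
  set s : ℝ → Set (Cn n) := fun δ => {w | ‖1 - ip x w‖ ≤ δ} with hs
  have hsm : ∀ δ, MeasurableSet (s δ) := fun δ => measurableSet_le (by fun_prop) (by fun_prop)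
  have h0 : (weightedMeasure n α) (⋂ δ > (0 : ℝ), s δ) = 0 := by
    rw [measure_eq_zero_iff_ae_notMem]
    filter_upwards [ae_mem_unitBall n α] with w hw h
    rw [mem_ball_zero_iff] at hw
    have h1 : ‖1 - ip x w‖ ≤ 0 :=
      le_of_forall_pos_le_add fun δ hδ => by
        rw [zero_add]
        exact mem_iInter₂.1 h δ hδ
    have h2 := norm_sub_norm_le (1 : ℂ) (ip x w)
    have h3 := norm_ip_le x w
    rw [norm_one] at h2
    rw [hx] at h3
    linarith
  have ht := tendsto_measure_biInter_gt (μ := weightedMeasure n α) (s := s) (a := 0)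
    (fun δ _ => (hsm δ).nullMeasurableSet) (fun i j _ hij w (hw : _ ≤ i) => hw.trans hij)
    ⟨1, one_pos, measure_ne_top _ _⟩
  rw [h0] at ht
  have he := (ht.eventually_lt_const (ENNReal.ofReal_pos.2 hε)).and self_mem_nhdsWithin
  obtain ⟨δ, hδ1, hδ2⟩ := he.exists
  refine ⟨δ, hδ2, ?_⟩
  exact (ENNReal.lt_ofReal_iff_toReal_lt (measure_ne_top _ _)).1 hδ1

/-- In the orthogonal direction the derivative of the automorphism is `-√(1-r²) y`, while `|1 -
r⟨x,w⟩| ≥ δ/2` because moving `r` to `1` costs at most `1-r ≤ δ/2`. -/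
theorem norm_kernel_le_of_lt {n : ℕ} {α : ℝ} (hα : -1 < α) {x y : Cn n} (hx : ‖x‖ = 1)
    (hy : ‖y‖ = 1) (hxy : inner ℂ x y = 0) {r δ : ℝ} (hr : r ∈ Ico (0 : ℝ) 1) (hδ : 0 < δ)
    (hrδ : 1 - r ≤ δ / 2) {w : Cn n} (hw : w ∈ unitBall n) (hδw : δ < ‖1 - ip x w‖) :
    ‖kernelFactor n α ((r : ℂ) • x) w * ip (ballAutDeriv ((r : ℂ) • x) y) w‖ ≤
      (n + α + 1) / (δ / 2) ^ (n + α + 2) * √(1 - r ^ 2) := by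
  have hn : (0 : ℝ) ≤ n := n.cast_nonneg
  have hw' : ‖w‖ < 1 := mem_ball_zero_iff.1 hw
  have h1 : ballAutDeriv ((r : ℂ) • x) y = -((√(1 - r ^ 2) : ℝ) : ℂ) • y := by
    have := ballAutDeriv_smul hx hxy hr.1 0 1 1
    simpa using this
  have h2 : ‖ip (ballAutDeriv ((r : ℂ) • x) y) w‖ ≤ √(1 - r ^ 2) := by
    refine (norm_ip_le _ _).trans ?_
    rw [h1, norm_smul, hy, norm_neg, Complex.norm_real, Real.norm_of_nonneg (Real.sqrt_nonneg _),
      mul_one]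
    exact mul_le_of_le_one_left (Real.sqrt_nonneg _) hw'.le
  have h3 : δ / 2 ≤ ‖1 - ip ((r : ℂ) • x) w‖ := by
    have e : ip ((r : ℂ) • x) w = r * ip x w := by rw [ip, inner_smul_right, ip]
    have e2 : 1 - ip x w = (1 - ip ((r : ℂ) • x) w) - ((1 - r : ℝ) : ℂ) * ip x w := by
      rw [e]; push_cast; ring
    have h4 := norm_sub_le (1 - ip ((r : ℂ) • x) w) (((1 - r : ℝ) : ℂ) * ip x w)
    rw [← e2, norm_mul, Complex.norm_real, Real.norm_of_nonneg (by linarith [hr.2])] at h4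
    have h5 := norm_ip_le x w
    rw [hx, mul_one] at h5
    nlinarith [hr.2]
  rw [norm_mul, norm_kernelFactor hα (smul_mem_unitBall hx hr) hw]
  refine mul_le_mul ?_ h2 (norm_nonneg _) (div_nonneg (by linarith) (by positivity))
  refine div_le_div_of_nonneg_left (by linarith) (by positivity) ?_
  exact Real.rpow_le_rpow (by positivity) h3 (by linarith)

theorem exists_lt_integral_norm_kernel {n : ℕ} (hn : 2 ≤ n) {α : ℝ} (hα : -1 < α) {x y : Cn n}
    (hx : ‖x‖ = 1) (hy : ‖y‖ = 1) (hxy : inner ℂ x y = 0) {ε δ : ℝ} (hε : 0 < ε) (hδ : 0 < δ) :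
    ∃ r ∈ Ico (0 : ℝ) 1, 1 - r ≤ δ / 2 ∧
      (n + α + 1) / (δ / 2) ^ (n + α + 2) * √(1 - r ^ 2) < ε ∧
      ENNReal.ofReal (Real.pi / 2 * CConst n α - ε) <
        ∫⁻ w, ‖kernelFactor n α ((r : ℂ) • x) w * ip (ballAutDeriv ((r : ℂ) • x) y) w‖ₑ
          ∂(weightedMeasure n α) := by
  have hn' : (2 : ℝ) ≤ n := by exact_mod_cast hn
  have hC := CConst_pos (n := n) hα
  have hpi := Real.pi_pos
  set r : ℕ → ℝ := fun j => 1 - 1 / ((j : ℝ) + 1) with hrdef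
  have hr1 : ∀ j, r j ∈ Ico (0 : ℝ) 1 := by
    intro j
    have h1 : (0 : ℝ) < 1 / ((j : ℝ) + 1) := by positivity
    have h2 : 1 / ((j : ℝ) + 1) ≤ 1 := by
      rw [div_le_one (by positivity)]
      linarith [(Nat.cast_nonneg j : (0 : ℝ) ≤ j)]
    exact ⟨by simp only [hrdef]; linarith, by simp only [hrdef]; linarith⟩
  have hr : Filter.Tendsto r Filter.atTop (nhds 1) := by
    simpa only [sub_zero] using (tendsto_one_div_add_atTop_nhds_zero_nat (𝕜 := ℝ)).const_sub 1
  set K : ℝ≥0∞ := ENNReal.ofReal (n + α + 1) *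
    ENNReal.ofReal (Real.Gamma (n + α + 1) / (Real.Gamma (n + α - 1) * Real.pi ^ 2)) with hK
  have hI : ∀ j, ∫⁻ w, ‖kernelFactor n α ((r j : ℂ) • x) w *
      ip (ballAutDeriv ((r j : ℂ) • x) y) w‖ₑ ∂(weightedMeasure n α) =
        K * ballIntegral (n + α - 2) 0 1 (r j) := by
    intro j
    have := lintegral_enorm_kernel hn hα hx hy hxy 0 1 (c := 1) (by simp) (hr1 j)
    rw [hK, mul_assoc, ← this]
    simp
  have hlim : ENNReal.ofReal (Real.pi / 2 * CConst n α) =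
      K * ballIntegral (n + α - 2) 0 1 1 := by
    -- The direction `y` orthogonal to `x` is the case `k = 0`, `s = 1`, where `E` takes its maximal
    -- value `π/2`.
    rw [hK, mul_assoc, ofReal_mul_ballIntegral_one hn hα (by norm_num), ellipticE_zero,
      ← ENNReal.ofReal_mul (by linarith)]
    congr 1
    have : (n : ℝ) + α + 1 ≠ 0 := by linarith
    field_simp
  have hliminf : ENNReal.ofReal (Real.pi / 2 * CConst n α) ≤
      Filter.liminf (fun j => K * ballIntegral (n + α - 2) 0 1 (r j)) Filter.atTop := by
    rw [hlim]
    rw [ENNReal.liminf_const_mul_of_ne_top (ENNReal.mul_ne_top (by simp) (by simp))]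
    gcongr
    exact ballIntegral_one_le_liminf _ 0 1 hr
  have he1 : ∀ᶠ j in Filter.atTop, ENNReal.ofReal (Real.pi / 2 * CConst n α - ε) <
      K * ballIntegral (n + α - 2) 0 1 (r j) := by
    refine Filter.eventually_lt_of_lt_liminf (lt_of_lt_of_le ?_ hliminf)
    exact (ENNReal.ofReal_lt_ofReal_iff (by positivity)).2 (by linarith)
  have he2 : ∀ᶠ j in Filter.atTop, 1 - r j < δ / 2 :=
    (hr.const_sub 1).eventually_lt_const (by simpa using hδ)
  have he3 : ∀ᶠ j in Filter.atTop,
      (n + α + 1) / (δ / 2) ^ (n + α + 2) * √(1 - r j ^ 2) < ε := by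
    have hc : Continuous fun a : ℝ => (n + α + 1) / (δ / 2) ^ (n + α + 2) * √(1 - a ^ 2) := by
      fun_prop
    refine ((hc.tendsto 1).comp hr).eventually_lt_const ?_
    simpa using hε
  obtain ⟨j, h1, h2, h3⟩ := (he1.and (he2.and he3)).exists
  exact ⟨r j, hr1 j, h2.le, h3, by rw [hI]; exact h1⟩

theorem ofReal_one_add_le_projNorm {n : ℕ} (hn : 2 ≤ n) {α : ℝ} (hα : -1 < α) :
    ENNReal.ofReal (1 + Real.pi / 2 * CConst n α) ≤ projNorm n α := by
  have := isProbabilityMeasure_weightedMeasure hn hα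
  obtain ⟨x, y, hx, hy, hxy⟩ : ∃ x y : Cn n, ‖x‖ = 1 ∧ ‖y‖ = 1 ∧ inner ℂ x y = 0 := by
    refine ⟨EuclideanSpace.single ⟨0, by lia⟩ 1, EuclideanSpace.single ⟨1, by lia⟩ 1,
      by simp, by simp, ?_⟩
    rw [EuclideanSpace.inner_single_left]
    simp
  refine ENNReal.le_of_forall_pos_le_add fun ε hε _ => ?_
  have hη : (0 : ℝ) < ε / 5 := by positivity
  -- The error budget is `5η`: `2η` from the measure of `A` in `P_α f(0)`, `2η` from the kernel off
  -- `A`, and `η` from the `L¹` norm at this `r`.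
  set η : ℝ := ε / 5 with hηdef
  obtain ⟨δ, hδ, hμ⟩ := exists_measureReal_norm_one_sub_ip_le hn hα hx hη
  obtain ⟨r, hr, hrδ, hM, hI⟩ := exists_lt_integral_norm_kernel hn hα hx hy hxy hη hδ
  set A : Set (Cn n) := {w | ‖1 - ip x w‖ ≤ δ} with hA
  have hAm : MeasurableSet A := measurableSet_le (by fun_prop) (by fun_prop)
  set κ : Cn n → ℂ := fun w =>
    kernelFactor n α ((r : ℂ) • x) w * ip (ballAutDeriv ((r : ℂ) • x) y) w with hκ
  have hκm : Measurable κ := by fun_prop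
  have hz := smul_mem_unitBall hx hr
  have hκfin : ∫⁻ w, ‖κ w‖ₑ ∂(weightedMeasure n α) < ∞ :=
    (lintegral_enorm_kernel_le hn hα hz hy).trans_lt ENNReal.ofReal_lt_top
  have hκi : Integrable κ (weightedMeasure n α) := ⟨hκm.aestronglyMeasurable, hκfin⟩
  obtain ⟨f, hf1, hf⟩ := exists_phase_LInfty α hκm hAm
  have hfle : ∀ᵐ w ∂(weightedMeasure n α), ‖f w‖ ≤ 1 :=
    (ae_norm_le_of_LInfty α f).mono fun w hw => hw.trans hf1
  have hfm := aestronglyMeasurable_LInfty α f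
  have h1 := one_sub_two_mul_measureReal_le hfm hfle hAm (hf.mono fun w hw => hw.2)
  have hn' : (0 : ℝ) ≤ n := n.cast_nonneg
  have hn2 : (2 : ℝ) ≤ n := by exact_mod_cast hn
  have h2 := integral_norm_sub_le_norm_integral_mul hfm hfle hκi
    (M := (n + α + 1) / (δ / 2) ^ (n + α + 2) * √(1 - r ^ 2))
    (mul_nonneg (div_nonneg (by linarith) (by positivity)) (by positivity))
    (hf.mono fun w hw => hw.1) (by
      filter_upwards [ae_mem_unitBall n α] with w hw hwA
      exact norm_kernel_le_of_lt hα hx hy hxy hr hδ hrδ hw (not_le.1 hwA))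
  have h3 : Real.pi / 2 * CConst n α - η < ∫ w, ‖κ w‖ ∂(weightedMeasure n α) := by
    rw [integral_norm_eq_lintegral_enorm hκm.aestronglyMeasurable]
    rw [← ENNReal.ofReal_toReal hκfin.ne] at hI
    exact (ENNReal.ofReal_lt_ofReal_iff'.1 hI).1
  rw [← bergmanProj_zero_eq] at h1
  rw [← fderiv_bergmanProj_comp_ballAut hn hα f hz] at h2
  have h4 : ‖fderiv ℂ (bergmanProj n α f ∘ ballAut ((r : ℂ) • x)) 0 y‖ ≤
      ‖invGrad (bergmanProj n α f) ((r : ℂ) • x)‖ := by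
    rw [invGrad, norm_cgrad]
    simpa [hy] using ContinuousLinearMap.le_opNorm
      (fderiv ℂ (bergmanProj n α f ∘ ballAut ((r : ℂ) • x)) 0) y
  have h5 : ‖bergmanProj n α f 0‖ₑ + ‖invGrad (bergmanProj n α f) ((r : ℂ) • x)‖ₑ ≤
      projNorm n α :=
    le_iSup₂_of_le f hf1 (add_le_add le_rfl
      (le_iSup₂ (f := fun z (_ : z ∈ unitBall n) => ‖invGrad (bergmanProj n α f) z‖ₑ) _ hz))
  refine le_trans ?_ (add_le_add_left h5 (ε : ℝ≥0∞))
  rw [← ofReal_norm, ← ofReal_norm, ← ENNReal.ofReal_coe_nnreal,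
    ← ENNReal.ofReal_add (norm_nonneg _) (norm_nonneg _),
    ← ENNReal.ofReal_add (by positivity) (by positivity)]
  refine ENNReal.ofReal_le_ofReal ?_
  have : (ε : ℝ) = 5 * η := by rw [hηdef]; ring
  linarith

/-- No separate test function is needed: subtracting the contribution of `|P_α f(0)|`, at most `1`,
from the lower bound for the full norm gives the one for the semi-norm. -/
theorem projSeminorm_eq {n : ℕ} (hn : 2 ≤ n) {α : ℝ} (hα : -1 < α) :
    projSeminorm n α = ENNReal.ofReal (Real.pi / 2 * CConst n α) := by
  have hC := CConst_pos (n := n) hα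
  have hpi := Real.pi_pos
  refine le_antisymm (projSeminorm_le hn hα) ?_
  have h := (ofReal_one_add_le_projNorm hn hα).trans (projNorm_le_one_add_projSeminorm hn hα)
  rw [ENNReal.ofReal_add zero_le_one (by positivity), ENNReal.ofReal_one] at h
  exact (ENNReal.add_le_add_iff_left ENNReal.one_ne_top).1 h

theorem projNorm_eq {n : ℕ} (hn : 2 ≤ n) {α : ℝ} (hα : -1 < α) :
    projNorm n α = ENNReal.ofReal (1 + Real.pi / 2 * CConst n α) := by
  have hC := CConst_pos (n := n) hα
  have hpi := Real.pi_pos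
  refine le_antisymm ((projNorm_le_one_add_projSeminorm hn hα).trans ?_)
    (ofReal_one_add_le_projNorm hn hα)
  rw [projSeminorm_eq hn hα, ENNReal.ofReal_add zero_le_one (by positivity), ENNReal.ofReal_one]

end BergmanBloch

end

theorem theorem2 (n : ℕ) (hn : 2 ≤ n) (α : ℝ) (hα : -1 < α) :
    (∀ f : BergmanBloch.LInfty n, BergmanBloch.MemBloch (BergmanBloch.bergmanProj n α f)) ∧
    BergmanBloch.projSeminorm n α =
      ENNReal.ofReal (Real.pi / 2 * BergmanBloch.CConst n α) ∧
    BergmanBloch.projNorm n α =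
      ENNReal.ofReal (1 + Real.pi / 2 * BergmanBloch.CConst n α) ∧
    (∀ t ∈ Icc 0 (Real.pi / 2),
      Integrable (BergmanBloch.lIntegrand n hn α t) (BergmanBloch.weightedMeasure n α)) ∧
    (∀ t ∈ Ioc 0 (Real.pi / 2),
      Summable (fun m : ℕ => BergmanBloch.coeffA m * Real.cos t ^ (2 * m)) ∧
      BergmanBloch.lFun n hn α t = BergmanBloch.CConst n α * Real.sin t ^ 2 *
        ∑' m : ℕ, BergmanBloch.coeffA m * Real.cos t ^ (2 * m)) ∧
    StrictMonoOn (BergmanBloch.lFun n hn α) (Icc 0 (Real.pi / 2)) := by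
  refine ⟨BergmanBloch.memBloch_bergmanProj hn hα, BergmanBloch.projSeminorm_eq hn hα,
    BergmanBloch.projNorm_eq hn hα, fun t _ => BergmanBloch.integrable_lIntegrand hn hα t,
    fun t ht => ?_, BergmanBloch.strictMonoOn_lFun hn hα⟩
  have hcos := BergmanBloch.abs_cos_lt_one_of_mem_Ioc ht
  refine ⟨(BergmanBloch.hasSum_coeffA hcos).summable, ?_⟩
  -- The factor `1 - k²` at `k = cos t` is `sin² t`.
  rw [BergmanBloch.lFun_eq hn hα, BergmanBloch.ellipticE_eq_tsum hcos, Real.sin_sq, mul_assoc]
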